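/- **Setting.** Let $k,\Omega>0$, $\alpha,\beta\in\mathbb R$ and let $m\ge 1$ be an integer. For Delaunay elements $(L,G,\ell,g)$ with $0<|G|<L$ and angles $\ell,g$ modulo $2\pi$, put $a=L^2/k$, $e=\sqrt{1-G^2/L^2}\in(0,1)$, $\omega=\sqrt{k/a^3}$. Let $\hat u$ be the eccentric anomaly, $\hat u-e\sin\hat u=\ell$, and let $r,\theta=g+v$ be given by $r\cos v=a(\cos\hat u-e)$, $r\sin v=a\sqrt{1-e^2}\,\sin\hat u$. Put $\mathcal C=r^2\cos2\theta$, $\mathcal S=r^2\sin2\theta$ as functions of $(L,G,\ell,g)$, $$\phi(t)=\Omega^2\{\cos2\Omega t+\tfrac\delta2[(\alpha-\beta)\cos\Omega t+(\alpha+\beta)\cos3\Omega t]\},\quad \psi(t)=\Omega^2\{\sin2\Omega t+\tfrac\delta2[(\alpha-\beta)\sin\Omega t+(\alpha+\beta)\sin3\Omega t]\},$$ and consider the system $$\dot L=-\epsilon(\mathcal C_\ell\phi+\mathcal S_\ell\psi),\quad \dot G=-\epsilon(\mathcal C_g\phi+\mathcal S_g\psi),\quad \dot\ell=\omega+\epsilon(\mathcal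 C_L\phi+\mathcal S_L\psi),\quad \dot g=\epsilon(\mathcal C_G\phi+\mathcal S_G\psi).\tag{1}$$ With $J_\nu$ the Bessel function of the first kind and integer order $\nu\geq 1$, let $U_\nu=A_\nu+B_\nu$, where $$A_\nu(e)=\tfrac{4}{\nu^2e^2}\bigl(2\nu e(1-e^2)J_\nu'(\nu e)-(2-e^2)J_\nu(\nu e)\bigr),\quad B_\nu(e)=-\tfrac{8}{\nu^2e^2}\sqrt{1-e^2}\,\bigl(eJ_\nu'(\nu e)-\nu(1-e^2)J_\nu(\nu e)\bigr).$$ With angles read modulo $2\pi$, let $\mathcal Z_1^+$, respectively $\mathcal Z_1^-$, be the set of $(e,\ell,g)$ with $U_{2m}'(e)=0$ and $2g+2m\ell=0$, respectively $=\pi$; let $\mathcal Z_2^+$, respectively $\mathcal Z_2^-$, be the set of $(e,\ell,g)$ with $U_{2m}(e)=0$ and $2g+2m\ell=\pi/2$, respectively $=3\pi/2$. **Theorem.** Let $0<|G|<L$ and let $(L,G,\ell,g)$ lie on an $(m:1)$ resonant Keplerian ellipse, $L^3=mk^2/\Omega$, with eccentricity $e$. Suppose that either * $(e,\ell,g)\in\mathcal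 Z_1^+\cup\mathcal Z_1^-$ and $(\alpha-\beta)U_m(e)+(\alpha+\beta)U_{3m}(e)\ne0$, or * $(e,\ell,g)\in\mathcal Z_2^+\cup\mathcal Z_2^-$ and $(\alpha-\beta)U_m(e)-(\alpha+\beta)U_{3m}(e)\ne0$, and that, in either case, $\sin(2g+m\ell)=0$. Then the Keplerian ellipse continues to a periodic orbit for small $\delta\ne0$, in the following sense. There are $\delta_0>0$ and a continuous curve $\Upsilon$ on $(-\delta_0,\delta_0)$ of points of the phase space with $\Upsilon(0)=(L,G,\ell,g)$ such that, for every $\delta$ with $0<|\delta|<\delta_0$, the point $\Upsilon(\delta)$ has the same first coordinate $L$ and there are $\epsilon_0>0$ and a continuous curve $\epsilon\mapsto\kappa(\epsilon)$ on $(-\epsilon_0,\epsilon_0)$ with $\kappa(0)=\Upsilon(\delta)$ for which the solution of (1) starting at time $0$ at $\kappa(\epsilon)$ exists for all times, stays in $0<|G|<L$, and is periodic with period $2\pi m/\Omega$ (angles modulo $2\pi$). -/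

import Mathlib

namespace KeplerWave

noncomputable section

/-! ### Bessel functions and the Fourier coefficients -/

/-- The Bessel function of the first kind `J_n` of integer order `n`, through Bessel's integral
`J_n(x) = (1/π) ∫_0^π cos (n τ - x sin τ) dτ`. -/
def besselJ (n : ℕ) (x : ℝ) : ℝ :=
  (1 / Real.pi) * ∫ τ in (0 : ℝ)..Real.pi, Real.cos (n * τ - x * Real.sin τ)

/-- `A_ν(e) = 4/(ν²e²) (2 ν e (1-e²) J_ν'(νe) - (2-e²) J_ν(νe))`. -/
def coeffA (ν : ℕ) (e : ℝ) : ℝ :=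
  4 / ((ν : ℝ) ^ 2 * e ^ 2) *
    (2 * ν * e * (1 - e ^ 2) * deriv (besselJ ν) (ν * e) - (2 - e ^ 2) * besselJ ν (ν * e))

/-- `B_ν(e) = -8/(ν²e²) √(1-e²) (e J_ν'(νe) - ν (1-e²) J_ν(νe))`. -/
def coeffB (ν : ℕ) (e : ℝ) : ℝ :=
  -(8 / ((ν : ℝ) ^ 2 * e ^ 2)) * Real.sqrt (1 - e ^ 2) *
    (e * deriv (besselJ ν) (ν * e) - ν * (1 - e ^ 2) * besselJ ν (ν * e))

/-- `U_ν = A_ν + B_ν`. -/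
def coeffU (ν : ℕ) (e : ℝ) : ℝ := coeffA ν e + coeffB ν e

/-! ### Delaunay elements and the osculating ellipse -/

/-- Delaunay elements `(L, G, ℓ, g)`; the angles `ℓ` and `g` are represented by real lifts. -/
abbrev Delaunay : Type := ℝ × ℝ × ℝ × ℝ

/-- Equality of two points of the phase space, where the last two coordinates are angles
modulo `2π`. -/
def SamePoint (p q : Delaunay) : Prop :=
  p.1 = q.1 ∧ p.2.1 = q.2.1 ∧
    (p.2.2.1 : Real.Angle) = (q.2.2.1 : Real.Angle) ∧
    (p.2.2.2 : Real.Angle) = (q.2.2.2 : Real.Angle)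

/-- The noncircular, nondegenerate Keplerian ellipses: `0 < |G| < L`, that is `0 < e < 1`. -/
def ellipses : Set Delaunay := {p | 0 < p.1 ∧ p.2.1 ≠ 0 ∧ |p.2.1| < p.1}

/-- Semimajor axis `a = L²/k`. -/
def semimajor (k L : ℝ) : ℝ := L ^ 2 / k

/-- Eccentricity `e = √(1 - G²/L²)`. -/
def eccentricity (L G : ℝ) : ℝ := Real.sqrt (1 - G ^ 2 / L ^ 2)

/-- Keplerian frequency `ω`, with `ω² = k/a³`. -/
def keplerFreq (k L : ℝ) : ℝ := Real.sqrt (k / semimajor k L ^ 3)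

/-- The eccentric anomaly: the solution `u` of Kepler's equation `u - e sin u = ℓ`. -/
def eccAnomaly (e l : ℝ) : ℝ := Function.invFun (fun u : ℝ => u - e * Real.sin u) l

theorem exists_kepler {e : ℝ} (h0 : 0 ≤ e) (h1 : e < 1) (l : ℝ) :
    ∃ u : ℝ, u - e * Real.sin u = l := by
  have hc : ContinuousOn (fun u : ℝ => u - e * Real.sin u) (Set.Icc (l - 1) (l + 1)) := by
    fun_prop
  have hsub := intermediate_value_Icc (by linarith : l - 1 ≤ l + 1) hc
  have hl : l ∈ Set.Icc ((l - 1) - e * Real.sin (l - 1)) ((l + 1) - e * Real.sin (l + 1)) := by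
    constructor
    · nlinarith [Real.neg_one_le_sin (l - 1)]
    · nlinarith [Real.sin_le_one (l + 1)]
  obtain ⟨u, -, hu⟩ := hsub hl
  exact ⟨u, hu⟩

/-- Kepler's equation holds for the eccentric anomaly when `0 ≤ e < 1`. -/
theorem eccAnomaly_spec {e : ℝ} (h0 : 0 ≤ e) (h1 : e < 1) (l : ℝ) :
    eccAnomaly e l - e * Real.sin (eccAnomaly e l) = l :=
  Function.invFun_eq (f := fun u : ℝ => u - e * Real.sin u) (exists_kepler h0 h1 l)

/-- `x/a = cos û - e = (r/a) cos v` in the frame of the ellipse (`v` is the true anomaly). -/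
def orbX (e l : ℝ) : ℝ := Real.cos (eccAnomaly e l) - e

/-- `y/a = √(1-e²) sin û = (r/a) sin v` in the frame of the ellipse. -/
def orbY (e l : ℝ) : ℝ := Real.sqrt (1 - e ^ 2) * Real.sin (eccAnomaly e l)

/-- Cartesian coordinate `r cos θ`, where `θ = g + v`. -/
def posX (k L G l g : ℝ) : ℝ :=
  semimajor k L *
    (orbX (eccentricity L G) l * Real.cos g - orbY (eccentricity L G) l * Real.sin g)

/-- Cartesian coordinate `r sin θ`, where `θ = g + v`. -/
def posY (k L G l g : ℝ) : ℝ :=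
  semimajor k L *
    (orbX (eccentricity L G) l * Real.sin g + orbY (eccentricity L G) l * Real.cos g)

/-- `𝒞 = r² cos 2θ = (r cos θ)² - (r sin θ)²` in Delaunay elements. -/
def quadC (k L G l g : ℝ) : ℝ := posX k L G l g ^ 2 - posY k L G l g ^ 2

/-- `𝒮 = r² sin 2θ = 2 (r cos θ) (r sin θ)` in Delaunay elements. -/
def quadS (k L G l g : ℝ) : ℝ := 2 * posX k L G l g * posY k L G l g

/-! ### The perturbed system -/

/-- The constants of the model: `k`, the basic wave frequency `Ω`, the amplitudes `α`, `β`. -/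
structure Params where
  k : ℝ
  Ω : ℝ
  α : ℝ
  β : ℝ

/-- `φ(t) = Ω² {cos 2Ωt + (δ/2) [(α-β) cos Ωt + (α+β) cos 3Ωt]}`. -/
def wavePhi (P : Params) (δ t : ℝ) : ℝ :=
  P.Ω ^ 2 * (Real.cos (2 * P.Ω * t) +
    δ / 2 * ((P.α - P.β) * Real.cos (P.Ω * t) + (P.α + P.β) * Real.cos (3 * P.Ω * t)))

/-- `ψ(t) = Ω² {sin 2Ωt + (δ/2) [(α-β) sin Ωt + (α+β) sin 3Ωt]}`. -/
def wavePsi (P : Params) (δ t : ℝ) : ℝ :=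
  P.Ω ^ 2 * (Real.sin (2 * P.Ω * t) +
    δ / 2 * ((P.α - P.β) * Real.sin (P.Ω * t) + (P.α + P.β) * Real.sin (3 * P.Ω * t)))

/-- The right-hand side of the equations of motion in Delaunay elements. -/
def field (P : Params) (δ ε t : ℝ) : Delaunay → Delaunay
  | (L, G, l, g) =>
    ( -ε * (deriv (fun x => quadC P.k L G x g) l * wavePhi P δ t +
            deriv (fun x => quadS P.k L G x g) l * wavePsi P δ t),
      -ε * (deriv (fun x => quadC P.k L G l x) g * wavePhi P δ t +
            deriv (fun x => quadS P.k L G l x) g * wavePsi P δ t),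
      keplerFreq P.k L +
        ε * (deriv (fun x => quadC P.k x G l g) L * wavePhi P δ t +
             deriv (fun x => quadS P.k x G l g) L * wavePsi P δ t),
      ε * (deriv (fun x => quadC P.k L x l g) G * wavePhi P δ t +
           deriv (fun x => quadS P.k L x l g) G * wavePsi P δ t) )

/-- A solution of the perturbed system, defined for all times. -/
def IsSolution (P : Params) (δ ε : ℝ) (u : ℝ → Delaunay) : Prop :=
  ∀ t : ℝ, u t ∈ ellipses ∧ HasDerivAt u (field P δ ε t (u t)) t

/-- The initial point `ζ` of an unperturbed (`ε = 0`) orbit is continuable, for the fixed value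
`δ`: there is a continuous curve `ε ↦ κ ε` with `κ 0 = ζ` such that, for all small `ε`, the
solution of the perturbed system that starts at time `0` at `κ ε` is periodic with period
`2πm/Ω` (`κ ε` is a fixed point of the `m`-th order Poincaré map). -/
def Continuable (P : Params) (δ : ℝ) (m : ℕ) (ζ : Delaunay) : Prop :=
  ∃ ε₀ > 0, ∃ κ : ℝ → Delaunay,
    ContinuousOn κ (Set.Ioo (-ε₀) ε₀) ∧ κ 0 = ζ ∧
    ∀ ε ∈ Set.Ioo (-ε₀) ε₀, ∃ u : ℝ → Delaunay,
      IsSolution P δ ε u ∧ u 0 = κ ε ∧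
      ∀ t : ℝ, SamePoint (u (t + 2 * Real.pi * m / P.Ω)) (u t)

/-! ### The zero sets of the unperturbed bifurcation function, in the variables `(e, ℓ, g)` -/

/-- `2g + 2mℓ = 0` (as an angle) and `U_{2m}'(e) = 0`. -/
def Z1plus (m : ℕ) : Set (ℝ × ℝ × ℝ) :=
  {p | ((2 * p.2.2 + 2 * m * p.2.1 : ℝ) : Real.Angle) = ((0 : ℝ) : Real.Angle) ∧
    deriv (coeffU (2 * m)) p.1 = 0}

/-- `2g + 2mℓ = π` (as an angle) and `U_{2m}'(e) = 0`. -/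
def Z1minus (m : ℕ) : Set (ℝ × ℝ × ℝ) :=
  {p | ((2 * p.2.2 + 2 * m * p.2.1 : ℝ) : Real.Angle) = (Real.pi : Real.Angle) ∧
    deriv (coeffU (2 * m)) p.1 = 0}

/-- `2g + 2mℓ = π/2` (as an angle) and `U_{2m}(e) = 0`. -/
def Z2plus (m : ℕ) : Set (ℝ × ℝ × ℝ) :=
  {p | ((2 * p.2.2 + 2 * m * p.2.1 : ℝ) : Real.Angle) = ((Real.pi / 2 : ℝ) : Real.Angle) ∧
    coeffU (2 * m) p.1 = 0}

/-- `2g + 2mℓ = 3π/2` (as an angle) and `U_{2m}(e) = 0`. -/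
def Z2minus (m : ℕ) : Set (ℝ × ℝ × ℝ) :=
  {p | ((2 * p.2.2 + 2 * m * p.2.1 : ℝ) : Real.Angle) = ((3 * Real.pi / 2 : ℝ) : Real.Angle) ∧
    coeffU (2 * m) p.1 = 0}

end

end KeplerWave

open KeplerWave

/-!
The periodic solutions are found by averaging and Lyapunov-Schmidt reduction.

Fix `δ`, put `T = 2πm/Ω`, and write a solution as a `T`-periodic slow curve plus the resonant drift
`ℓ = Ωt/m`. The integral equation for the slow curve, in which the means of the time derivatives of
`L`, `G`, `g` are divided by `ε`, is a strictly differentiable equation in `C([0, T])`. Its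
linearization at a constant is invertible as soon as the Kepler frequency has nonzero derivative in
`L` and the perturbing function averaged along the resonant motion has a nondegenerate critical
point in `(G, ℓ, g)`
(`linearized_bijective`, `exists_periodic_solution_arc`, `continuable_of_nondegenerate`).

The averaged function is a positive multiple of
`U_{2m}(e) cos ξ + (δ/2) [(α-β) U_m(e) cos η + (α+β) U_{3m}(e) cos (2ξ - η)]`, where `ξ = 2g + 2mℓ`
and `η = 2g + mℓ`: by oddness and orthogonality only three harmonics survive, and their coefficients
are computed in the eccentric anomaly by an integration by parts (`integral_orb`, `averaged_eq`).
After division of its `η`-derivative by `δ/2`, its gradient stays nondegenerate at `δ = 0`, and the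
implicit function theorem gives the curve `Υ` (`bifurcation_nondegenerate`,
`exists_nondegenerate_curve`).

Nondegeneracy in the directions `(e, ξ)` is not among the hypotheses: it needs that for `ν ≥ 2` the
zeros of `U_ν` in `(0, 1)` are simple and its critical points nondegenerate. By Bessel's equation
`U_ν` and all its derivatives are combinations of `J_ν(νe)` and `J_ν'(νe)`, which are positive
there. Eliminating these two from `U_ν = U_ν' = 0`, resp. from `U_ν' = U_ν'' = 0`, leaves an
algebraic equation for `e`, and at its solutions the first of the two functions has a strict sign
(`deriv_coeffU_ne_zero`, `deriv_deriv_coeffU_ne_zero`).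
-/

namespace KeplerWave

open Real Filter Topology

/-! ### Bessel's integral -/

/-- Bessel's integral `∫₀^π cos (n τ - z sin τ) dτ = π J_n(z)` for an arbitrary integer order. -/
noncomputable def besselInt (n : ℤ) (z : ℝ) : ℝ :=
  ∫ τ in (0 : ℝ)..π, cos (n * τ - z * sin τ)

/-- The derivative of Bessel's integral with respect to the argument. -/
noncomputable def besselIntDeriv (n : ℤ) (z : ℝ) : ℝ :=
  ∫ τ in (0 : ℝ)..π, sin τ * sin (n * τ - z * sin τ)

/-- The moment of Bessel's integrand against `cos τ`. -/
noncomputable def besselMoment (n : ℤ) (z : ℝ) : ℝ :=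
  ∫ τ in (0 : ℝ)..π, cos τ * cos (n * τ - z * sin τ)

lemma besselJ_eq (n : ℕ) (z : ℝ) : besselJ n z = 1 / π * besselInt n z := by
  simp [besselJ, besselInt]

lemma hasDerivAt_besselPhase (n : ℤ) (z τ : ℝ) :
    HasDerivAt (fun τ : ℝ => n * τ - z * sin τ) (n - z * cos τ) τ := by
  exact (((hasDerivAt_id τ).const_mul (n : ℝ)).sub ((hasDerivAt_sin τ).const_mul z)).congr_deriv
    (by ring)

lemma sin_besselPhase_pi (n : ℤ) (z : ℝ) : sin (n * π - z * sin π) = 0 := by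
  simp [sin_int_mul_pi]

lemma mul_besselMoment (n : ℤ) (z : ℝ) : z * besselMoment n z = n * besselInt n z := by
  have h := intervalIntegral.integral_eq_sub_of_hasDerivAt (a := 0) (b := π)
    (f := fun τ => sin (n * τ - z * sin τ))
    (f' := fun τ => n * cos (n * τ - z * sin τ) - z * (cos τ * cos (n * τ - z * sin τ)))
    (fun τ _ => by
      have := (hasDerivAt_besselPhase n z τ).sin
      exact this.congr_deriv (by ring))
    (Continuous.intervalIntegrable (by fun_prop) _ _)
  rw [intervalIntegral.integral_sub (Continuous.intervalIntegrable (by fun_prop) _ _)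
    (Continuous.intervalIntegrable (by fun_prop) _ _), intervalIntegral.integral_const_mul,
    intervalIntegral.integral_const_mul, sin_besselPhase_pi] at h
  simp only [mul_zero, sin_zero, sub_zero] at h
  simp only [besselMoment, besselInt]
  linarith

lemma mul_integral_cos_sq_mul_cos (n : ℤ) (z : ℝ) :
    z * (∫ τ in (0 : ℝ)..π, cos τ ^ 2 * cos (n * τ - z * sin τ)) =
      n * besselMoment n z - besselIntDeriv n z := by
  have h := intervalIntegral.integral_eq_sub_of_hasDerivAt (a := 0) (b := π)
    (f := fun τ => cos τ * sin (n * τ - z * sin τ))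
    (f' := fun τ => n * (cos τ * cos (n * τ - z * sin τ)) - sin τ * sin (n * τ - z * sin τ)
      - z * (cos τ ^ 2 * cos (n * τ - z * sin τ)))
    (fun τ _ => by
      have := (hasDerivAt_cos τ).mul (hasDerivAt_besselPhase n z τ).sin
      exact this.congr_deriv (by ring))
    (Continuous.intervalIntegrable (by fun_prop) _ _)
  rw [intervalIntegral.integral_sub (Continuous.intervalIntegrable (by fun_prop) _ _)
    (Continuous.intervalIntegrable (by fun_prop) _ _),
    intervalIntegral.integral_sub (Continuous.intervalIntegrable (by fun_prop) _ _)
    (Continuous.intervalIntegrable (by fun_prop) _ _), intervalIntegral.integral_const_mul,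
    intervalIntegral.integral_const_mul, sin_besselPhase_pi] at h
  simp only [mul_zero, sin_zero, sub_zero] at h
  simp only [besselMoment, besselIntDeriv]
  linarith

lemma mul_integral_sin_mul_cos_mul_sin (n : ℤ) (z : ℝ) :
    z * (∫ τ in (0 : ℝ)..π, sin τ * cos τ * sin (n * τ - z * sin τ)) =
      n * besselIntDeriv n z - besselMoment n z := by
  have h := intervalIntegral.integral_eq_sub_of_hasDerivAt (a := 0) (b := π)
    (f := fun τ => sin τ * cos (n * τ - z * sin τ))
    (f' := fun τ => cos τ * cos (n * τ - z * sin τ) - n * (sin τ * sin (n * τ - z * sin τ))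
      + z * (sin τ * cos τ * sin (n * τ - z * sin τ)))
    (fun τ _ => by
      have := (hasDerivAt_sin τ).mul (hasDerivAt_besselPhase n z τ).cos
      exact this.congr_deriv (by ring))
    (Continuous.intervalIntegrable (by fun_prop) _ _)
  rw [intervalIntegral.integral_add (Continuous.intervalIntegrable (by fun_prop) _ _)
    (Continuous.intervalIntegrable (by fun_prop) _ _),
    intervalIntegral.integral_sub (Continuous.intervalIntegrable (by fun_prop) _ _)
    (Continuous.intervalIntegrable (by fun_prop) _ _), intervalIntegral.integral_const_mul,
    intervalIntegral.integral_const_mul] at h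
  simp only [sin_pi, sin_zero, zero_mul, sub_zero] at h
  simp only [besselMoment, besselIntDeriv]
  linarith

lemma hasDerivAt_besselInt (n : ℤ) (z : ℝ) :
    HasDerivAt (besselInt n) (besselIntDeriv n z) z := by
  refine (intervalIntegral.hasDerivAt_integral_of_dominated_loc_of_deriv_le
    (F := fun z τ => cos (n * τ - z * sin τ))
    (F' := fun z τ => sin τ * sin (n * τ - z * sin τ)) (bound := fun _ => 1)
    univ_mem (Eventually.of_forall fun z => ?_) ?_ ?_ ?_ ?_ ?_).2
  · exact Continuous.aestronglyMeasurable (by fun_prop)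
  · exact Continuous.intervalIntegrable (by fun_prop) _ _
  · exact Continuous.aestronglyMeasurable (by fun_prop)
  · refine Eventually.of_forall fun τ _ z _ => ?_
    rw [norm_mul]
    exact mul_le_one₀ (abs_sin_le_one _) (norm_nonneg _) (abs_sin_le_one _)
  · exact intervalIntegrable_const
  · refine Eventually.of_forall fun τ _ z _ => ?_
    have h : HasDerivAt (fun z : ℝ => n * τ - z * sin τ) (-(sin τ)) z := by
      simpa using ((hasDerivAt_id z).mul_const (sin τ)).const_sub (n * τ)
    exact h.cos.congr_deriv (by ring)

lemma besselIntDeriv_eq (n : ℤ) (z : ℝ) :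
    besselIntDeriv n z = 1 / 2 * (besselInt (n - 1) z - besselInt (n + 1) z) := by
  rw [besselIntDeriv, besselInt, besselInt, ← intervalIntegral.integral_sub
    (Continuous.intervalIntegrable (by fun_prop) _ _)
    (Continuous.intervalIntegrable (by fun_prop) _ _), ← intervalIntegral.integral_const_mul]
  congr 1; ext τ; push_cast
  rw [show ((n : ℝ) - 1) * τ - z * sin τ = (n * τ - z * sin τ) - τ by ring,
    show ((n : ℝ) + 1) * τ - z * sin τ = (n * τ - z * sin τ) + τ by ring, cos_sub, cos_add]
  ring

lemma besselInt_sub_one (n : ℤ) (z : ℝ) :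
    besselInt (n - 1) z = besselMoment n z + besselIntDeriv n z := by
  rw [besselIntDeriv, besselInt, besselMoment, ← intervalIntegral.integral_add
    (Continuous.intervalIntegrable (by fun_prop) _ _)
    (Continuous.intervalIntegrable (by fun_prop) _ _)]
  congr 1; ext τ; push_cast
  rw [show ((n : ℝ) - 1) * τ - z * sin τ = (n * τ - z * sin τ) - τ by ring, cos_sub]
  ring

lemma contDiff_besselInt (n : ℤ) : ContDiff ℝ (⊤ : ℕ∞) (besselInt n) := by
  suffices h : ∀ k : ℕ, ∀ n : ℤ, ContDiff ℝ k (besselInt n) from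
    contDiff_infty.2 fun k => h k n
  intro k
  induction k with
  | zero =>
    intro n
    exact contDiff_zero.2 (continuous_iff_continuousAt.2 fun z =>
      (hasDerivAt_besselInt n z).continuousAt)
  | succ k ih =>
    intro n
    have hd : deriv (besselInt n) =
        fun z => 1 / 2 * (besselInt (n - 1) z - besselInt (n + 1) z) := by
      ext z; rw [(hasDerivAt_besselInt n z).deriv, besselIntDeriv_eq]
    push_cast
    rw [contDiff_succ_iff_deriv]
    refine ⟨fun z => (hasDerivAt_besselInt n z).differentiableAt, by simp, ?_⟩
    rw [hd]
    exact contDiff_const.mul ((ih _).sub (ih _))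

/-- Bessel's differential equation, written for the derivative of `J_n'`. -/
lemma hasDerivAt_besselIntDeriv (n : ℤ) {z : ℝ} (hz : z ≠ 0) :
    HasDerivAt (besselIntDeriv n)
      ((n ^ 2 / z ^ 2 - 1) * besselInt n z - besselIntDeriv n z / z) z := by
  have h1 : HasDerivAt (fun z => 1 / 2 * (besselInt (n - 1) z - besselInt (n + 1) z))
      (1 / 2 * (besselIntDeriv (n - 1) z - besselIntDeriv (n + 1) z)) z :=
    ((hasDerivAt_besselInt _ z).sub (hasDerivAt_besselInt _ z)).const_mul _
  have h2 : besselIntDeriv n = fun z => 1 / 2 * (besselInt (n - 1) z - besselInt (n + 1) z) :=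
    funext fun z => besselIntDeriv_eq n z
  have h3 : 1 / 2 * (besselIntDeriv (n - 1) z - besselIntDeriv (n + 1) z) =
      (∫ τ in (0 : ℝ)..π, cos τ ^ 2 * cos (n * τ - z * sin τ)) - besselInt n z := by
    rw [besselIntDeriv, besselIntDeriv, besselInt, ← intervalIntegral.integral_sub
      (Continuous.intervalIntegrable (by fun_prop) _ _)
      (Continuous.intervalIntegrable (by fun_prop) _ _), ← intervalIntegral.integral_const_mul,
      ← intervalIntegral.integral_sub
      (Continuous.intervalIntegrable (by fun_prop) _ _)
      (Continuous.intervalIntegrable (by fun_prop) _ _)]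
    congr 1; ext τ; push_cast
    rw [show ((n : ℝ) - 1) * τ - z * sin τ = (n * τ - z * sin τ) - τ by ring,
      show ((n : ℝ) + 1) * τ - z * sin τ = (n * τ - z * sin τ) + τ by ring, sin_sub, sin_add,
      cos_sq']
    ring
  rw [h3] at h1
  rw [show besselIntDeriv n z / z = (1 / 2 * (besselInt (n - 1) z - besselInt (n + 1) z)) / z by
    rw [besselIntDeriv_eq], h2]
  refine h1.congr_deriv ?_
  rw [← besselIntDeriv_eq]
  have e1 := mul_integral_cos_sq_mul_cos n z
  have e2 := mul_besselMoment n z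
  field_simp
  linear_combination z * e1 + (n : ℝ) * e2

lemma besselInt_zero_zero : besselInt 0 0 = π := by simp [besselInt]

lemma hasDerivAt_pow_mul_besselInt (n : ℕ) (z : ℝ) :
    HasDerivAt (fun z => z ^ (n + 1) * besselInt (n + 1) z) (z ^ (n + 1) * besselInt n z) z := by
  have h := (hasDerivAt_pow (n + 1) z).mul (hasDerivAt_besselInt (n + 1) z)
  refine h.congr_deriv ?_
  have h1 := besselInt_sub_one (n + 1) z
  have h2 := mul_besselMoment (n + 1) z
  simp only [add_sub_cancel_right] at h1
  rw [h1]
  push_cast at h2 ⊢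
  linear_combination (-z ^ n) * h2

/-- `J_n` is positive on a right neighbourhood of zero. -/
lemma besselInt_pos_near_zero (n : ℕ) : ∃ δ > 0, ∀ z, 0 < z → z < δ → 0 < besselInt n z := by
  induction n with
  | zero =>
    have hc : ContinuousAt (besselInt 0) 0 := (hasDerivAt_besselInt 0 0).continuousAt
    have h0 : 0 < besselInt 0 0 := by rw [besselInt_zero_zero]; exact pi_pos
    obtain ⟨δ, hδ, h⟩ := Metric.eventually_nhds_iff.1 (hc.eventually (lt_mem_nhds h0))
    refine ⟨δ, hδ, fun z hz hz' => h ?_⟩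
    rw [Real.dist_eq, sub_zero, abs_of_pos hz]; exact hz'
  | succ n ih =>
    obtain ⟨δ, hδ, h⟩ := ih
    refine ⟨δ, hδ, fun z hz hz' => ?_⟩
    have hmono : StrictMonoOn (fun z => z ^ (n + 1) * besselInt (n + 1) z) (Set.Icc 0 z) := by
      refine strictMonoOn_of_deriv_pos (convex_Icc _ _)
        (fun x _ => (hasDerivAt_pow_mul_besselInt n x).continuousAt.continuousWithinAt) ?_
      intro x hx
      rw [interior_Icc] at hx
      rw [(hasDerivAt_pow_mul_besselInt n x).deriv]
      exact mul_pos (pow_pos hx.1 _) (h x hx.1 (hx.2.trans hz'))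
    have := hmono (Set.left_mem_Icc.2 hz.le) (Set.right_mem_Icc.2 hz.le) hz
    simp only [ne_eq, Nat.add_eq_zero_iff, one_ne_zero, and_false, not_false_eq_true, zero_pow,
      zero_mul] at this
    push_cast
    exact (pos_iff_pos_of_mul_pos this).1 (pow_pos hz _)

/-- `J_n` vanishes at the origin for positive order. -/
lemma besselInt_zero_right {n : ℕ} (hn : n ≠ 0) : besselInt n 0 = 0 := by
  have h := mul_besselMoment n 0
  simp only [zero_mul, Int.cast_natCast] at h
  have hn' : (n : ℝ) ≠ 0 := Nat.cast_ne_zero.2 hn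
  exact (mul_eq_zero.1 h.symm).resolve_left hn'

/-- Below the turning point `z = n` of Bessel's equation, `J_n` and `J_n'` are positive. -/
lemma besselInt_pos {n : ℕ} (hn : n ≠ 0) {z : ℝ} (hz : 0 < z) (hzn : z < n) :
    0 < besselInt n z ∧ 0 < besselIntDeriv n z := by
  have hc : Continuous (besselInt n) := (contDiff_besselInt n).continuous
  have hc' : Continuous (besselIntDeriv n) := by
    rw [show besselIntDeriv n = _ from funext fun z => besselIntDeriv_eq n z]
    exact continuous_const.mul
      ((contDiff_besselInt _).continuous.sub (contDiff_besselInt _).continuous)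
  obtain ⟨δ, hδ, hpos⟩ := besselInt_pos_near_zero n
  -- `z J_n J_n'` vanishes at zero and has derivative `z J_n'² + (n² - z²) J_n² / z`.
  have hd : ∀ x : ℝ, 0 < x →
      HasDerivAt (fun x => x * besselIntDeriv n x * besselInt n x)
        (x * besselIntDeriv n x ^ 2 + (n ^ 2 - x ^ 2) / x * besselInt n x ^ 2) x := by
    intro x hx
    have h := ((hasDerivAt_id x).mul (hasDerivAt_besselIntDeriv n hx.ne')).mul
      (hasDerivAt_besselInt n x)
    refine h.congr_deriv ?_
    simp only [Pi.mul_apply, id, Int.cast_natCast]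
    field_simp
    ring
  have hmono : MonotoneOn (fun x => x * besselIntDeriv n x * besselInt n x) (Set.Icc 0 n) := by
    refine monotoneOn_of_deriv_nonneg (convex_Icc _ _) (by fun_prop) ?_ ?_
    · intro x hx
      rw [interior_Icc] at hx
      exact (hd x hx.1).differentiableAt.differentiableWithinAt
    · intro x hx
      rw [interior_Icc] at hx
      rw [(hd x hx.1).deriv]
      have hx1 := hx.1
      have : 0 ≤ (n : ℝ) ^ 2 - x ^ 2 := by nlinarith [hx.2]
      positivity
  have hnn : ∀ x ∈ Set.Icc (0 : ℝ) n, 0 ≤ besselIntDeriv n x * besselInt n x := by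
    intro x hx
    rcases hx.1.eq_or_lt with h | h
    · rw [← h, besselInt_zero_right hn, mul_zero]
    · have := hmono (Set.left_mem_Icc.2 (hx.1.trans hx.2)) hx hx.1
      simp only [zero_mul, mul_assoc] at this
      exact nonneg_of_mul_nonneg_right this h
  -- Hence `J_n²` is nondecreasing, so that `J_n` cannot vanish.
  have hsq : MonotoneOn (fun x => besselInt n x ^ 2) (Set.Icc 0 n) := by
    refine monotoneOn_of_deriv_nonneg (convex_Icc _ _) (by fun_prop) ?_ ?_
    · intro x hx
      exact ((hasDerivAt_besselInt n x).pow 2).differentiableAt.differentiableWithinAt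
    · intro x hx
      rw [interior_Icc] at hx
      have := ((hasDerivAt_besselInt n x).pow 2).deriv
      have h2 : deriv (fun x => besselInt n x ^ 2) x = _ := this
      rw [h2]
      have := hnn x ⟨hx.1.le, hx.2.le⟩
      norm_num
      linarith
  have hne : ∀ x : ℝ, 0 < x → x < n → besselInt n x ≠ 0 := by
    intro x hx hxn h0
    set y := min (x / 2) (δ / 2) with hy
    have hy0 : 0 < y := lt_min (by linarith) (by linarith)
    have hyx : y ≤ x := (min_le_left _ _).trans (by linarith)
    have hyd : y < δ := (min_le_right _ _).trans_lt (by linarith)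
    have := hsq ⟨hy0.le, hyx.trans hxn.le⟩ ⟨hx.le, hxn.le⟩ hyx
    simp only [h0] at this
    have := hpos y hy0 hyd
    nlinarith [this]
  have hJ : 0 < besselInt n z := by
    by_contra hneg
    push Not at hneg
    set y := min (z / 2) (δ / 2) with hy
    have hy0 : 0 < y := lt_min (by linarith) (by linarith)
    have hyz : y ≤ z := (min_le_left _ _).trans (by linarith)
    have hyd : y < δ := (min_le_right _ _).trans_lt (by linarith)
    obtain ⟨x, hx, hx0⟩ := intermediate_value_Icc' hyz hc.continuousOn
      ⟨hneg, (hpos y hy0 hyd).le⟩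
    exact hne x (hy0.trans_le hx.1) (hx.2.trans_lt hzn) hx0
  refine ⟨hJ, ?_⟩
  have hlt : (0 : ℝ) < z * besselIntDeriv n z * besselInt n z := by
    have hstrict : StrictMonoOn (fun x => x * besselIntDeriv n x * besselInt n x)
        (Set.Icc 0 n) := by
      refine strictMonoOn_of_deriv_pos (convex_Icc _ _) (by fun_prop) ?_
      intro x hx
      rw [interior_Icc] at hx
      rw [(hd x hx.1).deriv]
      have hx1 := hx.1
      have h1 : 0 < (n : ℝ) ^ 2 - x ^ 2 := by nlinarith [hx.2]
      have h2 := pow_pos (abs_pos.2 (hne x hx.1 hx.2)) 2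
      rw [sq_abs] at h2
      positivity
    have := hstrict (Set.left_mem_Icc.2 (hz.trans hzn).le) ⟨hz.le, hzn.le⟩ hz
    simpa using this
  rw [mul_assoc] at hlt
  have h1 := (pos_iff_pos_of_mul_pos hlt).1 hz
  exact (pos_iff_pos_of_mul_pos h1).2 hJ

/-! ### Nondegeneracy of the coefficients `U_ν` -/

/-- `s = √(1 - e²)`. -/
noncomputable def coEcc (e : ℝ) : ℝ := sqrt (1 - e ^ 2)

/-- `K = e (d/de) J_ν(ν e)`, up to the factor `π` of Bessel's integral. -/
noncomputable def eulerBessel (ν : ℕ) (e : ℝ) : ℝ := ν * e * besselIntDeriv ν (ν * e)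

/-- `V = (π ν² e² / 4) U_ν`, as a combination of `K` and `J`. -/
noncomputable def coeffV (ν : ℕ) (e : ℝ) : ℝ :=
  2 * coEcc e * (coEcc e - 1 / ν) * eulerBessel ν e +
    (2 * ν * coEcc e ^ 3 - 1 - coEcc e ^ 2) * besselInt ν (ν * e)

/-- `W = (π ν² e³ / 4) U_ν'`, as a combination of `K` and `J`. -/
noncomputable def coeffW (ν : ℕ) (e : ℝ) : ℝ :=
  (2 * ν * coEcc e ^ 3 - 5 - coEcc e ^ 2 + 2 * (1 + coEcc e ^ 2) / (ν * coEcc e)) *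
      eulerBessel ν e +
    (2 * ν ^ 2 * coEcc e ^ 4 - 6 * ν * coEcc e + 4) * besselInt ν (ν * e)

section

variable {ν : ℕ} {e : ℝ}

lemma coEcc_pos (h0 : 0 < e) (h1 : e < 1) : 0 < coEcc e := sqrt_pos.2 (by nlinarith)

lemma coEcc_sq (h0 : 0 < e) (h1 : e < 1) : coEcc e ^ 2 = 1 - e ^ 2 := sq_sqrt (by nlinarith)

lemma hasDerivAt_coEcc (h0 : 0 < e) (h1 : e < 1) : HasDerivAt coEcc (-e / coEcc e) e := by
  have h : HasDerivAt (fun e : ℝ => 1 - e ^ 2) (-(2 * e)) e := by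
    simpa using ((hasDerivAt_id e).pow 2).const_sub 1
  have hs := coEcc_pos h0 h1
  refine (h.sqrt (by nlinarith)).congr_deriv ?_
  change -(2 * e) / (2 * coEcc e) = _
  field_simp

lemma hasDerivAt_besselInt_mul (ν : ℕ) (h0 : 0 < e) :
    HasDerivAt (fun e : ℝ => besselInt ν (ν * e)) (eulerBessel ν e / e) e := by
  have h := (hasDerivAt_besselInt ν (ν * e)).comp e ((hasDerivAt_id e).const_mul (ν : ℝ))
  refine h.congr_deriv ?_
  simp only [eulerBessel]
  field_simp

/-- Bessel's equation in the form `(e d/de)² J = ν² (1 - e²) J`. -/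
lemma hasDerivAt_eulerBessel (hν : ν ≠ 0) (h0 : 0 < e) (h1 : e < 1) :
    HasDerivAt (eulerBessel ν) (ν ^ 2 * coEcc e ^ 2 * besselInt ν (ν * e) / e) e := by
  have hν' : (ν : ℝ) ≠ 0 := Nat.cast_ne_zero.2 hν
  have hlin := (hasDerivAt_id e).const_mul (ν : ℝ)
  have h := hlin.mul ((hasDerivAt_besselIntDeriv ν (z := ν * e) (by positivity)).comp e hlin)
  refine h.congr_deriv ?_
  rw [coEcc_sq h0 h1]
  simp only [Int.cast_natCast, Function.comp, id]
  field_simp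
  ring

lemma coeffU_eq (hν : ν ≠ 0) (h0 : 0 < e) (h1 : e < 1) :
    coeffU ν e = 4 / (π * ν ^ 2 * e ^ 2) * coeffV ν e := by
  have hν' : (ν : ℝ) ≠ 0 := Nat.cast_ne_zero.2 hν
  have hd : deriv (besselJ ν) (ν * e) = 1 / π * besselIntDeriv ν (ν * e) := by
    rw [funext fun z => besselJ_eq ν z]
    exact ((hasDerivAt_besselInt ν (ν * e)).const_mul _).deriv
  have hs : sqrt (1 - e ^ 2) = coEcc e := rfl
  have he : e ^ 2 = 1 - coEcc e ^ 2 := by rw [coEcc_sq h0 h1]; ring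
  have hne := (pow_pos h0 2).ne'
  rw [coeffU, coeffA, coeffB, hd, besselJ_eq, hs, coeffV, eulerBessel]
  rw [show (2 - e ^ 2) = 1 + coEcc e ^ 2 by rw [he]; ring,
    show (1 - e ^ 2) = coEcc e ^ 2 by rw [he]; ring]
  field_simp
  ring

lemma eventually_mem_unit (h0 : 0 < e) (h1 : e < 1) : ∀ᶠ x in 𝓝 e, 0 < x ∧ x < 1 :=
  (lt_mem_nhds h0).and (gt_mem_nhds h1)

lemma hasDerivAt_coeffU (hν : ν ≠ 0) (h0 : 0 < e) (h1 : e < 1) :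
    HasDerivAt (coeffU ν) (4 / (π * ν ^ 2 * e ^ 3) * coeffW ν e) e := by
  have hν' : (ν : ℝ) ≠ 0 := Nat.cast_ne_zero.2 hν
  have hs := coEcc_pos h0 h1
  have hds := hasDerivAt_coEcc h0 h1
  have hJ := hasDerivAt_besselInt_mul ν h0
  have hK := hasDerivAt_eulerBessel hν h0 h1
  have hV := ((hds.const_mul 2).mul (hds.sub_const (1 / (ν : ℝ)))).mul hK |>.add
    ((((hds.pow 3).const_mul (2 * (ν : ℝ))).sub_const 1 |>.sub (hds.pow 2)).mul hJ)
  have hden : HasDerivAt (fun x : ℝ => 4 / (π * ν ^ 2 * x ^ 2)) (-8 / (π * ν ^ 2 * e ^ 3)) e := by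
    have h := (((hasDerivAt_id e).pow 2).const_mul (π * (ν : ℝ) ^ 2)).inv (mul_pos (by positivity)
      (pow_pos h0 2)).ne'
      |>.const_mul 4
    refine (h.congr_deriv ?_).congr_of_eventuallyEq (Eventually.of_forall fun x => ?_)
    · simp only [id, Pi.pow_apply]; field_simp; norm_num; ring
    · simp [div_eq_mul_inv]
  have hU := hden.mul hV
  refine (hU.congr_of_eventuallyEq ?_).congr_deriv ?_
  · filter_upwards [eventually_mem_unit h0 h1] with x hx
    rw [coeffU_eq hν hx.1 hx.2]; rfl
  · have he : e ^ 2 = 1 - coEcc e ^ 2 := by rw [coEcc_sq h0 h1]; ring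
    simp only [coeffW, Pi.add_apply, Pi.mul_apply, Pi.sub_apply, Pi.pow_apply]
    generalize eulerBessel ν e = K
    generalize besselInt ν (ν * e) = J
    generalize coEcc e = s at *
    field_simp
    rw [he]
    ring

/-- The derivative of `W`; the coefficients are obtained by differentiating those of `W` and
using Bessel's equation. -/
lemma hasDerivAt_coeffW (hν : ν ≠ 0) (h0 : 0 < e) (h1 : e < 1) :
    HasDerivAt (coeffW ν)
      (1 / e * ((e ^ 2 * (-6 * ν * coEcc e + 2 + 2 / (ν * coEcc e ^ 3) - 2 / (ν * coEcc e)) +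
          (2 * ν ^ 2 * coEcc e ^ 4 - 6 * ν * coEcc e + 4)) * eulerBessel ν e +
        (e ^ 2 * (-8 * ν ^ 2 * coEcc e ^ 2 + 6 * ν / coEcc e) +
          (2 * ν * coEcc e ^ 3 - 5 - coEcc e ^ 2 + 2 * (1 + coEcc e ^ 2) / (ν * coEcc e)) *
            (ν ^ 2 * coEcc e ^ 2)) * besselInt ν (ν * e))) e := by
  have hν' : (ν : ℝ) ≠ 0 := Nat.cast_ne_zero.2 hν
  have hs := coEcc_pos h0 h1
  have hds := hasDerivAt_coEcc h0 h1
  have hJ := hasDerivAt_besselInt_mul ν h0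
  have hK := hasDerivAt_eulerBessel hν h0 h1
  have h1' := (((hds.pow 3).const_mul (2 * (ν : ℝ))).sub_const 5).sub (hds.pow 2) |>.add
    ((((hds.pow 2).const_add 1).const_mul 2).div (hds.const_mul (ν : ℝ)) (by positivity))
  have h2' := (((hds.pow 4).const_mul (2 * (ν : ℝ) ^ 2)).sub (hds.const_mul (6 * (ν : ℝ))))
    |>.add_const (4 : ℝ)
  have h := (h1'.mul hK).add (h2'.mul hJ)
  refine HasDerivAt.congr_deriv h ?_
  simp only [Pi.add_apply, Pi.sub_apply, Pi.pow_apply, Pi.div_apply]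
  generalize eulerBessel ν e = K
  generalize besselInt ν (ν * e) = J
  generalize coEcc e = s at *
  field_simp
  ring

lemma eulerBessel_pos (hν : ν ≠ 0) (h0 : 0 < e) (h1 : e < 1) :
    0 < eulerBessel ν e ∧ 0 < besselInt ν (ν * e) := by
  have hν' : (0 : ℝ) < ν := by positivity
  have h := besselInt_pos hν (z := ν * e) (by positivity) (by nlinarith)
  exact ⟨mul_pos (by positivity) h.2, h.1⟩

/-- The zeros of `U_ν` are simple: eliminating `K` and `J` from `V = W = 0` leaves `5 ν s = 2`,
where `V` is negative. -/
lemma deriv_coeffU_ne_zero (hν : ν ≠ 0) (h0 : 0 < e) (h1 : e < 1) (hU : coeffU ν e = 0) :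
    deriv (coeffU ν) e ≠ 0 := by
  have hν' : (0 : ℝ) < ν := by positivity
  obtain ⟨hK, hJ⟩ := eulerBessel_pos hν h0 h1
  have hs := coEcc_pos h0 h1
  have he : coEcc e ^ 2 < 1 := by rw [coEcc_sq h0 h1]; nlinarith
  rw [(hasDerivAt_coeffU hν h0 h1).deriv]
  rw [coeffU_eq hν h0 h1] at hU
  intro hU'
  have hV : coeffV ν e = 0 := (mul_eq_zero.1 hU).resolve_left (by positivity)
  have hW : coeffW ν e = 0 := (mul_eq_zero.1 hU').resolve_left (by positivity)
  rw [coeffV] at hV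
  rw [coeffW] at hW
  generalize eulerBessel ν e = K at *
  generalize besselInt ν (ν * e) = J at *
  generalize coEcc e = s at *
  generalize (ν : ℝ) = N at *
  have hdet : (1 - s ^ 2) ^ 2 * (5 * (N * s) - 2) * K = 0 := by
    field_simp at hV hW
    have e1 : (2 * s * (N * s - 1) * K + N * (2 * N * s ^ 3 - 1 - s ^ 2) * J) = 0 := by
      linear_combination hV
    have e2 : ((2 * N * s ^ 3 - 5 - s ^ 2) * (N * s) + 2 * (1 + s ^ 2)) * K +
        (2 * N ^ 2 * s ^ 4 - 6 * N * s + 4) * (N * s) * J = 0 := by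
      linear_combination hW
    linear_combination (2 * N * s ^ 3 - 1 - s ^ 2) * e2 -
      s * (2 * N ^ 2 * s ^ 4 - 6 * N * s + 4) * e1
  have h5 : N * s = 2 / 5 := by
    have hne : (1 - s ^ 2) ^ 2 ≠ 0 := by
      have : 0 < 1 - s ^ 2 := by linarith
      positivity
    have h := (mul_eq_zero.1 hdet).resolve_right hK.ne'
    have := (mul_eq_zero.1 h).resolve_left hne
    linarith
  have hN : N = 2 / (5 * s) := by field_simp; linarith
  rw [hN] at hV
  field_simp at hV
  nlinarith [mul_pos (mul_pos hs hs) hK, mul_pos (mul_pos hs hs) hJ]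

/-- The elementary inequality behind the nondegeneracy of the critical points of `U_ν`, with
`y = ν s`: where the resultant of `W` and its derivative vanishes, both coefficients of `W` are
positive. -/
lemma pos_of_resultant_eq_zero {N s : ℝ} (hN : 2 ≤ N) (hs : 0 < s) (hs1 : s < 1)
    (hE : 5 * (N * s) ^ 3 * s ^ 2 + (8 * s ^ 2 - 30) * (N * s) ^ 2 +
      (24 + 4 * s ^ 2) * (N * s) - 8 = 0) :
    0 < 2 * N ^ 2 * s ^ 4 - 6 * N * s + 4 ∧
      0 < (2 * N * s ^ 3 - 5 - s ^ 2) * (N * s) + 2 * (1 + s ^ 2) := by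
  obtain ⟨y, hy⟩ : ∃ y, y = N * s := ⟨_, rfl⟩
  have hy0 : 0 < y := by rw [hy]; positivity
  rw [← hy] at hE
  have hsig : s ^ 2 * (y * (5 * y ^ 2 + 8 * y + 4)) = 30 * y ^ 2 - 24 * y + 8 := by
    linear_combination hE
  have hle : 4 * s ^ 2 ≤ y ^ 2 := by
    rw [hy, mul_pow]
    exact mul_le_mul_of_nonneg_right (by nlinarith) (sq_nonneg s)
  have hs2 : s ^ 2 < 1 := by nlinarith
  have hy2 : 2 < y := by
    by_contra hcon
    push Not at hcon
    have hb : 0 < y * (5 * y ^ 2 + 8 * y + 4) := by positivity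
    have h1 : 4 * (30 * y ^ 2 - 24 * y + 8) ≤ y ^ 2 * (y * (5 * y ^ 2 + 8 * y + 4)) := by
      rw [← hsig]; nlinarith
    have h2 : (y - 2) * (5 * y ^ 4 + 18 * y ^ 3 + 40 * y ^ 2 - 40 * y + 16) ≥ 0 := by
      nlinarith
    have h3 : 0 < 5 * y ^ 4 + 18 * y ^ 3 + 40 * y ^ 2 - 40 * y + 16 := by
      nlinarith [pow_pos hy0 3, pow_pos hy0 4, sq_nonneg (2 * y - 1)]
    have h4 : y = 2 := by
      by_contra hne
      have : y - 2 < 0 := lt_of_le_of_ne (by linarith) (sub_ne_zero.2 hne)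
      nlinarith
    rw [h4] at hsig
    nlinarith
  have hq : 0 < y ^ 2 * s ^ 2 - 3 * y + 2 := by
    have hb : 0 < 5 * y ^ 2 + 8 * y + 4 := by positivity
    have h1 : (y ^ 2 * s ^ 2 - 3 * y + 2) * (5 * y ^ 2 + 8 * y + 4) =
        (y - 2) * (15 * y ^ 2 - 8 * y - 4) := by
      linear_combination y * hsig
    have h2 : 0 < (y - 2) * (15 * y ^ 2 - 8 * y - 4) :=
      mul_pos (by linarith) (by nlinarith)
    rw [← h1] at h2
    exact (pos_iff_pos_of_mul_pos h2).2 hb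
  have hq' : 0 < 2 * N ^ 2 * s ^ 4 - 6 * N * s + 4 := by
    rw [hy] at hq; nlinarith
  refine ⟨hq', ?_⟩
  have h3 : (2 * N * s ^ 3 - 5 - s ^ 2) * (N * s) + 2 * (1 + s ^ 2) =
      (2 * N ^ 2 * s ^ 4 - 6 * N * s + 4) + (1 - s ^ 2) * (y - 2) := by
    rw [hy]; ring
  rw [h3]
  have := mul_pos (sub_pos.2 hs2) (sub_pos.2 hy2)
  linarith

/-- The critical points of `U_ν` are nondegenerate for `ν ≥ 2`: eliminating `K` and `J` from
`W = W' = 0` leaves the equation of `pos_of_resultant_eq_zero`, where `W` is positive. -/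
lemma deriv_deriv_coeffU_ne_zero (hν : 2 ≤ ν) (h0 : 0 < e) (h1 : e < 1)
    (hU : deriv (coeffU ν) e = 0) : deriv (deriv (coeffU ν)) e ≠ 0 := by
  have hν0 : ν ≠ 0 := by omega
  have hν2 : (2 : ℝ) ≤ ν := by exact_mod_cast hν
  have hν' : (0 : ℝ) < ν := by positivity
  obtain ⟨hK, hJ⟩ := eulerBessel_pos hν0 h0 h1
  have hs := coEcc_pos h0 h1
  have hse : e ^ 2 = 1 - coEcc e ^ 2 := by rw [coEcc_sq h0 h1]; ring
  have he : coEcc e < 1 := by nlinarith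
  rw [(hasDerivAt_coeffU hν0 h0 h1).deriv] at hU
  have hW : coeffW ν e = 0 := (mul_eq_zero.1 hU).resolve_left (by positivity)
  have hden : DifferentiableAt ℝ (fun x : ℝ => 4 / (π * ν ^ 2 * x ^ 3)) e := by
    refine DifferentiableAt.div (by fun_prop) (by fun_prop) (by positivity)
  have hev : deriv (coeffU ν) =ᶠ[𝓝 e] fun x => 4 / (π * ν ^ 2 * x ^ 3) * coeffW ν x := by
    filter_upwards [eventually_mem_unit h0 h1] with x hx
    exact (hasDerivAt_coeffU hν0 hx.1 hx.2).deriv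
  have hd := hden.hasDerivAt.mul (hasDerivAt_coeffW hν0 h0 h1)
  rw [hev.deriv_eq, show deriv (fun x => 4 / (π * ν ^ 2 * x ^ 3) * coeffW ν x) e = _ from hd.deriv,
    hW, mul_zero, zero_add]
  refine mul_ne_zero (by positivity) (mul_ne_zero (by positivity) fun hW' => ?_)
  rw [coeffW] at hW
  rw [hse] at hW'
  generalize eulerBessel ν e = K at *
  generalize besselInt ν (ν * e) = J at *
  generalize coEcc e = s at *
  generalize (ν : ℝ) = N at *
  have e2 : ((2 * N * s ^ 3 - 5 - s ^ 2) * (N * s) + 2 * (1 + s ^ 2)) * K +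
      (2 * N ^ 2 * s ^ 4 - 6 * N * s + 4) * (N * s) * J = 0 := by
    field_simp at hW
    linear_combination hW
  have e3 : ((1 - s ^ 2) * (-6 * N ^ 2 * s ^ 4 + 2 * N * s ^ 3 + 2 - 2 * s ^ 2) +
      (2 * N ^ 2 * s ^ 4 - 6 * N * s + 4) * (N * s ^ 3)) * K +
      ((1 - s ^ 2) * (-8 * N ^ 3 * s ^ 5 + 6 * N ^ 2 * s ^ 2) +
        ((2 * N * s ^ 3 - 5 - s ^ 2) * (N * s) + 2 * (1 + s ^ 2)) * N ^ 2 * s ^ 4) * J = 0 := by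
    field_simp at hW'
    linear_combination hW'
  have hdet : (N * s) * ((1 - s ^ 2) ^ 2 * (5 * (N * s) ^ 3 * s ^ 2 +
      (8 * s ^ 2 - 30) * (N * s) ^ 2 + (24 + 4 * s ^ 2) * (N * s) - 8) * K) = 0 := by
    linear_combination ((1 - s ^ 2) * (-8 * N ^ 3 * s ^ 5 + 6 * N ^ 2 * s ^ 2) +
        ((2 * N * s ^ 3 - 5 - s ^ 2) * (N * s) + 2 * (1 + s ^ 2)) * N ^ 2 * s ^ 4) * e2 -
      (2 * N ^ 2 * s ^ 4 - 6 * N * s + 4) * (N * s) * e3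
  replace hdet := (mul_eq_zero.1 hdet).resolve_left (by positivity)
  have hE := (mul_eq_zero.1 ((mul_eq_zero.1 hdet).resolve_right hK.ne')).resolve_left (by
    have : 0 < 1 - s ^ 2 := by nlinarith
    positivity)
  obtain ⟨hq, hp⟩ := pos_of_resultant_eq_zero hν2 hs he hE
  have := mul_pos hp hK
  have := mul_pos (mul_pos hq (mul_pos hν' hs)) hJ
  linarith

lemma contDiffAt_coeffU (hν : ν ≠ 0) (h0 : 0 < e) (h1 : e < 1) :
    ContDiffAt ℝ (⊤ : ℕ∞) (coeffU ν) e := by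
  have hs : ContDiffAt ℝ (⊤ : ℕ∞) coEcc e :=
    ContDiffAt.sqrt (by fun_prop) (by nlinarith)
  have hJ : ContDiffAt ℝ (⊤ : ℕ∞) (fun e : ℝ => besselInt ν (ν * e)) e :=
    ((contDiff_besselInt ν).comp (contDiff_const.mul contDiff_id)).contDiffAt
  have hJ' : ContDiffAt ℝ (⊤ : ℕ∞) (fun e : ℝ => besselIntDeriv ν (ν * e)) e := by
    simp only [besselIntDeriv_eq]
    exact (contDiff_const.mul (((contDiff_besselInt _).comp (contDiff_const.mul contDiff_id)).sub
      ((contDiff_besselInt _).comp (contDiff_const.mul contDiff_id)))).contDiffAt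
  have hK : ContDiffAt ℝ (⊤ : ℕ∞) (eulerBessel ν) e := by
    unfold eulerBessel
    fun_prop
  have hV : ContDiffAt ℝ (⊤ : ℕ∞) (coeffV ν) e := by
    unfold coeffV
    fun_prop
  have hν' : (ν : ℝ) ≠ 0 := Nat.cast_ne_zero.2 hν
  have hden : ContDiffAt ℝ (⊤ : ℕ∞) (fun x : ℝ => 4 / (π * ν ^ 2 * x ^ 2)) e :=
    contDiffAt_const.div (by fun_prop) (by positivity)
  refine (hden.mul hV).congr_of_eventuallyEq ?_
  filter_upwards [eventually_mem_unit h0 h1] with x hx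
  exact coeffU_eq hν hx.1 hx.2

end

/-! ### The Fourier coefficients of the quadratic moments -/

section

variable {e : ℝ}

lemma kepler_strictMono (h0 : 0 ≤ e) (h1 : e < 1) : StrictMono fun u : ℝ => u - e * sin u := by
  refine strictMono_of_deriv_pos fun u => ?_
  have h : HasDerivAt (fun u : ℝ => u - e * sin u) (1 - e * cos u) u :=
    (hasDerivAt_id u).sub ((hasDerivAt_sin u).const_mul e)
  rw [h.deriv]
  nlinarith [cos_le_one u]

lemma eccAnomaly_eq (h0 : 0 ≤ e) (h1 : e < 1) {u l : ℝ} (h : u - e * sin u = l) :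
    eccAnomaly e l = u :=
  (kepler_strictMono h0 h1).injective ((eccAnomaly_spec h0 h1 l).trans h.symm)

lemma eccAnomaly_add_two_pi (h0 : 0 ≤ e) (h1 : e < 1) (l : ℝ) :
    eccAnomaly e (l + 2 * π) = eccAnomaly e l + 2 * π := by
  refine eccAnomaly_eq h0 h1 ?_
  rw [sin_add_two_pi]
  linarith [eccAnomaly_spec h0 h1 l]

lemma eccAnomaly_neg (h0 : 0 ≤ e) (h1 : e < 1) (l : ℝ) :
    eccAnomaly e (-l) = -eccAnomaly e l := by
  refine eccAnomaly_eq h0 h1 ?_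
  rw [sin_neg]
  linarith [eccAnomaly_spec h0 h1 l]

lemma continuous_eccAnomaly (h0 : 0 ≤ e) (h1 : e < 1) : Continuous (eccAnomaly e) := by
  have hmono : Monotone (eccAnomaly e) := by
    intro a b hab
    rw [← eccAnomaly_spec h0 h1 a, ← eccAnomaly_spec h0 h1 b] at hab
    exact (kepler_strictMono h0 h1).le_iff_le.1 hab
  exact hmono.continuous_of_surjective fun u => ⟨_, eccAnomaly_eq h0 h1 rfl⟩

lemma orbX_add_two_pi (h0 : 0 ≤ e) (h1 : e < 1) (l : ℝ) : orbX e (l + 2 * π) = orbX e l := by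
  rw [orbX, orbX, eccAnomaly_add_two_pi h0 h1, cos_add_two_pi]

lemma orbY_add_two_pi (h0 : 0 ≤ e) (h1 : e < 1) (l : ℝ) : orbY e (l + 2 * π) = orbY e l := by
  rw [orbY, orbY, eccAnomaly_add_two_pi h0 h1, sin_add_two_pi]

lemma orbX_neg (h0 : 0 ≤ e) (h1 : e < 1) (l : ℝ) : orbX e (-l) = orbX e l := by
  rw [orbX, orbX, eccAnomaly_neg h0 h1, cos_neg]

lemma orbY_neg (h0 : 0 ≤ e) (h1 : e < 1) (l : ℝ) : orbY e (-l) = -orbY e l := by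
  rw [orbY, orbY, eccAnomaly_neg h0 h1, sin_neg, mul_neg]

lemma continuous_orbX (h0 : 0 ≤ e) (h1 : e < 1) : Continuous (orbX e) :=
  (continuous_cos.comp (continuous_eccAnomaly h0 h1)).sub continuous_const

lemma continuous_orbY (h0 : 0 ≤ e) (h1 : e < 1) : Continuous (orbY e) :=
  continuous_const.mul (continuous_sin.comp (continuous_eccAnomaly h0 h1))

/-- The Fourier integral over half a revolution: passing to the eccentric anomaly and integrating
by parts expresses it through Bessel's integrals. -/
lemma integral_orb_half {n : ℕ} (hn : n ≠ 0) (h0 : 0 < e) (h1 : e < 1) :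
    ∫ M in (0 : ℝ)..π, ((orbX e M ^ 2 - orbY e M ^ 2) * cos (n * M) +
      2 * orbX e M * orbY e M * sin (n * M)) = π / 2 * coeffU n e := by
  have hn' : (n : ℝ) ≠ 0 := Nat.cast_ne_zero.2 hn
  have hcX := continuous_orbX h0.le h1
  have hcY := continuous_orbY h0.le h1
  have hs2 := coEcc_sq h0 h1
  set s := coEcc e with hs
  -- the substitution `M = u - e sin u`
  have hsub := intervalIntegral.integral_comp_mul_deriv (a := 0) (b := π)
    (f := fun u => u - e * sin u) (f' := fun u => 1 - e * cos u)
    (g := fun M => (orbX e M ^ 2 - orbY e M ^ 2) * cos (n * M) +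
      2 * orbX e M * orbY e M * sin (n * M))
    (fun u _ => (hasDerivAt_id u).sub ((hasDerivAt_sin u).const_mul e))
    (by fun_prop) (by fun_prop)
  simp only [sin_pi, sin_zero, mul_zero, sub_zero] at hsub
  rw [← hsub]
  have hX : ∀ u, orbX e (u - e * sin u) = cos u - e := fun u => by
    rw [orbX, eccAnomaly_eq h0.le h1 rfl]
  have hY : ∀ u, orbY e (u - e * sin u) = s * sin u := fun u => by
    rw [orbY, eccAnomaly_eq h0.le h1 rfl]; rfl
  simp only [Function.comp, hX, hY]
  -- integration by parts
  have hP := fun u => hasDerivAt_besselPhase n (n * e) u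
  have hparts := intervalIntegral.integral_eq_sub_of_hasDerivAt (a := 0) (b := π)
    (f := fun u => ((cos u - e) ^ 2 - (s * sin u) ^ 2) * sin ((n : ℤ) * u - n * e * sin u)
      - 2 * (cos u - e) * (s * sin u) * cos ((n : ℤ) * u - n * e * sin u))
    (f' := fun u => n * ((((cos u - e) ^ 2 - (s * sin u) ^ 2) * cos (n * (u - e * sin u)) +
        2 * (cos u - e) * (s * sin u) * sin (n * (u - e * sin u))) * (1 - e * cos u))
      - (2 * (1 + s ^ 2)) * (sin u * cos u * sin ((n : ℤ) * u - n * e * sin u))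
      + 2 * e * (sin u * sin ((n : ℤ) * u - n * e * sin u))
      - 4 * s * (cos u ^ 2 * cos ((n : ℤ) * u - n * e * sin u))
      + 2 * s * cos ((n : ℤ) * u - n * e * sin u)
      + 2 * s * e * (cos u * cos ((n : ℤ) * u - n * e * sin u)))
    (fun u _ => by
      have h1 := ((hasDerivAt_cos u).sub_const e)
      have h2 := ((hasDerivAt_sin u).const_mul s)
      have h := (((h1.pow 2).sub (h2.pow 2)).mul (hP u).sin).sub
        (((h1.const_mul 2).mul h2).mul (hP u).cos)
      refine h.congr_deriv ?_
      rw [show (n : ℝ) * (u - e * sin u) = (n : ℤ) * u - n * e * sin u by push_cast; ring]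
      simp only [Pi.mul_apply, Pi.sub_apply, Pi.pow_apply, Int.cast_natCast]
      have hsc := sin_sq_add_cos_sq u
      generalize cos (↑n * u - ↑n * e * sin u) = c
      generalize sin (↑n * u - ↑n * e * sin u) = d
      norm_num
      linear_combination (2 * s * c) * hsc)
    (Continuous.intervalIntegrable (by fun_prop) _ _)
  rw [intervalIntegral.integral_add (Continuous.intervalIntegrable (by fun_prop) _ _)
      (Continuous.intervalIntegrable (by fun_prop) _ _),
    intervalIntegral.integral_add (Continuous.intervalIntegrable (by fun_prop) _ _)
      (Continuous.intervalIntegrable (by fun_prop) _ _),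
    intervalIntegral.integral_sub (Continuous.intervalIntegrable (by fun_prop) _ _)
      (Continuous.intervalIntegrable (by fun_prop) _ _),
    intervalIntegral.integral_add (Continuous.intervalIntegrable (by fun_prop) _ _)
      (Continuous.intervalIntegrable (by fun_prop) _ _),
    intervalIntegral.integral_sub (Continuous.intervalIntegrable (by fun_prop) _ _)
      (Continuous.intervalIntegrable (by fun_prop) _ _),
    intervalIntegral.integral_const_mul, intervalIntegral.integral_const_mul,
    intervalIntegral.integral_const_mul, intervalIntegral.integral_const_mul,
    intervalIntegral.integral_const_mul, intervalIntegral.integral_const_mul,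
    sin_besselPhase_pi] at hparts
  simp only [sin_pi, sin_zero, mul_zero, zero_mul, sub_zero] at hparts
  have m1 := mul_besselMoment n (n * e)
  have m2 := mul_integral_cos_sq_mul_cos n (n * e)
  have m3 := mul_integral_sin_mul_cos_mul_sin n (n * e)
  rw [coeffU_eq hn h0 h1, coeffV, eulerBessel, ← hs]
  simp only [besselMoment, besselInt, besselIntDeriv] at m1 m2 m3 ⊢
  simp only [Int.cast_natCast] at m1 m2 m3 hparts ⊢
  generalize (∫ u in (0 : ℝ)..π, cos (n * u - n * e * sin u)) = a0 at *
  generalize (∫ u in (0 : ℝ)..π, cos u * cos (n * u - n * e * sin u)) = a1 at *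
  generalize (∫ u in (0 : ℝ)..π, sin u * sin (n * u - n * e * sin u)) = b1 at *
  generalize (∫ u in (0 : ℝ)..π, cos u ^ 2 * cos (n * u - n * e * sin u)) = a2 at *
  generalize (∫ u in (0 : ℝ)..π, sin u * cos u * sin (n * u - n * e * sin u)) = b2 at *
  generalize (∫ u in (0 : ℝ)..π, (((cos u - e) ^ 2 - (s * sin u) ^ 2) * cos (n * (u - e * sin u)) +
    2 * (cos u - e) * (s * sin u) * sin (n * (u - e * sin u))) * (1 - e * cos u)) = I at *
  have ha1 : a1 = a0 / e := by field_simp; field_simp at m1; linear_combination m1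
  have ha2 : a2 = (n * a1 - b1) / (n * e) := by field_simp; linear_combination m2
  have hb2 : b2 = (n * b1 - a1) / (n * e) := by field_simp; linear_combination m3
  have hI : I =
      (2 * (1 + s ^ 2) * b2 - 2 * e * b1 + 4 * s * a2 - 2 * s * a0 - 2 * s * e * a1) / n := by
    field_simp; linear_combination hparts
  rw [hI, ha2, hb2, ha1]
  have he : e ^ 2 = 1 - s ^ 2 := by rw [hs2]; ring
  field_simp
  linear_combination (-4 * n * b1 * e - 8 * s * n * a0) * he

/-- The resonant Fourier coefficient of the quadratic moments over a full revolution. -/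
lemma integral_orb {n : ℕ} (hn : n ≠ 0) (h0 : 0 < e) (h1 : e < 1) (l g : ℝ) :
    ∫ τ in (0 : ℝ)..(2 * π), ((orbX e (l + τ) ^ 2 - orbY e (l + τ) ^ 2) * cos (2 * g - n * τ) -
      2 * orbX e (l + τ) * orbY e (l + τ) * sin (2 * g - n * τ)) =
      π * coeffU n e * cos (2 * g + n * l) := by
  have hcX := continuous_orbX h0.le h1
  have hcY := continuous_orbY h0.le h1
  set c := 2 * g + n * l with hc
  set F : ℝ → ℝ := fun M => (orbX e M ^ 2 - orbY e M ^ 2) * cos (c - n * M) -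
    2 * orbX e M * orbY e M * sin (c - n * M) with hF
  have hFc : Continuous F := by fun_prop
  have hper : Function.Periodic F (2 * π) := by
    intro M
    simp only [hF, orbX_add_two_pi h0.le h1, orbY_add_two_pi h0.le h1]
    rw [show c - n * (M + 2 * π) = c - n * M - n * (2 * π) by ring, cos_sub_nat_mul_two_pi,
      sin_sub_nat_mul_two_pi]
  have e1 : (fun τ => (orbX e (l + τ) ^ 2 - orbY e (l + τ) ^ 2) * cos (2 * g - n * τ) -
      2 * orbX e (l + τ) * orbY e (l + τ) * sin (2 * g - n * τ)) = fun τ => F (l + τ) := by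
    ext τ
    simp only [hF]
    rw [show c - n * (l + τ) = 2 * g - n * τ by rw [hc]; ring]
  rw [e1, intervalIntegral.integral_comp_add_left, add_zero,
    hper.intervalIntegral_add_eq l (-π), show -π + 2 * π = π by ring,
    ← intervalIntegral.integral_add_adjacent_intervals (b := 0) (hFc.intervalIntegrable _ _)
      (hFc.intervalIntegrable _ _)]
  have e2 : ∫ M in (-π)..0, F M = ∫ M in (0 : ℝ)..π, F (-M) := by
    rw [intervalIntegral.integral_comp_neg, neg_zero]
  rw [e2, ← intervalIntegral.integral_add (Continuous.intervalIntegrable (by fun_prop) _ _)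
    (hFc.intervalIntegrable _ _)]
  have e3 : (fun M => F (-M) + F M) = fun M => (2 * cos c) *
      ((orbX e M ^ 2 - orbY e M ^ 2) * cos (n * M) + 2 * orbX e M * orbY e M * sin (n * M)) := by
    ext M
    simp only [hF, orbX_neg h0.le h1, orbY_neg h0.le h1, mul_neg, cos_sub, sin_sub,
      cos_neg, sin_neg]
    ring
  rw [e3, intervalIntegral.integral_const_mul, integral_orb_half hn h0 h1]
  ring

end

end KeplerWave

namespace KeplerWave

open Filter Topology Set

/-! ### Superposition operators and the implicit function theorem -/

section

set_option linter.unusedSectionVars false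

variable {K : Type*} [TopologicalSpace K] [CompactSpace K]
  {E : Type*} [NormedAddCommGroup E] [NormedSpace ℝ E]
  {F : Type*} [NormedAddCommGroup F] [NormedSpace ℝ F]

open Classical in
/-- The superposition operator `u ↦ f ∘ u` on continuous functions, with the junk value `0` where
`f ∘ u` is not continuous. -/
noncomputable def superpose (f : E → F) (u : C(K, E)) : C(K, F) :=
  if h : Continuous (f ∘ u) then ⟨f ∘ u, h⟩ else 0

/-- Pointwise application of a continuous family of operators. -/
noncomputable def pointwiseCLM (g : C(K, E →L[ℝ] F)) : C(K, E) →L[ℝ] C(K, F) :=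
  LinearMap.mkContinuous
    { toFun := fun v => ⟨fun k => g k (v k), g.continuous.clm_apply v.continuous⟩
      map_add' := fun v w => by ext k; simp
      map_smul' := fun c v => by ext k; simp } ‖g‖ fun v => by
    refine (ContinuousMap.norm_le _ (by positivity)).2 fun k => ?_
    exact ((g k).le_opNorm _).trans
      (mul_le_mul (g.norm_coe_le_norm k) (v.norm_coe_le_norm k) (norm_nonneg _) (norm_nonneg g))

@[simp] lemma pointwiseCLM_apply (g : C(K, E →L[ℝ] F)) (v : C(K, E)) (k : K) :
    pointwiseCLM g v k = g k (v k) := rfl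

lemma eventually_mem_of_isOpen {S : Set E} (hS : IsOpen S) {u₀ : C(K, E)} (h : ∀ k, u₀ k ∈ S) :
    ∀ᶠ u in 𝓝 u₀, ∀ k, u k ∈ S := by
  have := ContinuousMap.eventually_mapsTo (f := u₀) isCompact_univ hS (fun k _ => h k)
  filter_upwards [this] with u hu k using hu (mem_univ k)

lemma superpose_apply {f : E → F} {S : Set E} (hf : ContinuousOn f S) {u : C(K, E)}
    (hu : ∀ k, u k ∈ S) (k : K) : superpose f u k = f (u k) := by
  have h : Continuous (f ∘ u) := hf.comp_continuous u.continuous hu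
  simp [superpose, h]

/-- The superposition operator of a `C¹` map is strictly differentiable. -/
lemma hasStrictFDerivAt_superpose {f : E → F} {S : Set E} (hS : IsOpen S)
    (hf : ∀ x ∈ S, ContDiffAt ℝ 1 f x) {u₀ : C(K, E)} (h₀ : ∀ k, u₀ k ∈ S)
    (g : C(K, E →L[ℝ] F)) (hg : ∀ k, g k = fderiv ℝ f (u₀ k)) :
    HasStrictFDerivAt (superpose f) (pointwiseCLM g) u₀ := by
  have hfc : ContinuousOn f S := fun x hx => (hf x hx).continuousAt.continuousWithinAt
  refine .of_isLittleO (Asymptotics.IsLittleO.of_bound fun c hc => ?_)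
  -- a uniform version of strict differentiability along the compact range of `u₀`
  have hunif : ∀ᶠ a : E × E in 𝓝 0, ∀ x ∈ range u₀,
      ‖f (x + a.1) - f (x + a.2) - fderiv ℝ f x (a.1 - a.2)‖ ≤ c * ‖a.1 - a.2‖ := by
    refine (isCompact_range u₀.continuous).eventually_forall_of_forall_eventually ?_
    rintro _ ⟨k, rfl⟩
    have hx := hf _ (h₀ k)
    have h1 := (hx.hasStrictFDerivAt one_ne_zero).isLittleO.bound (half_pos hc)
    have h2 : ∀ᶠ y in 𝓝 (u₀ k), ‖fderiv ℝ f y - fderiv ℝ f (u₀ k)‖ ≤ c / 2 := by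
      have := (hx.fderiv_right (m := 0) le_rfl).continuousAt
      have := Metric.tendsto_nhds.1 this (c / 2) (half_pos hc)
      filter_upwards [this] with y hy
      rw [← dist_eq_norm]; exact hy.le
    have ht1 : Tendsto (fun z : (E × E) × E => (z.2 + z.1.1, z.2 + z.1.2))
        (𝓝 ((0 : E × E), u₀ k)) (𝓝 (u₀ k, u₀ k)) := by
      have : Continuous fun z : (E × E) × E => (z.2 + z.1.1, z.2 + z.1.2) := by fun_prop
      simpa using this.tendsto ((0 : E × E), u₀ k)
    have ht2 : Tendsto (fun z : (E × E) × E => z.2) (𝓝 ((0 : E × E), u₀ k)) (𝓝 (u₀ k)) :=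
      continuous_snd.tendsto _
    filter_upwards [ht1.eventually h1, ht2.eventually h2] with z hz1 hz2
    have e1 : f (z.2 + z.1.1) - f (z.2 + z.1.2) - fderiv ℝ f z.2 (z.1.1 - z.1.2) =
        (f (z.2 + z.1.1) - f (z.2 + z.1.2) - fderiv ℝ f (u₀ k) (z.1.1 - z.1.2)) -
          (fderiv ℝ f z.2 - fderiv ℝ f (u₀ k)) (z.1.1 - z.1.2) := by
      simp
    rw [e1]
    rw [add_sub_add_left_eq_sub] at hz1
    calc _ ≤ _ := norm_sub_le _ _
      _ ≤ c / 2 * ‖z.1.1 - z.1.2‖ + c / 2 * ‖z.1.1 - z.1.2‖ :=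
        add_le_add hz1 ((ContinuousLinearMap.le_opNorm _ _).trans
          (mul_le_mul_of_nonneg_right hz2 (norm_nonneg _)))
      _ = _ := by ring
  obtain ⟨ρ, hρ, hball⟩ := Metric.eventually_nhds_iff.1 hunif
  have hmem := eventually_mem_of_isOpen hS h₀
  have hnear : ∀ᶠ u in 𝓝 u₀, dist u u₀ < ρ := Metric.ball_mem_nhds u₀ hρ
  have hev : ∀ᶠ u in 𝓝 u₀, (∀ k, u k ∈ S) ∧ dist u u₀ < ρ := hmem.and hnear
  have hfst : Tendsto (Prod.fst : C(K, E) × C(K, E) → C(K, E)) (𝓝 (u₀, u₀)) (𝓝 u₀) :=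
    continuous_fst.tendsto _
  have hsnd : Tendsto (Prod.snd : C(K, E) × C(K, E) → C(K, E)) (𝓝 (u₀, u₀)) (𝓝 u₀) :=
    continuous_snd.tendsto _
  filter_upwards [hfst.eventually hev, hsnd.eventually hev] with p h1 h2
  refine (ContinuousMap.norm_le _ (by positivity)).2 fun k => ?_
  have hd : dist ((p.1 k - u₀ k, p.2 k - u₀ k) : E × E) 0 < ρ := by
    rw [dist_zero_right, Prod.norm_def]
    refine max_lt ?_ ?_
    · rw [← dist_eq_norm]; exact (ContinuousMap.dist_apply_le_dist k).trans_lt h1.2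
    · rw [← dist_eq_norm]; exact (ContinuousMap.dist_apply_le_dist k).trans_lt h2.2
  have := hball hd (u₀ k) ⟨k, rfl⟩
  simp only [add_sub_cancel, sub_sub_sub_cancel_right] at this
  simp only [ContinuousMap.sub_apply, pointwiseCLM_apply, superpose_apply hfc h1.1,
    superpose_apply hfc h2.1, hg]
  refine this.trans (mul_le_mul_of_nonneg_left ?_ hc.le)
  exact (p.1 - p.2).norm_coe_le_norm k

/-- The implicit function theorem with a real parameter; the implicit function is continuous on a
whole interval although the equation need only be strictly differentiable at one point. -/
lemma exists_continuous_implicit_curve [CompleteSpace E] [CompleteSpace F] {Φ : E × ℝ → F}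
    {Φ' : E × ℝ →L[ℝ] F} {x₀ : E} (h : HasStrictFDerivAt Φ Φ' (x₀, 0)) (h0 : Φ (x₀, 0) = 0)
    (hinj : ∀ v, Φ' (v, 0) = 0 → v = 0) (hsurj : ∀ w, ∃ v, Φ' (v, 0) = w) :
    ∃ ε₀ > 0, ∃ ψ : ℝ → E, ContinuousOn ψ (Ioo (-ε₀) ε₀) ∧ ψ 0 = x₀ ∧
      ∀ ε ∈ Ioo (-ε₀) ε₀, Φ (ψ ε, ε) = 0 := by
  have hΨ : HasStrictFDerivAt (fun p : E × ℝ => (Φ p, p.2))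
      (Φ'.prod (ContinuousLinearMap.snd ℝ E ℝ)) (x₀, 0) := h.prodMk hasStrictFDerivAt_snd
  let e : (E × ℝ) ≃L[ℝ] (F × ℝ) := ContinuousLinearEquiv.ofBijective
    (Φ'.prod (ContinuousLinearMap.snd ℝ E ℝ))
    (by
      refine LinearMap.ker_eq_bot'.2 ?_
      rintro ⟨v, s⟩ hv
      have hv' : (Φ' (v, s), s) = ((0 : F), (0 : ℝ)) := hv
      obtain ⟨h1, rfl⟩ := Prod.ext_iff.1 hv'
      rw [hinj v h1]; rfl)
    (by
      refine LinearMap.range_eq_top.2 ?_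
      rintro ⟨w, s⟩
      obtain ⟨v, hv⟩ := hsurj (w - Φ' (0, s))
      refine ⟨(v, s), ?_⟩
      change (Φ' (v, s), s) = (w, s)
      have : ((v, s) : E × ℝ) = (v, 0) + (0, s) := by simp
      rw [this, map_add, hv, sub_add_cancel])
  have he : HasStrictFDerivAt (fun p : E × ℝ => (Φ p, p.2)) (e : E × ℝ →L[ℝ] F × ℝ) (x₀, 0) := by
    convert hΨ using 1
    ext <;> rfl
  let H := he.toOpenPartialHomeomorph
  have hcoe : ∀ p, H p = (Φ p, p.2) := fun p => rfl
  have hsrc : ((x₀, 0) : E × ℝ) ∈ H.source := he.mem_toOpenPartialHomeomorph_source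
  have htgt : ((0, 0) : F × ℝ) ∈ H.target := by
    have := H.map_source hsrc
    rwa [hcoe, h0] at this
  have hpre : (fun ε : ℝ => ((0, ε) : F × ℝ)) ⁻¹' H.target ∈ 𝓝 (0 : ℝ) :=
    (H.open_target.preimage (by fun_prop)).mem_nhds htgt
  obtain ⟨ε₀, hε, hsub⟩ := Metric.mem_nhds_iff.1 hpre
  rw [Real.ball_eq_Ioo, zero_sub, zero_add] at hsub
  refine ⟨ε₀, hε, fun ε => (H.symm (0, ε)).1, ?_, ?_, fun ε hε => ?_⟩
  · exact continuous_fst.comp_continuousOn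
      (H.continuousOn_symm.comp (Continuous.continuousOn (by fun_prop)) hsub)
  · have := H.left_inv hsrc
    rw [hcoe, h0] at this
    simp only [this]
  · have hr := H.right_inv (hsub hε)
    rw [hcoe] at hr
    obtain ⟨h1, h2⟩ := Prod.ext_iff.1 hr
    simp only at h1 h2
    rw [show ((H.symm (0, ε)).1, ε) = H.symm (0, ε) from Prod.ext rfl h2.symm]
    exact h1

end

/-! ### Periodic solutions of slowly varying systems -/

section

set_option linter.unusedSectionVars false

variable {E : Type*} [NormedAddCommGroup E] [NormedSpace ℝ E]
  {T : ℝ}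

/-- The extension of a function on `[0, T]` to the real line, constant outside. -/
noncomputable def extendIcc (hT : 0 ≤ T) (v : C(Icc 0 T, E)) (t : ℝ) : E := v (projIcc 0 T hT t)

lemma continuous_extendIcc (hT : 0 ≤ T) (v : C(Icc 0 T, E)) : Continuous (extendIcc hT v) :=
  v.continuous.comp continuous_projIcc

lemma extendIcc_of_mem (hT : 0 ≤ T) (v : C(Icc 0 T, E)) {t : ℝ} (ht : t ∈ Icc 0 T) :
    extendIcc hT v t = v ⟨t, ht⟩ := by
  rw [extendIcc, projIcc_of_mem hT ht]

lemma norm_extendIcc_le (hT : 0 ≤ T) (v : C(Icc 0 T, E)) (t : ℝ) : ‖extendIcc hT v t‖ ≤ ‖v‖ :=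
  v.norm_coe_le_norm _

/-- The primitive vanishing at zero, as an operator on `C([0, T])`. -/
noncomputable def primitiveCLM (hT : 0 ≤ T) : C(Icc 0 T, E) →L[ℝ] C(Icc 0 T, E) :=
  LinearMap.mkContinuous
    { toFun := fun v => ⟨fun t => ∫ s in (0 : ℝ)..t, extendIcc hT v s,
        (intervalIntegral.continuous_primitive
          (fun a b => (continuous_extendIcc hT v).intervalIntegrable a b) 0).comp
          continuous_subtype_val⟩
      map_add' := fun v w => by
        ext t
        exact intervalIntegral.integral_add ((continuous_extendIcc hT v).intervalIntegrable _ _)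
          ((continuous_extendIcc hT w).intervalIntegrable _ _)
      map_smul' := fun c v => by
        ext t
        exact intervalIntegral.integral_smul c _ } T fun v => by
    refine (ContinuousMap.norm_le _ (by positivity)).2 fun t => ?_
    have := intervalIntegral.norm_integral_le_of_norm_le_const (a := 0) (b := (t : ℝ))
      (f := extendIcc hT v) (C := ‖v‖) fun s _ => norm_extendIcc_le hT v s
    refine this.trans ?_
    rw [sub_zero, abs_of_nonneg t.2.1, mul_comm]
    exact mul_le_mul_of_nonneg_right t.2.2 (norm_nonneg _)

lemma primitiveCLM_apply (hT : 0 ≤ T) (v : C(Icc 0 T, E)) (t : Icc 0 T) :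
    primitiveCLM hT v t = ∫ s in (0 : ℝ)..t, extendIcc hT v s := rfl

/-- The left endpoint of `[0, T]`. -/
def leftPt (hT : 0 ≤ T) : Icc 0 T := ⟨0, left_mem_Icc.2 hT⟩

/-- The right endpoint of `[0, T]`. -/
def rightPt (hT : 0 ≤ T) : Icc 0 T := ⟨T, right_mem_Icc.2 hT⟩

/-- The integral over `[0, T]`. -/
noncomputable def integralCLM (hT : 0 ≤ T) : C(Icc 0 T, E) →L[ℝ] E :=
  (ContinuousMap.evalCLM ℝ (rightPt hT)).comp (primitiveCLM hT)

lemma integralCLM_apply (hT : 0 ≤ T) (v : C(Icc 0 T, E)) :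
    integralCLM hT v = ∫ s in (0 : ℝ)..T, extendIcc hT v s := rfl

/-- Constant functions on `[0, T]`. -/
noncomputable def constCLM (T : ℝ) (E : Type*) [NormedAddCommGroup E] [NormedSpace ℝ E] :
    E →L[ℝ] C(Icc 0 T, E) :=
  LinearMap.mkContinuous
    { toFun := fun c => ContinuousMap.const _ c
      map_add' := fun _ _ => rfl
      map_smul' := fun _ _ => rfl } 1 fun c => by
    rw [one_mul]
    exact (ContinuousMap.norm_le _ (norm_nonneg _)).2 fun t => le_rfl

@[simp] lemma constCLM_apply (c : E) (t : Icc 0 T) : constCLM T E c t = c := rfl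

/-- The curve `t ↦ t c`. -/
noncomputable def linearCurve (T : ℝ) (c : E) : C(Icc 0 T, E) := ⟨fun t => (t : ℝ) • c, by fun_prop⟩

/-- The affine map `(w, ε) ↦ (t ↦ (t, w t, ε))`. -/
noncomputable def graphMap (p : C(Icc 0 T, E) × ℝ) : C(Icc 0 T, ℝ × E × ℝ) :=
  ⟨fun t => ((t : ℝ), p.1 t, p.2), by fun_prop⟩

/-- The linear part of `graphMap`. -/
noncomputable def graphCLM (T : ℝ) (E : Type*) [NormedAddCommGroup E] [NormedSpace ℝ E] :
    C(Icc 0 T, E) × ℝ →L[ℝ] C(Icc 0 T, ℝ × E × ℝ) :=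
  LinearMap.mkContinuous
    { toFun := fun p => ⟨fun t => ((0 : ℝ), p.1 t, p.2), by fun_prop⟩
      map_add' := fun _ _ => by ext t <;> simp
      map_smul' := fun _ _ => by ext t <;> simp } 1 fun p => by
    rw [one_mul]
    refine (ContinuousMap.norm_le _ (norm_nonneg _)).2 fun t => ?_
    simp only [LinearMap.coe_mk, AddHom.coe_mk, ContinuousMap.coe_mk, Prod.norm_def, norm_zero]
    exact max_le (by positivity) (max_le_max (p.1.norm_coe_le_norm t) le_rfl)

lemma hasStrictFDerivAt_graphMap (p : C(Icc 0 T, E) × ℝ) :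
    HasStrictFDerivAt graphMap (graphCLM T E) p := by
  have h : (graphMap : C(Icc 0 T, E) × ℝ → _) = fun p => graphCLM T E p + graphMap 0 := by
    ext p t <;> simp [graphMap, graphCLM]
  rw [h]
  exact (graphCLM T E).hasStrictFDerivAt.add_const _

/-- The derivative of a time-dependent map along a continuous curve, as a continuous family. -/
lemma exists_fderiv_family {F : Type*} [NormedAddCommGroup F] [NormedSpace ℝ F]
    {f : ℝ × E × ℝ → F} {z₀ : E} {ε : ℝ}
    (hf : ∀ t, ContDiffAt ℝ 1 f (t, z₀, ε)) :
    ∃ g : C(Icc 0 T, ℝ × E × ℝ →L[ℝ] F), ∀ t : Icc 0 T, g t = fderiv ℝ f ((t : ℝ), z₀, ε) := by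
  refine ⟨⟨fun t => fderiv ℝ f ((t : ℝ), z₀, ε), ?_⟩, fun t => rfl⟩
  refine continuous_iff_continuousAt.2 fun t => ?_
  have h1 := ((hf t).fderiv_right (m := 0) le_rfl).continuousAt
  exact ContinuousAt.comp (f := fun t : Icc 0 T => ((t : ℝ), z₀, ε)) h1
    (Continuous.continuousAt (by fun_prop))

variable [CompleteSpace E]

/-- The linear operator `v ↦ v - v(0) - ∫₀ᵗ A v - ∫₀ᵀ β v` is injective, resp. surjective, when `A`
has square zero and `c ↦ ∫₀ᵀ β(s) (c + s A c) ds` is injective: the curves annihilated up to constants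
by the first three terms are `c + t A c`. -/
lemma linearized_bijective [FiniteDimensional ℝ E] (hT : 0 ≤ T)
    {A : E →L[ℝ] E} (hA : ∀ c, A (A c) = 0)
    (β : C(Icc 0 T, E →L[ℝ] E)) (g : C(Icc 0 T, E →L[ℝ] E)) (hg : ∀ t, g t = A)
    (hinj : ∀ c : E, integralCLM hT (pointwiseCLM β (constCLM T E c + linearCurve T (A c))) = 0 →
      c = 0) :
    let Λ : C(Icc 0 T, E) → C(Icc 0 T, E) := fun v =>
      v - constCLM T E (v (leftPt hT)) - primitiveCLM hT (pointwiseCLM g v) -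
        constCLM T E (integralCLM hT (pointwiseCLM β v))
    (∀ v, Λ v = 0 → v = 0) ∧ ∀ w, ∃ v, Λ v = w := by
  intro Λ
  have hprim0 : ∀ v : C(Icc 0 T, E), primitiveCLM hT v (leftPt hT) = 0 := fun v => by
    rw [primitiveCLM_apply]; exact intervalIntegral.integral_same
  -- `A` commutes with taking primitives
  have hAint : ∀ (v : C(Icc 0 T, E)) (t : Icc 0 T),
      A (primitiveCLM hT v t) = primitiveCLM hT (pointwiseCLM g v) t := by
    intro v t
    rw [primitiveCLM_apply, primitiveCLM_apply, ← ContinuousLinearMap.intervalIntegral_comp_comm _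
      ((continuous_extendIcc hT v).intervalIntegrable _ _)]
    simp only [extendIcc, pointwiseCLM_apply, hg]
  have hconst : ∀ (c : E), primitiveCLM hT (constCLM T E c) = linearCurve T c := by
    intro c
    ext t
    rw [primitiveCLM_apply]
    simp [extendIcc, linearCurve]
  have hgc : ∀ c : E, pointwiseCLM g (constCLM T E c) = constCLM T E (A c) := fun c => by
    ext t; simp [hg]
  constructor
  · intro v hv
    have hv' : ∀ t, v t - v (leftPt hT) - primitiveCLM hT (pointwiseCLM g v) t -
        integralCLM hT (pointwiseCLM β v) = 0 := fun t => by
      simpa [Λ] using DFunLike.congr_fun hv t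
    have hI : integralCLM hT (pointwiseCLM β v) = 0 := by
      have := hv' (leftPt hT)
      simpa [hprim0] using this
    set c := v (leftPt hT) with hc
    have hAv : pointwiseCLM g v = constCLM T E (A c) := by
      ext t
      have h1 := hv' t
      rw [hI, sub_zero, sub_sub, sub_eq_zero] at h1
      rw [pointwiseCLM_apply, hg, h1, map_add, hAint]
      have : pointwiseCLM g (pointwiseCLM g v) = 0 := by ext s; simp [hg, hA]
      rw [this, map_zero]; simp
    have hvc : v = constCLM T E c + linearCurve T (A c) := by
      ext t
      have h1 := hv' t
      rw [hI, sub_zero, sub_sub, sub_eq_zero, hAv, hconst] at h1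
      exact h1
    rw [hvc] at hI
    have h0 := hinj c hI
    rw [hvc, h0]
    ext t; simp [linearCurve]
  · intro w
    let B : E →ₗ[ℝ] E :=
      { toFun := fun c => integralCLM hT (pointwiseCLM β (constCLM T E c + linearCurve T (A c)))
        map_add' := fun c d => by
          rw [← map_add, ← map_add]
          congr 2
          ext t; simp [linearCurve]; abel
        map_smul' := fun r c => by
          rw [RingHom.id_apply, ← map_smul, ← map_smul]
          congr 2
          ext t
          change r • c + (t : ℝ) • A (r • c) = r • (c + (t : ℝ) • A c)
          rw [map_smul, smul_add, smul_comm] }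
    have hBinj : Function.Injective B := (injective_iff_map_eq_zero B).2 hinj
    have hBsurj : Function.Surjective B := LinearMap.injective_iff_surjective.1 hBinj
    set h := w - constCLM T E (w (leftPt hT)) with hh
    set k := h + primitiveCLM hT (pointwiseCLM g h) with hk
    obtain ⟨c, hc⟩ := hBsurj (-w (leftPt hT) - integralCLM hT (pointwiseCLM β k))
    have hc' : integralCLM hT (pointwiseCLM β (constCLM T E c + linearCurve T (A c))) = _ := hc
    have hk0 : k (leftPt hT) = 0 := by
      rw [hk, ContinuousMap.add_apply, hprim0, add_zero, hh, ContinuousMap.sub_apply,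
        constCLM_apply, sub_self]
    refine ⟨constCLM T E c + linearCurve T (A c) + k, ?_⟩
    have h1 : (constCLM T E c + linearCurve T (A c) + k) (leftPt hT) = c := by
      rw [ContinuousMap.add_apply, ContinuousMap.add_apply, hk0, constCLM_apply, add_zero,
        show linearCurve T (A c) (leftPt hT) = 0 from zero_smul ℝ _, add_zero]
    have h2 : pointwiseCLM g (constCLM T E c + linearCurve T (A c) + k) =
        constCLM T E (A c) + pointwiseCLM g h := by
      rw [map_add, map_add, hgc, hk, map_add]
      have e1 : pointwiseCLM g (linearCurve T (A c)) = 0 := by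
        ext t; simp [hg, linearCurve, hA]
      have e2 : pointwiseCLM g (primitiveCLM hT (pointwiseCLM g h)) = 0 := by
        ext t
        rw [pointwiseCLM_apply, hg, hAint]
        have : pointwiseCLM g (pointwiseCLM g h) = 0 := by ext s; simp [hg, hA]
        rw [this, map_zero]
      rw [e1, e2]; simp
    have h3 : integralCLM hT (pointwiseCLM β (constCLM T E c + linearCurve T (A c) + k)) =
        -w (leftPt hT) := by
      rw [map_add, map_add, hc']; abel
    simp only [Λ]
    rw [h1, h2, h3, map_add, hconst, map_neg, hk, hh]
    abel

/-- Periodic solutions from the averaged equation. The vector field `f` is slaved to `b` by an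
operator `M ε` that may degenerate at `ε = 0`, so that `∫ b = 0` is the bifurcation equation
obtained from `∫ f = 0` after division by the small parameter. -/
theorem exists_periodic_arc [FiniteDimensional ℝ E] (hT : 0 < T) {S : Set E} (hS : IsOpen S)
    {b f : ℝ × E × ℝ → E} (hb : ∀ t, ∀ z ∈ S, ∀ ε, ContDiffAt ℝ 1 b (t, z, ε))
    (hf : ∀ t, ∀ z ∈ S, ∀ ε, ContDiffAt ℝ 1 f (t, z, ε))
    {M : ℝ → E →L[ℝ] E} (hfb : ∀ t z ε, f (t, z, ε) = M ε (b (t, z, ε)))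
    {z₀ : E} (hz₀ : z₀ ∈ S) (hf0 : ∀ t, f (t, z₀, 0) = 0)
    (hb0 : ∫ t in (0 : ℝ)..T, b (t, z₀, 0) = 0)
    {A : E →L[ℝ] E} (hA : ∀ c, A (A c) = 0)
    (hfA : ∀ t c, fderiv ℝ f (t, z₀, 0) (0, c, 0) = A c)
    (hinj : ∀ c : E, ∫ t in (0 : ℝ)..T, fderiv ℝ b (t, z₀, 0) (0, c + t • A c, 0) = 0 → c = 0) :
    ∃ ε₀ > 0, ∃ w : ℝ → C(Icc 0 T, E), ContinuousOn w (Ioo (-ε₀) ε₀) ∧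
      w 0 = ContinuousMap.const _ z₀ ∧ ∀ ε ∈ Ioo (-ε₀) ε₀, (∀ t, w ε t ∈ S) ∧
        w ε (leftPt hT.le) = w ε (rightPt hT.le) ∧
        ∀ t : Icc 0 T, w ε t = w ε (leftPt hT.le) +
          ∫ s in (0 : ℝ)..t, f (s, extendIcc hT.le (w ε) s, ε) := by
  have hT' := hT.le
  set S' : Set (ℝ × E × ℝ) := {p | p.2.1 ∈ S} with hS'
  have hS'o : IsOpen S' := hS.preimage (by fun_prop)
  have hb' : ∀ p ∈ S', ContDiffAt ℝ 1 b p := fun p hp => hb p.1 p.2.1 hp p.2.2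
  have hf' : ∀ p ∈ S', ContDiffAt ℝ 1 f p := fun p hp => hf p.1 p.2.1 hp p.2.2
  have hbc : ContinuousOn b S' := fun x hx => (hb' x hx).continuousAt.continuousWithinAt
  have hfc : ContinuousOn f S' := fun x hx => (hf' x hx).continuousAt.continuousWithinAt
  obtain ⟨gb, hgb⟩ := exists_fderiv_family (T := T) (f := b) (z₀ := z₀) (ε := 0)
    fun t => hb t z₀ hz₀ 0
  obtain ⟨gf, hgf⟩ := exists_fderiv_family (T := T) (f := f) (z₀ := z₀) (ε := 0)
    fun t => hf t z₀ hz₀ 0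
  set x₀ : C(Icc 0 T, E) := ContinuousMap.const _ z₀ with hx₀
  have hsb : HasStrictFDerivAt (fun p => superpose b (graphMap p))
      ((pointwiseCLM gb).comp (graphCLM T E)) (x₀, (0 : ℝ)) :=
    (hasStrictFDerivAt_superpose hS'o hb' (u₀ := graphMap (x₀, 0)) (fun k => hz₀) gb hgb).comp _
      (hasStrictFDerivAt_graphMap _)
  have hsf : HasStrictFDerivAt (fun p => superpose f (graphMap p))
      ((pointwiseCLM gf).comp (graphCLM T E)) (x₀, (0 : ℝ)) :=
    (hasStrictFDerivAt_superpose hS'o hf' (u₀ := graphMap (x₀, 0)) (fun k => hz₀) gf hgf).comp _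
      (hasStrictFDerivAt_graphMap _)
  set ev : C(Icc 0 T, E) →L[ℝ] E := ContinuousMap.evalCLM ℝ (leftPt hT') with hev
  -- Evaluation at `t = 0` of a zero of `Φ` gives `∫ b = 0`, and then `Φ = 0` is the integral
  -- equation; one equation in `C([0, T])` thus encodes both the dynamics and the periodicity.
  set Φ : C(Icc 0 T, E) × ℝ → C(Icc 0 T, E) := fun p =>
    p.1 - constCLM T E (ev p.1) - primitiveCLM hT' (superpose f (graphMap p)) -
      constCLM T E (integralCLM hT' (superpose b (graphMap p))) with hΦ
  have hΦ' := ((hasStrictFDerivAt_fst (𝕜 := ℝ) (p := (x₀, (0 : ℝ)))).sub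
    ((constCLM T E).comp ev |>.hasStrictFDerivAt.comp _
      (hasStrictFDerivAt_fst (𝕜 := ℝ) (p := (x₀, (0 : ℝ)))))).sub
    ((primitiveCLM hT').hasStrictFDerivAt.comp _ hsf) |>.sub
    ((constCLM T E).comp (integralCLM hT') |>.hasStrictFDerivAt.comp _ hsb)
  have hsup : ∀ p : C(Icc 0 T, E) × ℝ, (∀ t, p.1 t ∈ S) → ∀ t : Icc 0 T,
      superpose f (graphMap p) t = f (t, p.1 t, p.2) ∧
      superpose b (graphMap p) t = b (t, p.1 t, p.2) := fun p hp t =>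
    ⟨superpose_apply hfc (fun k => hp k) t, superpose_apply hbc (fun k => hp k) t⟩
  have hint : ∀ p : C(Icc 0 T, E) × ℝ, (∀ t, p.1 t ∈ S) → 
      integralCLM hT' (superpose b (graphMap p)) =
        ∫ s in (0 : ℝ)..T, b (s, extendIcc hT' p.1 s, p.2) := by
    intro p hp
    rw [integralCLM_apply]
    refine intervalIntegral.integral_congr fun s hs => ?_
    rw [uIcc_of_le hT'] at hs
    simp only [extendIcc_of_mem hT' _ hs]
    exact (hsup p hp _).2
  have hprim : ∀ p : C(Icc 0 T, E) × ℝ, (∀ t, p.1 t ∈ S) → ∀ t : Icc 0 T,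
      primitiveCLM hT' (superpose f (graphMap p)) t =
        ∫ s in (0 : ℝ)..t, f (s, extendIcc hT' p.1 s, p.2) := by
    intro p hp t
    rw [primitiveCLM_apply]
    refine intervalIntegral.integral_congr fun s hs => ?_
    rw [uIcc_of_le t.2.1] at hs
    have hs' : s ∈ Icc 0 T := ⟨hs.1, hs.2.trans t.2.2⟩
    simp only [extendIcc_of_mem hT' _ hs']
    exact (hsup p hp _).1
  have h0 : Φ (x₀, 0) = 0 := by
    ext t
    simp only [hΦ, ContinuousMap.sub_apply, constCLM_apply, ContinuousMap.zero_apply]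
    rw [hint (x₀, 0) (fun _ => hz₀), hprim (x₀, 0) (fun _ => hz₀)]
    have e1 : ∀ s, extendIcc hT' x₀ s = z₀ := fun s => rfl
    simp only [e1, hf0, hb0]
    simp [hev, hx₀]
  -- the linearization falls under `linearized_bijective`
  let inner : E →L[ℝ] ℝ × E × ℝ := (ContinuousLinearMap.inr ℝ ℝ (E × ℝ)).comp
    (ContinuousLinearMap.inl ℝ E ℝ)
  let β : C(Icc 0 T, E →L[ℝ] E) := ⟨fun t => (gb t).comp inner, by
    exact gb.continuous.clm_comp continuous_const⟩
  let γ : C(Icc 0 T, E →L[ℝ] E) := ⟨fun t => (gf t).comp inner, by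
    exact gf.continuous.clm_comp continuous_const⟩
  have hγ : ∀ t, γ t = A := by
    intro t; ext c
    change gf t (0, c, 0) = A c
    rw [hgf, hfA]
  have hΛ := linearized_bijective hT' hA β γ hγ (fun c hc => hinj c (by
    rw [← hc, integralCLM_apply]
    refine intervalIntegral.integral_congr fun s hs => ?_
    rw [uIcc_of_le hT'] at hs
    simp only [extendIcc_of_mem hT' _ hs]
    change _ = gb _ (0, c + s • A c, 0)
    rw [hgb]))
  obtain ⟨ε₁, hε₁, w, hwc, hw0, hw⟩ := exists_continuous_implicit_curve hΦ' h0 hΛ.1 hΛ.2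
  have hwS : ∀ᶠ ε in 𝓝 (0 : ℝ), ∀ t, w ε t ∈ S := by
    have hc : ContinuousAt w 0 := hwc.continuousAt (Ioo_mem_nhds (by linarith) hε₁)
    exact hc.eventually (by rw [hw0]; exact eventually_mem_of_isOpen hS fun _ => hz₀)
  obtain ⟨ε₂, hε₂, hwS⟩ := Metric.eventually_nhds_iff.1 hwS
  refine ⟨min ε₁ ε₂, lt_min hε₁ hε₂, w, hwc.mono ?_, hw0, fun ε hε => ?_⟩
  · exact Ioo_subset_Ioo (neg_le_neg (min_le_left _ _)) (min_le_left _ _)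
  have hm : ∀ t, w ε t ∈ S := hwS (by
    rw [Real.dist_eq, sub_zero, abs_lt]
    exact ⟨by linarith [hε.1, min_le_right ε₁ ε₂], by linarith [hε.2, min_le_right ε₁ ε₂]⟩)
  have hz := hw ε ⟨by linarith [hε.1, min_le_left ε₁ ε₂], by linarith [hε.2, min_le_left ε₁ ε₂]⟩
  have hz' : ∀ t, w ε t - w ε (leftPt hT') - (∫ s in (0 : ℝ)..t, f (s, extendIcc hT' (w ε) s, ε)) -
      ∫ s in (0 : ℝ)..T, b (s, extendIcc hT' (w ε) s, ε) = 0 := by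
    intro t
    rw [← hint (w ε, ε) hm, ← hprim (w ε, ε) hm]
    exact DFunLike.congr_fun hz t
  have hbz : ∫ s in (0 : ℝ)..T, b (s, extendIcc hT' (w ε) s, ε) = 0 := by
    have := hz' (leftPt hT')
    simpa [leftPt] using this
  have hfz : ∫ s in (0 : ℝ)..T, f (s, extendIcc hT' (w ε) s, ε) = 0 := by
    simp only [hfb]
    rw [ContinuousLinearMap.intervalIntegral_comp_comm, hbz, map_zero]
    refine ContinuousOn.intervalIntegrable fun s _ => ContinuousAt.continuousWithinAt ?_
    have h1 := (hb s (extendIcc hT' (w ε) s) (hm _) ε).continuousAt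
    have h2 := continuous_extendIcc hT' (w ε)
    exact ContinuousAt.comp (f := fun s => (s, extendIcc hT' (w ε) s, ε)) h1
      (Continuous.continuousAt (by fun_prop))
  have hfin : ∀ t : Icc 0 T, w ε t = w ε (leftPt hT') +
      ∫ s in (0 : ℝ)..t, f (s, extendIcc hT' (w ε) s, ε) := by
    intro t
    have := hz' t
    rw [hbz, sub_zero, sub_sub, sub_eq_zero] at this
    exact this
  refine ⟨hm, ?_, hfin⟩
  rw [hfin (rightPt hT')]
  change _ = _ + ∫ s in (0 : ℝ)..T, f (s, extendIcc hT' (w ε) s, ε)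
  rw [hfz, add_zero]

/-- The periodic extension of a function on `[0, T]` with equal boundary values. -/
lemma exists_periodic_extension (hT : 0 < T) (w : C(Icc 0 T, E))
    (hw : w (leftPt hT.le) = w (rightPt hT.le)) :
    ∃ u : ℝ → E, Continuous u ∧ Function.Periodic u T ∧ ∀ t : Icc 0 T, u t = w t := by
  have : Fact (0 < T) := ⟨hT⟩
  have hend : extendIcc hT.le w 0 = extendIcc hT.le w (0 + T) := by
    rw [zero_add, extendIcc_of_mem _ _ (left_mem_Icc.2 hT.le),
      extendIcc_of_mem _ _ (right_mem_Icc.2 hT.le)]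
    exact hw
  have hper : Function.Periodic
      (fun t : ℝ => AddCircle.liftIco T 0 (extendIcc hT.le w) (t : AddCircle T)) T := fun t => by
    simp
  refine ⟨_, (AddCircle.liftIco_continuous hend
    (continuous_extendIcc hT.le w).continuousOn).comp (AddCircle.continuous_mk' T), hper, ?_⟩
  have hIco : ∀ t ∈ Ico 0 T, AddCircle.liftIco T 0 (extendIcc hT.le w) (t : AddCircle T) =
      extendIcc hT.le w t := fun t ht => AddCircle.liftIco_coe_apply (by rwa [zero_add])
  intro t
  rcases t.2.2.eq_or_lt with h | h
  · have h0 := hper 0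
    simp only [zero_add] at h0
    have : t = rightPt hT.le := Subtype.ext h
    rw [Function.comp, h, this, ← hw]
    change AddCircle.liftIco T 0 (extendIcc hT.le w) (T : AddCircle T) = _
    rw [h0, hIco 0 (left_mem_Ico.2 hT), extendIcc_of_mem _ _ (left_mem_Icc.2 hT.le)]
    rfl
  · change AddCircle.liftIco T 0 (extendIcc hT.le w) ((t : ℝ) : AddCircle T) = _
    rw [hIco t ⟨t.2.1, h⟩, extendIcc_of_mem _ _ t.2]

/-- Periodic solutions for all times, for a time-periodic vector field satisfying the hypotheses of
`exists_periodic_arc`. -/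
theorem exists_periodic_solution_arc [FiniteDimensional ℝ E] (hT : 0 < T) {S : Set E}
    (hS : IsOpen S)
    {b f : ℝ × E × ℝ → E} (hb : ∀ t, ∀ z ∈ S, ∀ ε, ContDiffAt ℝ 1 b (t, z, ε))
    (hf : ∀ t, ∀ z ∈ S, ∀ ε, ContDiffAt ℝ 1 f (t, z, ε))
    (hper : ∀ t, ∀ z ∈ S, ∀ ε, f (t + T, z, ε) = f (t, z, ε))
    {M : ℝ → E →L[ℝ] E} (hfb : ∀ t z ε, f (t, z, ε) = M ε (b (t, z, ε)))
    {z₀ : E} (hz₀ : z₀ ∈ S) (hf0 : ∀ t, f (t, z₀, 0) = 0)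
    (hb0 : ∫ t in (0 : ℝ)..T, b (t, z₀, 0) = 0)
    {A : E →L[ℝ] E} (hA : ∀ c, A (A c) = 0)
    (hfA : ∀ t c, fderiv ℝ f (t, z₀, 0) (0, c, 0) = A c)
    (hinj : ∀ c : E, ∫ t in (0 : ℝ)..T, fderiv ℝ b (t, z₀, 0) (0, c + t • A c, 0) = 0 → c = 0) :
    ∃ ε₀ > 0, ∃ κ : ℝ → E, ContinuousOn κ (Ioo (-ε₀) ε₀) ∧ κ 0 = z₀ ∧
      ∀ ε ∈ Ioo (-ε₀) ε₀, ∃ u : ℝ → E, Function.Periodic u T ∧ u 0 = κ ε ∧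
        ∀ t, u t ∈ S ∧ HasDerivAt u (f (t, u t, ε)) t := by
  obtain ⟨ε₀, hε₀, w, hwc, hw0, hw⟩ :=
    exists_periodic_arc hT hS hb hf hfb hz₀ hf0 hb0 hA hfA hinj
  refine ⟨ε₀, hε₀, fun ε => w ε (leftPt hT.le), ?_, by simp [hw0], fun ε hε => ?_⟩
  · exact (continuous_eval_const (leftPt hT.le)).comp_continuousOn hwc
  obtain ⟨hm, hlr, hint⟩ := hw ε hε
  obtain ⟨u, huc, hup, huw⟩ := exists_periodic_extension hT (w ε) hlr
  have huS : ∀ t, u t ∈ S := fun t => by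
    obtain ⟨s, hs, hst⟩ := hup.exists_mem_Ico₀ hT t
    rw [hst, huw ⟨s, hs.1, hs.2.le⟩]
    exact hm _
  have hhc : Continuous fun s => f (s, u s, ε) := continuous_iff_continuousAt.2 fun s =>
    ContinuousAt.comp (f := fun s => (s, u s, ε)) (hf s (u s) (huS s) ε).continuousAt
      (Continuous.continuousAt (by fun_prop))
  have hhp : Function.Periodic (fun s => f (s, u s, ε)) T := fun s => by
    simp only [hup s]
    exact hper s (u s) (huS s) ε
  have hu0 : u 0 = w ε (leftPt hT.le) := huw (leftPt hT.le)
  have hloc : ∀ t ∈ Icc 0 T, u t = u 0 + ∫ s in (0 : ℝ)..t, f (s, u s, ε) := by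
    intro t ht
    rw [huw ⟨t, ht⟩, hu0, hint ⟨t, ht⟩]
    congr 1
    refine intervalIntegral.integral_congr fun s hs => ?_
    rw [uIcc_of_le ht.1] at hs
    have hs' : s ∈ Icc 0 T := ⟨hs.1, hs.2.trans ht.2⟩
    simp only [extendIcc_of_mem hT.le _ hs', huw ⟨s, hs'⟩]
  have hzero : ∫ s in (0 : ℝ)..T, f (s, u s, ε) = 0 := by
    have h1 := hloc T (right_mem_Icc.2 hT.le)
    have h2 := hup 0
    rw [zero_add] at h2
    rw [h2] at h1
    exact left_eq_add.1 h1
  have hvp : Function.Periodic (fun t => u 0 + ∫ s in (0 : ℝ)..t, f (s, u s, ε)) T := by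
    intro t
    simp only
    rw [← intervalIntegral.integral_add_adjacent_intervals (b := t) (hhc.intervalIntegrable _ _)
      (hhc.intervalIntegrable _ _), hhp.intervalIntegral_add_eq t 0, zero_add, hzero, add_zero]
  have hglob : u = fun t => u 0 + ∫ s in (0 : ℝ)..t, f (s, u s, ε) := by
    ext t
    obtain ⟨s, hs, hst⟩ := (hup.sub hvp).exists_mem_Ico₀ hT t
    have h1 := hloc s ⟨hs.1, hs.2.le⟩
    simp only [Pi.sub_apply] at hst
    rw [← h1, sub_self, sub_eq_zero] at hst
    exact hst
  refine ⟨u, hup, hu0, fun t => ⟨huS t, ?_⟩⟩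
  have hd := (hhc.integral_hasStrictDerivAt 0 t).hasDerivAt.const_add (u 0)
  exact hd.congr_of_eventuallyEq (Eventually.of_forall fun t => congrFun hglob t)

end

end KeplerWave

namespace KeplerWave

open Real Filter Topology

/-! ### Smoothness of the Delaunay representation -/

/-- Solutions of Kepler's equation depend smoothly on the eccentricity and the mean anomaly. -/
lemma contDiffAt_eccAnomaly {e l : ℝ} (h0 : 0 < e) (h1 : e < 1) :
    ContDiffAt ℝ (⊤ : ℕ∞) (fun p : ℝ × ℝ => eccAnomaly p.1 p.2) (e, l) := by
  set u := eccAnomaly e l with hu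
  let f : (ℝ × ℝ) × ℝ → ℝ := fun q => q.2 - q.1.1 * sin q.2 - q.1.2
  have hf : ContDiff ℝ (⊤ : ℕ∞) f := by fun_prop
  have hd : HasDerivAt (fun x : ℝ => f ((e, l), x)) (1 - e * cos u) u := by
    exact ((hasDerivAt_id u).sub ((hasDerivAt_sin u).const_mul e)).sub_const l
  have hne : (1 - e * cos u) ≠ 0 := by nlinarith [cos_le_one u]
  have hinv : (fderiv ℝ f ((e, l), u) ∘L .inr ℝ (ℝ × ℝ) ℝ).IsInvertible := by
    refine ⟨ContinuousLinearEquiv.unitsEquivAut ℝ (Units.mk0 _ hne), ?_⟩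
    ext
    have hc : HasFDerivAt f (fderiv ℝ f ((e, l), u)) ((e, l), u) :=
      (hf.differentiable (by simp)).differentiableAt.hasFDerivAt
    have hcurve : HasDerivAt (fun x : ℝ => (((e, l), x) : (ℝ × ℝ) × ℝ)) ((0, 0), 1) u :=
      (hasDerivAt_const u (e, l)).prodMk (hasDerivAt_id u)
    have := (hc.comp_hasDerivAt u hcurve).unique hd
    simp only [ContinuousLinearEquiv.coe_coe, ContinuousLinearEquiv.unitsEquivAut_apply,
      ContinuousLinearMap.comp_apply, ContinuousLinearMap.inr_apply, Units.val_mk0, one_mul]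
    rw [← this]; rfl
  have hcd : ContDiffAt ℝ (⊤ : ℕ∞) f ((e, l), u) := hf.contDiffAt
  have hψ := hcd.contDiffAt_implicitFunction (by simp) hinv
  refine hψ.congr_of_eventuallyEq ?_
  have hev := hcd.eventually_apply_implicitFunction (by simp) hinv
  have hfu : f ((e, l), u) = 0 := by
    simp only [f, hu]
    linarith [eccAnomaly_spec h0.le h1 l]
  have hmem : ∀ᶠ p : ℝ × ℝ in 𝓝 (e, l), 0 < p.1 ∧ p.1 < 1 :=
    continuous_fst.continuousAt.eventually (eventually_mem_unit h0 h1)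
  filter_upwards [hev, hmem] with p hp hp'
  rw [hfu] at hp
  refine eccAnomaly_eq hp'.1.le hp'.2 ?_
  simp only [f] at hp
  linarith

lemma isOpen_ellipses : IsOpen ellipses := by
  have : ellipses = {p : Delaunay | 0 < p.1} ∩ ({p | p.2.1 ≠ 0} ∩ {p | |p.2.1| < p.1}) := rfl
  rw [this]
  exact (isOpen_lt (by fun_prop) (by fun_prop)).inter
    ((isOpen_ne_fun (by fun_prop) (by fun_prop)).inter (isOpen_lt (by fun_prop) (by fun_prop)))

lemma one_sub_sq_div_pos {L G : ℝ} (hL : 0 < L) (hGL : |G| < L) : 0 < 1 - G ^ 2 / L ^ 2 := by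
  rw [sub_pos, div_lt_one (by positivity)]
  exact sq_lt_sq.2 (by rwa [abs_of_pos hL])

lemma eccentricity_mem {L G : ℝ} (hL : 0 < L) (hG : G ≠ 0) (hGL : |G| < L) :
    0 < eccentricity L G ∧ eccentricity L G < 1 := by
  refine ⟨sqrt_pos.2 (one_sub_sq_div_pos hL hGL), ?_⟩
  rw [eccentricity, sqrt_lt' one_pos]
  have : 0 < G ^ 2 / L ^ 2 := by positivity
  linarith

lemma contDiffAt_eccentricity {L G : ℝ} (hL : 0 < L) (hGL : |G| < L) :
    ContDiffAt ℝ (⊤ : ℕ∞) (fun p : ℝ × ℝ => eccentricity p.1 p.2) (L, G) := by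
  unfold eccentricity
  refine ContDiffAt.sqrt ?_ (one_sub_sq_div_pos hL hGL).ne'
  exact contDiffAt_const.sub (ContDiffAt.div (by fun_prop) (by fun_prop) (by positivity))

/-- The function `𝒞` on the phase space. -/
noncomputable def momentC (k : ℝ) (p : Delaunay) : ℝ := quadC k p.1 p.2.1 p.2.2.1 p.2.2.2

/-- The function `𝒮` on the phase space. -/
noncomputable def momentS (k : ℝ) (p : Delaunay) : ℝ := quadS k p.1 p.2.1 p.2.2.1 p.2.2.2

section

variable {p : Delaunay}

lemma contDiffAt_orb (hp : p ∈ ellipses) :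
    ContDiffAt ℝ (⊤ : ℕ∞) (fun p : Delaunay => orbX (eccentricity p.1 p.2.1) p.2.2.1) p ∧
    ContDiffAt ℝ (⊤ : ℕ∞) (fun p : Delaunay => orbY (eccentricity p.1 p.2.1) p.2.2.1) p := by
  obtain ⟨hL, hG, hGL⟩ := hp
  obtain ⟨h0, h1⟩ := eccentricity_mem hL hG hGL
  have he : ContDiffAt ℝ (⊤ : ℕ∞) (fun p : Delaunay => eccentricity p.1 p.2.1) p :=
    ContDiffAt.comp (f := fun p : Delaunay => (p.1, p.2.1)) p (contDiffAt_eccentricity hL hGL)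
      (by fun_prop)
  have hu : ContDiffAt ℝ (⊤ : ℕ∞)
      (fun p : Delaunay => eccAnomaly (eccentricity p.1 p.2.1) p.2.2.1) p :=
    ContDiffAt.comp (f := fun p : Delaunay => (eccentricity p.1 p.2.1, p.2.2.1)) p
      (contDiffAt_eccAnomaly h0 h1) (by fun_prop)
  have hs : ContDiffAt ℝ (⊤ : ℕ∞)
      (fun p : Delaunay => sqrt (1 - eccentricity p.1 p.2.1 ^ 2)) p :=
    ContDiffAt.sqrt (by fun_prop) (by nlinarith)
  unfold orbX orbY
  exact ⟨by fun_prop, by fun_prop⟩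

lemma contDiffAt_moments (k : ℝ) (hp : p ∈ ellipses) :
    ContDiffAt ℝ (⊤ : ℕ∞) (momentC k) p ∧ ContDiffAt ℝ (⊤ : ℕ∞) (momentS k) p := by
  obtain ⟨hX, hY⟩ := contDiffAt_orb hp
  have ha : ContDiffAt ℝ (⊤ : ℕ∞) (fun p : Delaunay => semimajor k p.1) p := by
    unfold semimajor; fun_prop
  have hx : ContDiffAt ℝ (⊤ : ℕ∞)
      (fun p : Delaunay => posX k p.1 p.2.1 p.2.2.1 p.2.2.2) p := by
    unfold posX; fun_prop
  have hy : ContDiffAt ℝ (⊤ : ℕ∞)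
      (fun p : Delaunay => posY k p.1 p.2.1 p.2.2.1 p.2.2.2) p := by
    unfold posY; fun_prop
  unfold momentC momentS quadC quadS
  exact ⟨by fun_prop, by fun_prop⟩

lemma moments_add_two_pi (k : ℝ) (hp : p ∈ ellipses) :
    momentC k (p + (0, 0, 2 * π, 0)) = momentC k p ∧
      momentS k (p + (0, 0, 2 * π, 0)) = momentS k p := by
  obtain ⟨hL, hG, hGL⟩ := hp
  obtain ⟨h0, h1⟩ := eccentricity_mem hL hG hGL
  simp [momentC, momentS, quadC, quadS, posX, posY, orbX_add_two_pi h0.le h1,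
    orbY_add_two_pi h0.le h1]

/-- The perturbing function `𝒞 φ + 𝒮 ψ`. -/
noncomputable def perturbation (P : Params) (δ t : ℝ) (p : Delaunay) : ℝ :=
  momentC P.k p * wavePhi P δ t + momentS P.k p * wavePsi P δ t

/-- The differential of the perturbing function at fixed time. -/
noncomputable def dPerturbation (P : Params) (δ t : ℝ) (p v : Delaunay) : ℝ :=
  fderiv ℝ (momentC P.k) p v * wavePhi P δ t + fderiv ℝ (momentS P.k) p v * wavePsi P δ t

lemma hasFDerivAt_moments (k : ℝ) (hp : p ∈ ellipses) :
    HasFDerivAt (momentC k) (fderiv ℝ (momentC k) p) p ∧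
      HasFDerivAt (momentS k) (fderiv ℝ (momentS k) p) p :=
  ⟨((contDiffAt_moments k hp).1.differentiableAt (by simp)).hasFDerivAt,
    ((contDiffAt_moments k hp).2.differentiableAt (by simp)).hasFDerivAt⟩

/-- The equations of motion are Hamilton's equations of the perturbing function. -/
lemma field_eq (P : Params) (δ ε t : ℝ) (hp : p ∈ ellipses) :
    field P δ ε t p =
      (-ε * dPerturbation P δ t p (0, 0, 1, 0), -ε * dPerturbation P δ t p (0, 0, 0, 1),
        keplerFreq P.k p.1 + ε * dPerturbation P δ t p (1, 0, 0, 0),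
        ε * dPerturbation P δ t p (0, 1, 0, 0)) := by
  obtain ⟨hC, hS⟩ := hasFDerivAt_moments P.k hp
  obtain ⟨L, G, l, g⟩ := p
  have c1 : HasDerivAt (fun x : ℝ => ((x, G, l, g) : Delaunay)) (1, 0, 0, 0) L :=
    (hasDerivAt_id L).prodMk (hasDerivAt_const L (G, l, g))
  have c2 : HasDerivAt (fun x : ℝ => ((L, x, l, g) : Delaunay)) (0, 1, 0, 0) G :=
    (hasDerivAt_const G L).prodMk ((hasDerivAt_id G).prodMk (hasDerivAt_const G (l, g)))
  have c3 : HasDerivAt (fun x : ℝ => ((L, G, x, g) : Delaunay)) (0, 0, 1, 0) l :=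
    (hasDerivAt_const l L).prodMk ((hasDerivAt_const l G).prodMk
      ((hasDerivAt_id l).prodMk (hasDerivAt_const l g)))
  have c4 : HasDerivAt (fun x : ℝ => ((L, G, l, x) : Delaunay)) (0, 0, 0, 1) g :=
    (hasDerivAt_const g L).prodMk ((hasDerivAt_const g G).prodMk
      ((hasDerivAt_const g l).prodMk (hasDerivAt_id g)))
  have d1 := (hC.comp_hasDerivAt L c1).deriv
  have d2 := (hS.comp_hasDerivAt L c1).deriv
  have d3 := (hC.comp_hasDerivAt G c2).deriv
  have d4 := (hS.comp_hasDerivAt G c2).deriv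
  have d5 := (hC.comp_hasDerivAt l c3).deriv
  have d6 := (hS.comp_hasDerivAt l c3).deriv
  have d7 := (hC.comp_hasDerivAt g c4).deriv
  have d8 := (hS.comp_hasDerivAt g c4).deriv
  simp only [dPerturbation, ← d1, ← d2, ← d3, ← d4, ← d5, ← d6, ← d7, ← d8]
  rfl

end

end KeplerWave

namespace KeplerWave

open Real Filter Topology Set

/-! ### The averaged perturbing function -/

section

variable {E : Type*} [NormedAddCommGroup E] [NormedSpace ℝ E]
  {F : Type*} [NormedAddCommGroup F] [NormedSpace ℝ F]

/-- Differentiation under the integral sign, through the superposition operator. -/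
lemma exists_hasFDerivAt_integral [CompleteSpace F] {T : ℝ} (hT : 0 ≤ T) {S : Set E} (hS : IsOpen S)
    {h : ℝ × E × ℝ → F} (hh : ∀ t, ∀ z ∈ S, ∀ ε, ContDiffAt ℝ 1 h (t, z, ε)) {z : E} (hz : z ∈ S) :
    ∃ D : E →L[ℝ] F, HasFDerivAt (fun z => ∫ t in (0 : ℝ)..T, h (t, z, 0)) D z ∧
      ∀ v, D v = ∫ t in (0 : ℝ)..T, fderiv ℝ h (t, z, 0) (0, v, 0) := by
  set S' : Set (ℝ × E × ℝ) := {p | p.2.1 ∈ S} with hS'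
  have hS'o : IsOpen S' := hS.preimage (by fun_prop)
  have hh' : ∀ p ∈ S', ContDiffAt ℝ 1 h p := fun p hp => hh p.1 p.2.1 hp p.2.2
  have hhc : ContinuousOn h S' := fun x hx => (hh' x hx).continuousAt.continuousWithinAt
  obtain ⟨g, hg⟩ := exists_fderiv_family (T := T) (f := h) (z₀ := z) (ε := 0)
    fun t => hh t z hz 0
  let ι : E →L[ℝ] C(Icc 0 T, E) × ℝ := (constCLM T E).prod 0
  have hs : HasStrictFDerivAt (superpose h) (pointwiseCLM g) (graphMap (ι z)) :=
    hasStrictFDerivAt_superpose hS'o hh' (fun k => hz) g hg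
  have hd := ((integralCLM hT).hasStrictFDerivAt.comp z
    ((hs.comp (ι z) (hasStrictFDerivAt_graphMap (ι z))).comp z ι.hasStrictFDerivAt)).hasFDerivAt
  refine ⟨_, hd.congr_of_eventuallyEq ?_, fun v => ?_⟩
  · filter_upwards [hS.mem_nhds hz] with y hy
    simp only [integralCLM_apply]
    refine intervalIntegral.integral_congr fun s hs => ?_
    rw [uIcc_of_le hT] at hs
    simp only [extendIcc_of_mem hT _ hs]
    exact (superpose_apply hhc (u := graphMap (ι y)) (fun k => hy) ⟨s, hs⟩).symm
  · simp only [ContinuousLinearMap.comp_apply, integralCLM_apply]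
    refine intervalIntegral.integral_congr fun s hs => ?_
    rw [uIcc_of_le hT] at hs
    simp only [extendIcc_of_mem hT _ hs, pointwiseCLM_apply, hg]
    rfl

lemma intervalIntegral_prodMk [CompleteSpace E] [CompleteSpace F] {a : ℝ → E} {b : ℝ → F}
    (ha : Continuous a) (hb : Continuous b) (T : ℝ) :
    ∫ t in (0 : ℝ)..T, (a t, b t) = (∫ t in (0 : ℝ)..T, a t, ∫ t in (0 : ℝ)..T, b t) := by
  have hi := (ha.prodMk hb).intervalIntegrable (μ := MeasureTheory.volume) 0 T
  refine Prod.ext ?_ ?_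
  · exact ((ContinuousLinearMap.fst ℝ E F).intervalIntegral_comp_comm hi).symm
  · exact ((ContinuousLinearMap.snd ℝ E F).intervalIntegral_comp_comm hi).symm

/-- The partial differential with respect to the middle variable as a derivative along a line. -/
lemma hasDerivAt_line {h : ℝ × E × ℝ → F} {t : ℝ} {z : E} {ε : ℝ}
    (hh : ContDiffAt ℝ 1 h (t, z, ε)) (v : E) :
    HasDerivAt (fun s : ℝ => h (t, z + s • v, ε)) (fderiv ℝ h (t, z, ε) (0, v, 0)) 0 := by
  have hline : HasDerivAt (fun s : ℝ => z + s • v) v 0 := by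
    simpa using ((hasDerivAt_id (0 : ℝ)).smul_const v).const_add z
  have hcurve : HasDerivAt (fun s : ℝ => ((t, z + s • v, ε) : ℝ × E × ℝ)) (0, v, 0) 0 :=
    (hasDerivAt_const _ _).prodMk (hline.prodMk (hasDerivAt_const _ _))
  exact HasFDerivAt.comp_hasDerivAt_of_eq (0 : ℝ) (hh.differentiableAt one_ne_zero).hasFDerivAt
    hcurve (by simp)

lemma hasDerivAt_prod_fst {f : ℝ → E × F} {f' : E × F} {x : ℝ} (h : HasDerivAt f f' x) :
    HasDerivAt (fun t => (f t).1) f'.1 x :=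
  (ContinuousLinearMap.fst ℝ E F).hasFDerivAt.comp_hasDerivAt x h

lemma hasDerivAt_prod_snd {f : ℝ → E × F} {f' : E × F} {x : ℝ} (h : HasDerivAt f f' x) :
    HasDerivAt (fun t => (f t).2) f'.2 x :=
  (ContinuousLinearMap.snd ℝ E F).hasFDerivAt.comp_hasDerivAt x h

end

/-- The forward drift of the mean anomaly on the `(m : 1)` resonance. -/
noncomputable def drift (P : Params) (m : ℕ) (t : ℝ) : Delaunay := (0, 0, P.Ω / m * t, 0)

/-- The period `2πm/Ω`. -/
noncomputable def resPeriod (P : Params) (m : ℕ) : ℝ := 2 * π * m / P.Ω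

/-- The perturbing function integrated along the unperturbed resonant motion over one period. -/
noncomputable def averaged (P : Params) (δ : ℝ) (m : ℕ) (z : Delaunay) : ℝ :=
  ∫ t in (0 : ℝ)..resPeriod P m, perturbation P δ t (z + drift P m t)

section

variable {P : Params} {δ : ℝ} {m : ℕ}

lemma add_drift_mem {z : Delaunay} (hz : z ∈ ellipses) (t : ℝ) : z + drift P m t ∈ ellipses := by
  obtain ⟨h1, h2, h3⟩ := hz
  refine ⟨?_, ?_, ?_⟩ <;> simpa [drift]

lemma contDiff_wave (P : Params) (δ : ℝ) :
    ContDiff ℝ 1 (wavePhi P δ) ∧ ContDiff ℝ 1 (wavePsi P δ) := by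
  unfold wavePhi wavePsi
  exact ⟨by fun_prop, by fun_prop⟩

lemma contDiff_add_drift :
    ContDiff ℝ 1 (fun q : ℝ × Delaunay × ℝ => q.2.1 + drift P m q.1) := by
  unfold drift
  fun_prop

lemma contDiffAt_perturbation {t : ℝ} {z : Delaunay} (hz : z ∈ ellipses) (ε : ℝ) :
    ContDiffAt ℝ 1 (fun q : ℝ × Delaunay × ℝ => perturbation P δ q.1 (q.2.1 + drift P m q.1))
      (t, z, ε) := by
  obtain ⟨hC, hS⟩ := contDiffAt_moments P.k (add_drift_mem (P := P) (m := m) hz t)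
  obtain ⟨hφ, hψ⟩ := contDiff_wave P δ
  have hC' := ContDiffAt.comp (t, z, ε) (hC.of_le (by exact_mod_cast le_top))
    (contDiff_add_drift (P := P) (m := m)).contDiffAt
  have hS' := ContDiffAt.comp (t, z, ε) (hS.of_le (by exact_mod_cast le_top))
    (contDiff_add_drift (P := P) (m := m)).contDiffAt
  exact (hC'.mul (hφ.comp contDiff_fst).contDiffAt).add
    (hS'.mul (hψ.comp contDiff_fst).contDiffAt)

lemma contDiffAt_dPerturbation {t : ℝ} {z : Delaunay} (hz : z ∈ ellipses) (ε : ℝ) (v : Delaunay) :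
    ContDiffAt ℝ 1 (fun q : ℝ × Delaunay × ℝ => dPerturbation P δ q.1 (q.2.1 + drift P m q.1) v)
      (t, z, ε) := by
  obtain ⟨hC, hS⟩ := contDiffAt_moments P.k (add_drift_mem (P := P) (m := m) hz t)
  obtain ⟨hφ, hψ⟩ := contDiff_wave P δ
  have hC' := ContDiffAt.comp (t, z, ε) (hC.fderiv_right (m := 1) (by norm_cast))
    (contDiff_add_drift (P := P) (m := m)).contDiffAt
  have hS' := ContDiffAt.comp (t, z, ε) (hS.fderiv_right (m := 1) (by norm_cast))
    (contDiff_add_drift (P := P) (m := m)).contDiffAt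
  exact ((hC'.clm_apply contDiffAt_const).mul (hφ.comp contDiff_fst).contDiffAt).add
    ((hS'.clm_apply contDiffAt_const).mul (hψ.comp contDiff_fst).contDiffAt)

lemma keplerFreq_eq {k L : ℝ} (hk : 0 < k) (hL : 0 < L) : keplerFreq k L = k ^ 2 / L ^ 3 := by
  rw [keplerFreq, semimajor, show k / (L ^ 2 / k) ^ 3 = (k ^ 2 / L ^ 3) ^ 2 by field_simp]
  exact sqrt_sq (by positivity)

lemma hasDerivAt_keplerFreq {k L : ℝ} (hk : 0 < k) (hL : 0 < L) :
    HasDerivAt (keplerFreq k) (-3 * k ^ 2 / L ^ 4) L := by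
  have h := ((hasDerivAt_id L).pow 3).inv (pow_pos hL 3).ne' |>.const_mul (k ^ 2)
  refine (h.congr_deriv ?_).congr_of_eventuallyEq ?_
  · simp only [id, Pi.pow_apply]; field_simp; norm_num; ring
  · filter_upwards [lt_mem_nhds hL] with x hx
    simp [keplerFreq_eq hk hx, div_eq_mul_inv]

lemma contDiffAt_keplerFreq {k L : ℝ} (hk : 0 < k) (hL : 0 < L) :
    ContDiffAt ℝ 1 (keplerFreq k) L := by
  have h : ContDiffAt ℝ 1 (fun x : ℝ => k ^ 2 / x ^ 3) L :=
    ContDiffAt.div (by fun_prop) (by fun_prop) (by positivity)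
  refine h.congr_of_eventuallyEq ?_
  filter_upwards [lt_mem_nhds hL] with x hx
  exact keplerFreq_eq hk hx

/-- The differential of the averaged function is the average of the differential. -/
lemma exists_hasFDerivAt_averaged (hT : 0 ≤ resPeriod P m) {z : Delaunay} (hz : z ∈ ellipses) :
    ∃ D : Delaunay →L[ℝ] ℝ, HasFDerivAt (averaged P δ m) D z ∧
      ∀ v, D v = ∫ t in (0 : ℝ)..resPeriod P m, dPerturbation P δ t (z + drift P m t) v := by
  obtain ⟨D, hD, hDv⟩ := exists_hasFDerivAt_integral hT isOpen_ellipses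
    (fun t z hz ε => contDiffAt_perturbation (P := P) (δ := δ) (m := m) (t := t) hz ε) hz
  refine ⟨D, hD, fun v => ?_⟩
  rw [hDv]
  congr 1
  ext t
  have h2 := hasDerivAt_line (contDiffAt_perturbation (P := P) (δ := δ) (m := m) (t := t) hz 0) v
  have hline : HasDerivAt (fun s : ℝ => z + s • v) v 0 := by
    simpa using ((hasDerivAt_id (0 : ℝ)).smul_const v).const_add z
  obtain ⟨hC, hS⟩ := hasFDerivAt_moments P.k (add_drift_mem (P := P) (m := m) hz t)
  have hline' := hline.add_const (drift P m t)
  have h3 := ((HasFDerivAt.comp_hasDerivAt_of_eq (0 : ℝ) hC hline' (by simp)).mul_const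
    (wavePhi P δ t)).add
    ((HasFDerivAt.comp_hasDerivAt_of_eq (0 : ℝ) hS hline' (by simp)).mul_const (wavePsi P δ t))
  exact h2.unique h3

/-- The right-hand side in slow variables after division of the first, second and fourth component
by the small parameter. -/
noncomputable def slowField (P : Params) (δ : ℝ) (m : ℕ) (q : ℝ × Delaunay × ℝ) : Delaunay :=
  (-dPerturbation P δ q.1 (q.2.1 + drift P m q.1) (0, 0, 1, 0),
    -dPerturbation P δ q.1 (q.2.1 + drift P m q.1) (0, 0, 0, 1),
    keplerFreq P.k q.2.1.1 - P.Ω / m +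
      q.2.2 * dPerturbation P δ q.1 (q.2.1 + drift P m q.1) (1, 0, 0, 0),
    dPerturbation P δ q.1 (q.2.1 + drift P m q.1) (0, 1, 0, 0))

/-- Multiplication of the first, second and fourth component by the small parameter. -/
noncomputable def slowScale (ε : ℝ) : Delaunay →L[ℝ] Delaunay :=
  (ε • ContinuousLinearMap.fst ℝ ℝ (ℝ × ℝ × ℝ)).prod
    ((ε • (ContinuousLinearMap.fst ℝ ℝ (ℝ × ℝ))).prod
      ((ContinuousLinearMap.fst ℝ ℝ ℝ).prod (ε • ContinuousLinearMap.snd ℝ ℝ ℝ) ∘L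
        ContinuousLinearMap.snd ℝ ℝ (ℝ × ℝ)) ∘L ContinuousLinearMap.snd ℝ ℝ (ℝ × ℝ × ℝ))

lemma slowScale_apply (ε : ℝ) (v : Delaunay) :
    slowScale ε v = (ε * v.1, ε * v.2.1, v.2.2.1, ε * v.2.2.2) := rfl

lemma contDiffAt_slowField (hk : 0 < P.k) {t : ℝ} {z : Delaunay} (hz : z ∈ ellipses) (ε : ℝ) :
    ContDiffAt ℝ 1 (slowField P δ m) (t, z, ε) := by
  have hd := fun v => contDiffAt_dPerturbation (P := P) (δ := δ) (m := m) (t := t) hz ε v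
  have hω : ContDiffAt ℝ 1 (fun q : ℝ × Delaunay × ℝ => keplerFreq P.k q.2.1.1) (t, z, ε) :=
    ContDiffAt.comp (f := fun q : ℝ × Delaunay × ℝ => q.2.1.1) (t, z, ε)
      (contDiffAt_keplerFreq hk hz.1) (by fun_prop)
  exact (hd _).neg.prodMk ((hd _).neg.prodMk
    (((hω.sub contDiffAt_const).add (ContDiffAt.mul (by fun_prop) (hd _))).prodMk (hd _)))

lemma wave_add_period (hΩ : 0 < P.Ω) (t : ℝ) :
    wavePhi P δ (t + resPeriod P m) = wavePhi P δ t ∧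
      wavePsi P δ (t + resPeriod P m) = wavePsi P δ t := by
  have h1 : P.Ω * (t + resPeriod P m) = P.Ω * t + (m : ℕ) * (2 * π) := by
    rw [resPeriod]; field_simp
  have h2 : 2 * P.Ω * (t + resPeriod P m) = 2 * P.Ω * t + (2 * m : ℕ) * (2 * π) := by
    rw [resPeriod]; push_cast; field_simp
  have h3 : 3 * P.Ω * (t + resPeriod P m) = 3 * P.Ω * t + (3 * m : ℕ) * (2 * π) := by
    rw [resPeriod]; push_cast; field_simp
  simp only [wavePhi, wavePsi, h1, h2, h3, cos_add_nat_mul_two_pi, sin_add_nat_mul_two_pi, and_self]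

lemma drift_add_period (hΩ : 0 < P.Ω) (hm : m ≠ 0) (t : ℝ) :
    drift P m (t + resPeriod P m) = drift P m t + (0, 0, 2 * π, 0) := by
  have hm' : (m : ℝ) ≠ 0 := Nat.cast_ne_zero.2 hm
  have : P.Ω / m * (t + 2 * π * m / P.Ω) = P.Ω / m * t + 2 * π := by field_simp
  simp [drift, resPeriod, this]

lemma fderiv_moments_add_two_pi (k : ℝ) {p : Delaunay} (hp : p ∈ ellipses) :
    fderiv ℝ (momentC k) (p + (0, 0, 2 * π, 0)) = fderiv ℝ (momentC k) p ∧
      fderiv ℝ (momentS k) (p + (0, 0, 2 * π, 0)) = fderiv ℝ (momentS k) p := by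
  constructor
  · rw [← fderiv_comp_add_right]
    refine Filter.EventuallyEq.fderiv_eq ?_
    filter_upwards [isOpen_ellipses.mem_nhds hp] with q hq using (moments_add_two_pi k hq).1
  · rw [← fderiv_comp_add_right]
    refine Filter.EventuallyEq.fderiv_eq ?_
    filter_upwards [isOpen_ellipses.mem_nhds hp] with q hq using (moments_add_two_pi k hq).2

lemma slowField_add_period (hΩ : 0 < P.Ω) (hm : m ≠ 0) (t : ℝ) {z : Delaunay} (hz : z ∈ ellipses)
    (ε : ℝ) : slowField P δ m (t + resPeriod P m, z, ε) = slowField P δ m (t, z, ε) := by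
  have hd : ∀ v, dPerturbation P δ (t + resPeriod P m) (z + drift P m (t + resPeriod P m)) v =
      dPerturbation P δ t (z + drift P m t) v := by
    intro v
    obtain ⟨h1, h2⟩ := wave_add_period (P := P) (δ := δ) (m := m) hΩ t
    obtain ⟨h3, h4⟩ := fderiv_moments_add_two_pi P.k (add_drift_mem (P := P) (m := m) hz t)
    rw [drift_add_period hΩ hm, ← add_assoc, dPerturbation, dPerturbation, h1, h2, h3, h4]
  simp only [slowField, hd]

/-- A nondegenerate critical point, with respect to `(G, ℓ, g)`, of the averaged perturbing function
on the resonant manifold is continuable. The averaged function is described there by `w`, and `γ`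
is its gradient. -/
theorem continuable_of_nondegenerate (hk : 0 < P.k) (hΩ : 0 < P.Ω) (hm : m ≠ 0)
    {L : ℝ} {y₀ : ℝ × ℝ × ℝ} (hz₀ : ((L, y₀) : Delaunay) ∈ ellipses)
    (hres : L ^ 3 = m * P.k ^ 2 / P.Ω)
    {w : ℝ × ℝ × ℝ → ℝ} {γ : ℝ × ℝ × ℝ → ℝ × ℝ × ℝ}
    (hw : ∀ y, ((L, y) : Delaunay) ∈ ellipses → averaged P δ m (L, y) = w y)
    (hγ : ∀ y, ((L, y) : Delaunay) ∈ ellipses →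
      HasDerivAt (fun x => w (x, y.2.1, y.2.2)) (γ y).1 y.1 ∧
      HasDerivAt (fun x => w (y.1, x, y.2.2)) (γ y).2.1 y.2.1 ∧
      HasDerivAt (fun x => w (y.1, y.2.1, x)) (γ y).2.2 y.2.2)
    (hγ0 : γ y₀ = 0) {γ' : ℝ × ℝ × ℝ →L[ℝ] ℝ × ℝ × ℝ} (hγ' : HasFDerivAt γ γ' y₀)
    (hinj : ∀ c, γ' c = 0 → c = 0) :
    Continuable P δ m (L, y₀) := by
  have hm' : (0 : ℝ) < m := Nat.cast_pos.2 (Nat.pos_of_ne_zero hm)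
  have hT : 0 < resPeriod P m := by rw [resPeriod]; positivity
  have hL : 0 < L := hz₀.1
  have hω : keplerFreq P.k L = P.Ω / m := by
    rw [keplerFreq_eq hk hL, hres]; field_simp
  set ν := -3 * P.k ^ 2 / L ^ 4 with hν
  have hν0 : ν ≠ 0 := by
    rw [hν]; exact div_ne_zero (by nlinarith [pow_pos hk 2]) (by positivity)
  -- the partial derivatives of the averaged function
  have hgrad : ∀ y, ((L, y) : Delaunay) ∈ ellipses → 
      (∫ t in (0 : ℝ)..resPeriod P m, dPerturbation P δ t ((L, y) + drift P m t) (0, 1, 0, 0)) =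
        (γ y).1 ∧
      (∫ t in (0 : ℝ)..resPeriod P m, dPerturbation P δ t ((L, y) + drift P m t) (0, 0, 1, 0)) =
        (γ y).2.1 ∧
      (∫ t in (0 : ℝ)..resPeriod P m, dPerturbation P δ t ((L, y) + drift P m t) (0, 0, 0, 1)) =
        (γ y).2.2 := by
    intro y hy
    obtain ⟨D, hD, hDv⟩ := exists_hasFDerivAt_averaged (P := P) (δ := δ) (m := m) hT.le hy
    obtain ⟨h1, h2, h3⟩ := hγ y hy
    rw [← hDv, ← hDv, ← hDv]
    have key : ∀ {σ : ℝ → ℝ × ℝ × ℝ} {x : ℝ} {v : ℝ × ℝ × ℝ} {d : ℝ}, σ x = y →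
        HasDerivAt σ v x → HasDerivAt (fun s => w (σ s)) d x → D (0, v) = d := by
      intro σ x v d hx hσ hd
      have hc : HasDerivAt (fun s => ((L, σ s) : Delaunay)) (0, v) x :=
        (hasDerivAt_const _ _).prodMk hσ
      have ha := HasFDerivAt.comp_hasDerivAt_of_eq x hD hc (by rw [hx])
      refine ha.unique (hd.congr_of_eventuallyEq ?_)
      have hmem : ∀ᶠ s in 𝓝 x, ((L, σ s) : Delaunay) ∈ ellipses :=
        hc.continuousAt.eventually (isOpen_ellipses.mem_nhds
          (show ((L, σ x) : Delaunay) ∈ ellipses by rw [hx]; exact hy))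
      filter_upwards [hmem] with s hs using hw _ hs
    obtain ⟨G, l, g⟩ := y
    exact ⟨key (σ := fun x => (x, l, g)) rfl
        ((hasDerivAt_id G).prodMk (hasDerivAt_const G (l, g))) h1,
      key (σ := fun x => (G, x, g)) rfl ((hasDerivAt_const l G).prodMk
        ((hasDerivAt_id l).prodMk (hasDerivAt_const l g))) h2,
      key (σ := fun x => (G, l, x)) rfl ((hasDerivAt_const g G).prodMk
        ((hasDerivAt_const g l).prodMk (hasDerivAt_id g))) h3⟩
  have hcd := fun t (z : Delaunay) (hz : z ∈ ellipses) ε =>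
    contDiffAt_slowField (δ := δ) (m := m) hk (t := t) hz ε
  have hdcont : ∀ y, ((L, y) : Delaunay) ∈ ellipses → ∀ v, Continuous fun t =>
      dPerturbation P δ t ((L, y) + drift P m t) v := by
    intro y hy v
    refine continuous_iff_continuousAt.2 fun t => ?_
    exact ContinuousAt.comp (f := fun t => ((t, (L, y), 0) : ℝ × Delaunay × ℝ))
      (contDiffAt_dPerturbation (P := P) (δ := δ) (m := m) hy 0 v).continuousAt
      (Continuous.continuousAt (by fun_prop))
  -- the averaged right-hand side
  have hB : ∀ y, ((L, y) : Delaunay) ∈ ellipses →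
      ∫ t in (0 : ℝ)..resPeriod P m, slowField P δ m (t, (L, y), 0) =
        (-(γ y).2.1, -(γ y).2.2, 0, (γ y).1) := by
    intro y hy
    obtain ⟨h1, h2, h3⟩ := hgrad y hy
    have e : ∀ t, slowField P δ m (t, (L, y), 0) =
        (-dPerturbation P δ t ((L, y) + drift P m t) (0, 0, 1, 0),
        -dPerturbation P δ t ((L, y) + drift P m t) (0, 0, 0, 1), 0,
        dPerturbation P δ t ((L, y) + drift P m t) (0, 1, 0, 0)) := fun t => by
      simp [slowField, hω]
    simp only [e]
    have hc1 : Continuous fun t => -dPerturbation P δ t ((L, y) + drift P m t) (0, 0, 1, 0) :=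
      (hdcont y hy (0, 0, 1, 0)).neg
    have hc2 : Continuous fun t => -dPerturbation P δ t ((L, y) + drift P m t) (0, 0, 0, 1) :=
      (hdcont y hy (0, 0, 0, 1)).neg
    have hc3 : Continuous fun t => dPerturbation P δ t ((L, y) + drift P m t) (0, 1, 0, 0) :=
      hdcont y hy (0, 1, 0, 0)
    have hc0 : Continuous fun _ : ℝ => (0 : ℝ) := continuous_const
    rw [intervalIntegral_prodMk (E := ℝ) (F := ℝ × ℝ × ℝ) hc1 (hc2.prodMk (hc0.prodMk hc3)),
      intervalIntegral_prodMk (E := ℝ) (F := ℝ × ℝ) hc2 (hc0.prodMk hc3),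
      intervalIntegral_prodMk (E := ℝ) (F := ℝ) hc0 hc3, intervalIntegral.integral_neg,
      intervalIntegral.integral_neg, h1, h2, h3, intervalIntegral.integral_zero]
  set f : ℝ × Delaunay × ℝ → Delaunay := fun q => slowScale q.2.2 (slowField P δ m q) with hf
  have hfcd : ∀ t, ∀ z ∈ ellipses, ∀ ε, ContDiffAt ℝ 1 f (t, z, ε) := by
    intro t z hz ε
    have h := hcd t z hz ε
    have hε : ContDiffAt ℝ 1 (fun q : ℝ × Delaunay × ℝ => q.2.2) (t, z, ε) := by fun_prop
    exact (hε.mul h.fst).prodMk ((hε.mul h.snd.fst).prodMk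
      (h.snd.snd.fst.prodMk (hε.mul h.snd.snd.snd)))
  -- the linearization of the unperturbed equations
  set A : Delaunay →L[ℝ] Delaunay := (0 : Delaunay →L[ℝ] ℝ).prod ((0 : Delaunay →L[ℝ] ℝ).prod
    ((ν • ContinuousLinearMap.fst ℝ ℝ (ℝ × ℝ × ℝ)).prod (0 : Delaunay →L[ℝ] ℝ))) with hAdef
  have hAapp : ∀ c : Delaunay, A c = (0, 0, ν * c.1, 0) := fun c => rfl
  have hKline : ∀ c : Delaunay, HasDerivAt
      (fun s : ℝ => keplerFreq P.k (L + s * c.1) - P.Ω / m) (ν * c.1) 0 := by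
    intro c
    have h1 : HasDerivAt (fun s : ℝ => L + s * c.1) c.1 0 := by
      simpa using ((hasDerivAt_id (0 : ℝ)).mul_const c.1).const_add L
    exact (HasDerivAt.comp_of_eq (0 : ℝ) (hasDerivAt_keplerFreq hk hL) h1 (by simp)).sub_const _
  have hfA : ∀ t c, fderiv ℝ f (t, (L, y₀), 0) (0, c, 0) = A c := by
    intro t c
    have h1 := hasDerivAt_line (hfcd t _ hz₀ 0) c
    have h2 : HasDerivAt (fun s : ℝ => ((0, 0, keplerFreq P.k (L + s * c.1) - P.Ω / m, 0) :
        Delaunay)) (0, 0, ν * c.1, 0) 0 :=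
      (hasDerivAt_const _ _).prodMk ((hasDerivAt_const _ _).prodMk
        ((hKline c).prodMk (hasDerivAt_const _ _)))
    rw [hAapp]
    refine h1.unique (h2.congr_of_eventuallyEq (Eventually.of_forall fun s => ?_))
    simp [hf, slowScale_apply, slowField]
  have hthird : ∀ t c, (fderiv ℝ (slowField P δ m) (t, (L, y₀), 0) (0, c, 0)).2.2.1 = ν * c.1 := by
    intro t c
    have h1 := hasDerivAt_prod_fst (hasDerivAt_prod_snd (hasDerivAt_prod_snd
      (hasDerivAt_line (hcd t _ hz₀ 0) c)))
    refine h1.unique ((hKline c).congr_of_eventuallyEq (Eventually.of_forall fun s => ?_))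
    simp [slowField]
  have hinj' : ∀ c : Delaunay, ∫ t in (0 : ℝ)..resPeriod P m,
      fderiv ℝ (slowField P δ m) (t, (L, y₀), 0) (0, c + t • A c, 0) = 0 → c = 0 := by
    intro c hc
    have hcont : Continuous fun t : ℝ =>
        fderiv ℝ (slowField P δ m) (t, (L, y₀), 0) (0, c + t • A c, 0) := by
      have h1 : Continuous fun t : ℝ => fderiv ℝ (slowField P δ m) (t, (L, y₀), 0) :=
        continuous_iff_continuousAt.2 fun t =>
          ContinuousAt.comp (f := fun t : ℝ => ((t, (L, y₀), 0) : ℝ × Delaunay × ℝ))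
            ((hcd t _ hz₀ 0).fderiv_right (m := 0) le_rfl).continuousAt
            (Continuous.continuousAt (by fun_prop))
      exact h1.clm_apply (by fun_prop)
    have hc1 : c.1 = 0 := by
      let π₃ : Delaunay →L[ℝ] ℝ := (ContinuousLinearMap.fst ℝ ℝ ℝ) ∘L
        (ContinuousLinearMap.snd ℝ ℝ (ℝ × ℝ)) ∘L (ContinuousLinearMap.snd ℝ ℝ (ℝ × ℝ × ℝ))
      have h1 := π₃.intervalIntegral_comp_comm
        (hcont.intervalIntegrable (μ := MeasureTheory.volume) 0 (resPeriod P m))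
      rw [hc, map_zero] at h1
      have h2 : ∀ t : ℝ, π₃ (fderiv ℝ (slowField P δ m) (t, (L, y₀), 0) (0, c + t • A c, 0)) =
          ν * c.1 := fun t => by
        refine (hthird t _).trans ?_
        simp [hAapp]
      simp only [h2, intervalIntegral.integral_const, smul_eq_mul, sub_zero] at h1
      exact (mul_eq_zero.1 ((mul_eq_zero.1 h1).resolve_left hT.ne')).resolve_left hν0
    obtain ⟨c₁, c'⟩ := c
    simp only at hc1
    subst hc1
    have hA0 : A (0, c') = 0 := by rw [hAapp, mul_zero]; rfl
    simp only [hA0, smul_zero, add_zero] at hc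
    obtain ⟨D, hD, hDv⟩ := exists_hasFDerivAt_integral hT.le isOpen_ellipses hcd hz₀
    rw [← hDv] at hc
    have hline : HasDerivAt (fun s : ℝ => y₀ + s • c') c' 0 := by
      simpa using ((hasDerivAt_id (0 : ℝ)).smul_const c').const_add y₀
    have hcurve : HasDerivAt (fun s : ℝ => ((L, y₀ + s • c') : Delaunay)) (0, c') 0 :=
      (hasDerivAt_const _ _).prodMk hline
    have h1 := HasFDerivAt.comp_hasDerivAt_of_eq (0 : ℝ) hD hcurve (by simp)
    have h2 := HasFDerivAt.comp_hasDerivAt_of_eq (0 : ℝ) hγ' hline (by simp)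
    have h3 : HasDerivAt (fun s : ℝ => ((-(γ (y₀ + s • c')).2.1, -(γ (y₀ + s • c')).2.2, 0,
        (γ (y₀ + s • c')).1) : Delaunay)) (-(γ' c').2.1, -(γ' c').2.2, 0, (γ' c').1) 0 :=
      (hasDerivAt_prod_fst (hasDerivAt_prod_snd h2)).neg.prodMk
        ((hasDerivAt_prod_snd (hasDerivAt_prod_snd h2)).neg.prodMk
          ((hasDerivAt_const _ _).prodMk (hasDerivAt_prod_fst h2)))
    have hmem : ∀ᶠ s in 𝓝 (0 : ℝ), ((L, y₀ + s • c') : Delaunay) ∈ ellipses :=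
      hcurve.continuousAt.eventually (isOpen_ellipses.mem_nhds (by simpa using hz₀))
    have h4 := h1.unique (h3.congr_of_eventuallyEq (by
      filter_upwards [hmem] with s hs using hB _ hs))
    rw [hc] at h4
    have h5 : γ' c' = 0 := by
      simp only [Prod.ext_iff, Prod.fst_zero, Prod.snd_zero] at h4 ⊢
      exact ⟨h4.2.2.2.symm, by linarith [h4.1], by linarith [h4.2.1]⟩
    rw [hinj c' h5]; rfl
  obtain ⟨ε₀, hε₀, κ, hκ, hκ0, hu⟩ := exists_periodic_solution_arc hT isOpen_ellipses hcd hfcd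
    (fun t z hz ε => by simp only [hf, slowField_add_period hΩ hm t hz ε]) (M := slowScale)
    (fun t z ε => rfl) hz₀ (fun t => by simp [hf, slowScale_apply, slowField, hω])
    (by rw [hB y₀ hz₀, hγ0]; simp) (fun c => by simp [hAapp]) hfA hinj'
  refine ⟨ε₀, hε₀, κ, hκ, hκ0, fun ε hε => ?_⟩
  obtain ⟨u, hup, hu0, hu⟩ := hu ε hε
  refine ⟨fun t => u t + drift P m t, fun t => ⟨add_drift_mem (hu t).1 t, ?_⟩, ?_, fun t => ?_⟩
  · have h1 : HasDerivAt (drift P m) (0, 0, P.Ω / m, 0) t :=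
      (hasDerivAt_const _ _).prodMk ((hasDerivAt_const _ _).prodMk
        (((hasDerivAt_id t).const_mul _ |>.congr_deriv (mul_one _)).prodMk (hasDerivAt_const _ _)))
    refine ((hu t).2.add h1).congr_deriv ?_
    rw [field_eq P δ ε t (add_drift_mem (hu t).1 t)]
    simp only [hf, slowScale_apply, slowField, drift, Prod.mk_add_mk, Prod.fst_add, add_zero]
    ext <;> simp; ring
  · simp only [hu0]
    simp [drift]
  · have h1 : t + 2 * π * m / P.Ω = t + resPeriod P m := rfl
    simp only [h1, hup t, drift_add_period hΩ hm]
    refine ⟨by simp, by simp, ?_, by simp⟩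
    simp only [Prod.snd_add, Prod.fst_add]
    rw [← add_assoc]
    simp

end

/-! ### The resonant harmonics -/

/-- One harmonic of the perturbing function along the unperturbed motion. -/
noncomputable def harmonic (e l g : ℝ) (n : ℕ) (τ : ℝ) : ℝ :=
  (orbX e (l + τ) ^ 2 - orbY e (l + τ) ^ 2) * cos (2 * g - n * τ) -
    2 * orbX e (l + τ) * orbY e (l + τ) * sin (2 * g - n * τ)

section

variable {P : Params} {δ : ℝ} {m : ℕ}

lemma perturbation_eq_harmonics (P : Params) (δ : ℝ) (hm : m ≠ 0) (L G l g t : ℝ) :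
    perturbation P δ t ((L, G, l, g) + drift P m t) =
      (fun τ => semimajor P.k L ^ 2 * P.Ω ^ 2 * (harmonic (eccentricity L G) l g (2 * m) τ +
        δ / 2 * ((P.α - P.β) * harmonic (eccentricity L G) l g m τ +
          (P.α + P.β) * harmonic (eccentricity L G) l g (3 * m) τ))) (P.Ω / m * t) := by
  have hm' : (m : ℝ) ≠ 0 := Nat.cast_ne_zero.2 hm
  have hmode : ∀ X Y A : ℝ,
      ((X * cos g - Y * sin g) ^ 2 - (X * sin g + Y * cos g) ^ 2) * cos A +
        2 * (X * cos g - Y * sin g) * (X * sin g + Y * cos g) * sin A =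
      (X ^ 2 - Y ^ 2) * cos (2 * g - A) - 2 * X * Y * sin (2 * g - A) := by
    intro X Y A
    rw [cos_sub, sin_sub, cos_two_mul, sin_two_mul]
    have := sin_sq_add_cos_sq g
    linear_combination (-(X ^ 2 - Y ^ 2) * cos A - 2 * X * Y * sin A) * this
  have h2 : ((2 * m : ℕ) : ℝ) * (P.Ω / m * t) = 2 * P.Ω * t := by push_cast; field_simp
  have h1 : (m : ℝ) * (P.Ω / m * t) = P.Ω * t := by field_simp
  have h3 : ((3 * m : ℕ) : ℝ) * (P.Ω / m * t) = 3 * P.Ω * t := by push_cast; field_simp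
  simp only [harmonic, h1, h2, h3, ← hmode]
  simp only [perturbation, momentC, momentS, quadC, quadS, posX, posY, wavePhi, wavePsi, drift,
    Prod.mk_add_mk, add_zero]
  ring

/-- The averaged perturbing function contains the harmonics `2m`, `m` and `3m` only. -/
lemma averaged_eq (hΩ : 0 < P.Ω) (hm : m ≠ 0) {L G l g : ℝ}
    (hz : ((L, G, l, g) : Delaunay) ∈ ellipses) :
    averaged P δ m (L, G, l, g) = π * m * P.Ω * semimajor P.k L ^ 2 *
      (coeffU (2 * m) (eccentricity L G) * cos (2 * g + 2 * m * l) +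
        δ / 2 * ((P.α - P.β) * coeffU m (eccentricity L G) * cos (2 * g + m * l) +
          (P.α + P.β) * coeffU (3 * m) (eccentricity L G) * cos (2 * g + 3 * m * l))) := by
  have hm' : (m : ℝ) ≠ 0 := Nat.cast_ne_zero.2 hm
  obtain ⟨h0, h1⟩ := eccentricity_mem hz.1 hz.2.1 hz.2.2
  set e := eccentricity L G with he
  have hcX := continuous_orbX h0.le h1
  have hcY := continuous_orbY h0.le h1
  have hc : ∀ n, Continuous (harmonic e l g n) := fun n => by unfold harmonic; fun_prop
  have hI : ∀ n : ℕ, n ≠ 0 → ∫ τ in (0 : ℝ)..(2 * π), harmonic e l g n τ =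
      π * coeffU n e * cos (2 * g + n * l) := fun n hn => integral_orb hn h0 h1 l g
  obtain ⟨H, hH⟩ : ∃ H : ℝ → ℝ, H = fun τ => semimajor P.k L ^ 2 * P.Ω ^ 2 *
      (harmonic e l g (2 * m) τ + δ / 2 * ((P.α - P.β) * harmonic e l g m τ +
        (P.α + P.β) * harmonic e l g (3 * m) τ)) := ⟨_, rfl⟩
  have hpert : ∀ t, perturbation P δ t ((L, G, l, g) + drift P m t) = H (P.Ω / m * t) := fun t => by
    rw [perturbation_eq_harmonics P δ hm, hH]
  simp only [averaged, hpert]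
  rw [intervalIntegral.integral_comp_mul_left _ (by positivity), mul_zero,
    show P.Ω / m * resPeriod P m = 2 * π by rw [resPeriod]; field_simp, hH,
    intervalIntegral.integral_const_mul, intervalIntegral.integral_add
      ((hc _).intervalIntegrable _ _) (Continuous.intervalIntegrable (by fun_prop) _ _),
    intervalIntegral.integral_const_mul, intervalIntegral.integral_add
      (Continuous.intervalIntegrable (by fun_prop) _ _)
      (Continuous.intervalIntegrable (by fun_prop) _ _),
    intervalIntegral.integral_const_mul, intervalIntegral.integral_const_mul,
    hI _ (by omega), hI _ hm, hI _ (by omega), smul_eq_mul]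
  push_cast
  field_simp

/-! ### The bifurcation equations -/

/-- The gradient of the reduced averaged function with respect to the eccentricity and the resonant
angles `ξ = 2g + 2mℓ`, `η = 2g + mℓ`; the last component is divided by `δ / 2`, so that the system
stays nondegenerate at `δ = 0`. -/
noncomputable def bifurcation (P : Params) (m : ℕ) (q : (ℝ × ℝ × ℝ) × ℝ) : ℝ × ℝ × ℝ :=
  (deriv (coeffU (2 * m)) q.1.1 * cos q.1.2.1 +
      q.2 / 2 * ((P.α - P.β) * deriv (coeffU m) q.1.1 * cos q.1.2.2 +
        (P.α + P.β) * deriv (coeffU (3 * m)) q.1.1 * cos (2 * q.1.2.1 - q.1.2.2)),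
    -coeffU (2 * m) q.1.1 * sin q.1.2.1 -
      q.2 * ((P.α + P.β) * coeffU (3 * m) q.1.1 * sin (2 * q.1.2.1 - q.1.2.2)),
    -(P.α - P.β) * coeffU m q.1.1 * sin q.1.2.2 +
      (P.α + P.β) * coeffU (3 * m) q.1.1 * sin (2 * q.1.2.1 - q.1.2.2))

lemma contDiffAt_deriv_coeffU {ν : ℕ} (hν : ν ≠ 0) {e : ℝ} (h0 : 0 < e) (h1 : e < 1) :
    ContDiffAt ℝ 1 (deriv (coeffU ν)) e :=
  ((contDiffAt_coeffU hν h0 h1).fderiv_right (m := 1) (by norm_cast)).clm_apply contDiffAt_const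

lemma contDiffAt_bifurcation (hm : m ≠ 0) {q : (ℝ × ℝ × ℝ) × ℝ} (h0 : 0 < q.1.1) (h1 : q.1.1 < 1) :
    ContDiffAt ℝ 1 (bifurcation P m) q := by
  have hU : ∀ ν : ℕ, ν ≠ 0 → ContDiffAt ℝ 1 (fun q : (ℝ × ℝ × ℝ) × ℝ => coeffU ν q.1.1) q :=
    fun ν hν => ContDiffAt.comp (f := fun q : (ℝ × ℝ × ℝ) × ℝ => q.1.1) q
      ((contDiffAt_coeffU hν h0 h1).of_le (by exact_mod_cast le_top)) (by fun_prop)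
  have hU' : ∀ ν : ℕ, ν ≠ 0 →
      ContDiffAt ℝ 1 (fun q : (ℝ × ℝ × ℝ) × ℝ => deriv (coeffU ν) q.1.1) q :=
    fun ν hν => ContDiffAt.comp (f := fun q : (ℝ × ℝ × ℝ) × ℝ => q.1.1) q
      (contDiffAt_deriv_coeffU hν h0 h1) (by fun_prop)
  have a1 := hU m hm
  have a2 := hU (2 * m) (by omega)
  have a3 := hU (3 * m) (by omega)
  have b1 := hU' m hm
  have b2 := hU' (2 * m) (by omega)
  have b3 := hU' (3 * m) (by omega)
  unfold bifurcation
  fun_prop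

/-- The implicit function theorem, with nondegeneracy propagated along the curve. -/
lemma exists_nondegenerate_curve {E : Type*} [NormedAddCommGroup E] [NormedSpace ℝ E]
    [FiniteDimensional ℝ E] {Φ : E × ℝ → E} {x₀ : E} (h : ContDiffAt ℝ 1 Φ (x₀, 0))
    (h0 : Φ (x₀, 0) = 0) (hinj : ∀ v, fderiv ℝ Φ (x₀, 0) (v, 0) = 0 → v = 0) {O : Set E}
    (hO : IsOpen O) (hx₀ : x₀ ∈ O) :
    ∃ δ₀ > 0, ∃ ψ : ℝ → E, ContinuousOn ψ (Ioo (-δ₀) δ₀) ∧ ψ 0 = x₀ ∧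
      ∀ δ ∈ Ioo (-δ₀) δ₀, ψ δ ∈ O ∧ Φ (ψ δ, δ) = 0 ∧
        ∀ v, fderiv ℝ Φ (ψ δ, δ) (v, 0) = 0 → v = 0 := by
  have : CompleteSpace E := FiniteDimensional.complete ℝ E
  let ι := ContinuousLinearMap.inl ℝ E ℝ
  have hinj' : Function.Injective ((fderiv ℝ Φ (x₀, 0)).comp ι : E →ₗ[ℝ] E) :=
    (injective_iff_map_eq_zero _).2 hinj
  have hsurj := LinearMap.injective_iff_surjective.1 hinj'
  obtain ⟨δ₁, hδ₁, ψ, hψc, hψ0, hψ⟩ := exists_continuous_implicit_curve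
    (h.hasStrictFDerivAt one_ne_zero) h0 hinj hsurj
  let e₀ : E ≃L[ℝ] E := ContinuousLinearEquiv.ofBijective ((fderiv ℝ Φ (x₀, 0)).comp ι)
    (LinearMap.ker_eq_bot.2 hinj') (LinearMap.range_eq_top.2 hsurj)
  have he₀ : (e₀ : E →L[ℝ] E) = (fderiv ℝ Φ (x₀, 0)).comp ι := by ext; rfl
  have hcont : ContinuousAt (fun q => (fderiv ℝ Φ q).comp ι) (x₀, 0) :=
    (h.fderiv_right (m := 0) le_rfl).continuousAt.clm_comp continuousAt_const
  have hinv : ∀ᶠ q in 𝓝 (x₀, (0 : ℝ)),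
      (fderiv ℝ Φ q).comp ι ∈ range ((↑) : (E ≃L[ℝ] E) → E →L[ℝ] E) :=
    hcont.eventually (by
      change _ ∈ 𝓝 ((fderiv ℝ Φ (x₀, 0)).comp ι)
      rw [← he₀]; exact e₀.nhds)
  have hψ0c : ContinuousAt ψ 0 := hψc.continuousAt (Ioo_mem_nhds (by linarith) hδ₁)
  have hpair : Tendsto (fun δ => (ψ δ, δ)) (𝓝 0) (𝓝 (x₀, 0)) := by
    have := hψ0c.prodMk continuousAt_id
    rw [ContinuousAt, hψ0] at this
    exact this
  have hev : ∀ᶠ δ in 𝓝 (0 : ℝ), ψ δ ∈ O ∧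
      (fderiv ℝ Φ (ψ δ, δ)).comp ι ∈ range ((↑) : (E ≃L[ℝ] E) → E →L[ℝ] E) :=
    (hψ0c.eventually (by rw [hψ0]; exact hO.mem_nhds hx₀)).and (hpair.eventually hinv)
  obtain ⟨δ₂, hδ₂, hev⟩ := Metric.eventually_nhds_iff.1 hev
  refine ⟨min δ₁ δ₂, lt_min hδ₁ hδ₂, ψ, hψc.mono ?_, hψ0, fun δ hδ => ?_⟩
  · exact Ioo_subset_Ioo (neg_le_neg (min_le_left _ _)) (min_le_left _ _)
  obtain ⟨h1, E', hE'⟩ := hev (y := δ) (by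
    rw [Real.dist_eq, sub_zero, abs_lt]
    exact ⟨by linarith [hδ.1, min_le_right δ₁ δ₂], by linarith [hδ.2, min_le_right δ₁ δ₂]⟩)
  refine ⟨h1, hψ δ ⟨by linarith [hδ.1, min_le_left δ₁ δ₂], by linarith [hδ.2, min_le_left δ₁ δ₂]⟩,
    fun v hv => ?_⟩
  have : E' v = 0 := by
    have h2 := DFunLike.congr_fun hE' v
    exact h2.trans hv
  exact (map_eq_zero_iff E' E'.injective).1 this

/-- The linearization of the bifurcation equations at `δ = 0`. -/
lemma fderiv_bifurcation (hm : m ≠ 0) {e ξ η : ℝ} (h0 : 0 < e) (h1 : e < 1) (v : ℝ × ℝ × ℝ) :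
    fderiv ℝ (bifurcation P m) ((e, ξ, η), 0) (v, 0) =
      (deriv (deriv (coeffU (2 * m))) e * v.1 * cos ξ - deriv (coeffU (2 * m)) e * sin ξ * v.2.1,
        -deriv (coeffU (2 * m)) e * v.1 * sin ξ - coeffU (2 * m) e * cos ξ * v.2.1,
        -(P.α - P.β) * (deriv (coeffU m) e * v.1 * sin η + coeffU m e * cos η * v.2.2) +
          (P.α + P.β) * (deriv (coeffU (3 * m)) e * v.1 * sin (2 * ξ - η) +
            coeffU (3 * m) e * cos (2 * ξ - η) * (2 * v.2.1 - v.2.2))) := by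
  obtain ⟨v₁, v₂, v₃⟩ := v
  have hd := (contDiffAt_bifurcation (P := P) hm (q := ((e, ξ, η), 0)) h0 h1).differentiableAt
    one_ne_zero
  have l1 : HasDerivAt (fun s : ℝ => e + s * v₁) v₁ 0 := by
    simpa using ((hasDerivAt_id (0 : ℝ)).mul_const v₁).const_add e
  have l2 : HasDerivAt (fun s : ℝ => ξ + s * v₂) v₂ 0 := by
    simpa using ((hasDerivAt_id (0 : ℝ)).mul_const v₂).const_add ξ
  have l3 : HasDerivAt (fun s : ℝ => η + s * v₃) v₃ 0 := by
    simpa using ((hasDerivAt_id (0 : ℝ)).mul_const v₃).const_add η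
  have hcurve : HasDerivAt (fun s : ℝ => (((e + s * v₁, ξ + s * v₂, η + s * v₃), 0) :
      (ℝ × ℝ × ℝ) × ℝ)) ((v₁, v₂, v₃), 0) 0 :=
    (l1.prodMk (l2.prodMk l3)).prodMk (hasDerivAt_const _ _)
  have k1 := HasFDerivAt.comp_hasDerivAt_of_eq (0 : ℝ) hd.hasFDerivAt hcurve (by simp)
  have hU : ∀ ν : ℕ, ν ≠ 0 →
      HasDerivAt (fun s : ℝ => coeffU ν (e + s * v₁)) (deriv (coeffU ν) e * v₁) 0 := fun ν hν =>
    HasDerivAt.comp_of_eq (0 : ℝ)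
      ((contDiffAt_coeffU hν h0 h1).differentiableAt (by simp)).hasDerivAt l1 (by simp)
  have hU' : HasDerivAt (fun s : ℝ => deriv (coeffU (2 * m)) (e + s * v₁))
      (deriv (deriv (coeffU (2 * m))) e * v₁) 0 :=
    HasDerivAt.comp_of_eq (0 : ℝ) ((contDiffAt_deriv_coeffU (ν := 2 * m) (by omega) h0
      h1).differentiableAt one_ne_zero).hasDerivAt l1 (by simp)
  have l4 := (l2.const_mul 2).sub l3
  have c1 := hU'.mul l2.cos
  have c2 := (hU (2 * m) (by omega)).neg.mul l2.sin
  have c3 := (((hU m hm).const_mul (-(P.α - P.β))).mul l3.sin).add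
    (((hU (3 * m) (by omega)).const_mul (P.α + P.β)).mul l4.sin)
  have k2 := c1.prodMk (c2.prodMk c3)
  have k3 := k1.unique (k2.congr_of_eventuallyEq (Eventually.of_forall fun s => by
    simp [bifurcation]))
  rw [k3]
  simp
  refine ⟨?_, ?_, ?_⟩ <;> ring

/-- The bifurcation equations are nondegenerate at the points of the theorem. -/
lemma bifurcation_nondegenerate (hm : m ≠ 0) {e ξ η : ℝ} (h0 : 0 < e) (h1 : e < 1)
    (hη : sin η = 0)
    (hZ : (sin ξ = 0 ∧ deriv (coeffU (2 * m)) e = 0 ∧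
        (P.α - P.β) * coeffU m e + (P.α + P.β) * coeffU (3 * m) e ≠ 0) ∨
      (cos ξ = 0 ∧ coeffU (2 * m) e = 0 ∧
        (P.α - P.β) * coeffU m e - (P.α + P.β) * coeffU (3 * m) e ≠ 0)) :
    bifurcation P m ((e, ξ, η), 0) = 0 ∧
      ∀ v, fderiv ℝ (bifurcation P m) ((e, ξ, η), 0) (v, 0) = 0 → v = 0 := by
  have hcη : cos η ≠ 0 := fun h => by
    have := sin_sq_add_cos_sq η
    rw [hη, h] at this; norm_num at this
  have hsin : sin (2 * ξ - η) = 2 * sin ξ * cos ξ * cos η := by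
    rw [sin_sub, hη, sin_two_mul]; ring
  have hcos : cos (2 * ξ - η) = (cos ξ ^ 2 - sin ξ ^ 2) * cos η := by
    rw [cos_sub, hη, cos_two_mul']; ring
  have hsc := sin_sq_add_cos_sq ξ
  constructor
  · rcases hZ with ⟨hs, hU, -⟩ | ⟨hc, hU, -⟩
    · simp [bifurcation, hsin, hη, hs, hU]
    · simp [bifurcation, hsin, hη, hc, hU]
  · rintro ⟨v₁, v₂, v₃⟩ hv
    rw [fderiv_bifurcation hm h0 h1] at hv
    simp only [Prod.ext_iff, Prod.fst_zero, Prod.snd_zero, hsin, hcos, hη] at hv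
    obtain ⟨e1, e2, e3⟩ := hv
    rcases hZ with ⟨hs, hU, hne⟩ | ⟨hc, hU, hne⟩
    · rw [hs] at e1 e2 e3 hsc
      have hcξ : cos ξ ≠ 0 := fun h => by rw [h] at hsc; norm_num at hsc
      have hU0 : coeffU (2 * m) e ≠ 0 := fun h => deriv_coeffU_ne_zero (by omega) h0 h1 h hU
      have hU2 := deriv_deriv_coeffU_ne_zero (ν := 2 * m) (by omega) h0 h1 hU
      rw [hU] at e1 e2
      have hv1 : v₁ = 0 := by simpa [hcξ, hU2] using e1
      have hv2 : v₂ = 0 := by simpa [hcξ, hU0] using e2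
      have hc2 : cos ξ ^ 2 = 1 := by linarith
      rw [hv1, hv2, hc2] at e3
      have : ((P.α - P.β) * coeffU m e + (P.α + P.β) * coeffU (3 * m) e) * cos η * v₃ = 0 := by
        linear_combination -e3
      have hv3 : v₃ = 0 := by simpa [hne, hcη] using this
      rw [hv1, hv2, hv3]; rfl
    · rw [hc] at e1 e2 e3 hsc
      have hsξ : sin ξ ≠ 0 := fun h => by rw [h] at hsc; norm_num at hsc
      have hU1 := deriv_coeffU_ne_zero (ν := 2 * m) (by omega) h0 h1 hU
      rw [hU] at e2
      have hv1 : v₁ = 0 := by simpa [hsξ, hU1] using e2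
      have hv2 : v₂ = 0 := by simpa [hsξ, hU1] using e1
      have hs2 : sin ξ ^ 2 = 1 := by linarith
      rw [hv1, hv2, hs2] at e3
      have : ((P.α - P.β) * coeffU m e - (P.α + P.β) * coeffU (3 * m) e) * cos η * v₃ = 0 := by
        linear_combination -e3
      have hv3 : v₃ = 0 := by simpa [hne, hcη] using this
      rw [hv1, hv2, hv3]; rfl

end

/-! ### Continuation -/

section

variable {P : Params} {δ : ℝ} {m : ℕ}

/-- The eccentricity and the resonant angles `ξ = 2g + 2mℓ`, `η = 2g + mℓ`, as functions of
`(G, ℓ, g)`. -/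
noncomputable def resonantCoords (m : ℕ) (L : ℝ) (y : ℝ × ℝ × ℝ) : ℝ × ℝ × ℝ :=
  (eccentricity L y.1, 2 * y.2.2 + 2 * m * y.2.1, 2 * y.2.2 + m * y.2.1)

/-- The inverse of `resonantCoords` on the branch where `G` has the sign `σ = ±1`. -/
noncomputable def resonantCoordsInv (m : ℕ) (L σ : ℝ) (x : ℝ × ℝ × ℝ) : ℝ × ℝ × ℝ :=
  (σ * L * sqrt (1 - x.1 ^ 2), (x.2.1 - x.2.2) / m, (2 * x.2.2 - x.2.1) / 2)

lemma hasDerivAt_eccentricity {L G : ℝ} (hL : 0 < L) (hGL : |G| < L) :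
    HasDerivAt (eccentricity L) (-G / (L ^ 2 * eccentricity L G)) G := by
  have hpos := one_sub_sq_div_pos hL hGL
  have h : HasDerivAt (fun x : ℝ => 1 - x ^ 2 / L ^ 2) (-(2 * G / L ^ 2)) G := by
    simpa using (((hasDerivAt_id G).pow 2).div_const (L ^ 2)).const_sub 1
  refine (h.sqrt hpos.ne').congr_deriv ?_
  have he : 0 < eccentricity L G := sqrt_pos.2 hpos
  change -(2 * G / L ^ 2) / (2 * eccentricity L G) = _
  field_simp

lemma resonantCoords_inv (hm : m ≠ 0) {L σ : ℝ} (hL : 0 < L) (hσ : σ ^ 2 = 1) {x : ℝ × ℝ × ℝ}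
    (h0 : 0 < x.1) (h1 : x.1 < 1) : resonantCoords m L (resonantCoordsInv m L σ x) = x := by
  have hm' : (m : ℝ) ≠ 0 := Nat.cast_ne_zero.2 hm
  have hs : sqrt (1 - x.1 ^ 2) ^ 2 = 1 - x.1 ^ 2 := sq_sqrt (by nlinarith)
  refine Prod.ext ?_ (Prod.ext ?_ ?_)
  · simp only [resonantCoords, resonantCoordsInv, eccentricity, mul_pow, hσ, hs, one_mul]
    rw [mul_div_cancel_left₀ _ (pow_pos hL 2).ne', sub_sub_cancel, sqrt_sq h0.le]
  · simp only [resonantCoords, resonantCoordsInv]; field_simp; ring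
  · simp only [resonantCoords, resonantCoordsInv]; field_simp; ring

lemma resonantCoordsInv_mem {L σ : ℝ} (hL : 0 < L) (hσ : σ ^ 2 = 1) {x : ℝ × ℝ × ℝ}
    (h0 : 0 < x.1) (h1 : x.1 < 1) : ((L, resonantCoordsInv m L σ x) : Delaunay) ∈ ellipses := by
  have hs : 0 < sqrt (1 - x.1 ^ 2) := sqrt_pos.2 (by nlinarith)
  have hs1 : sqrt (1 - x.1 ^ 2) < 1 := by
    rw [sqrt_lt' one_pos]; nlinarith
  have hσ0 : σ ≠ 0 := fun h => by rw [h] at hσ; norm_num at hσ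
  have habs : |σ| = 1 := (pow_eq_one_iff_of_nonneg (abs_nonneg σ) two_ne_zero).1
    (by rw [sq_abs, hσ])
  refine ⟨hL, mul_ne_zero (mul_ne_zero hσ0 hL.ne') hs.ne', ?_⟩
  simp only [resonantCoordsInv, abs_mul, habs, abs_of_pos hL, abs_of_pos hs]
  nlinarith

/-- A nondegenerate zero of the bifurcation equations with `δ ≠ 0` is continuable. -/
lemma continuable_of_bifurcation (hk : 0 < P.k) (hΩ : 0 < P.Ω) (hm : m ≠ 0) (hδ : δ ≠ 0)
    {L : ℝ} {y₀ : ℝ × ℝ × ℝ} (hz₀ : ((L, y₀) : Delaunay) ∈ ellipses)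
    (hres : L ^ 3 = m * P.k ^ 2 / P.Ω)
    (h0 : bifurcation P m (resonantCoords m L y₀, δ) = 0)
    (hinj : ∀ v, fderiv ℝ (bifurcation P m) (resonantCoords m L y₀, δ) (v, 0) = 0 → v = 0) :
    Continuable P δ m (L, y₀) := by
  have hm' : (m : ℝ) ≠ 0 := Nat.cast_ne_zero.2 hm
  have hL : 0 < L := hz₀.1
  set C : ℝ := π * m * P.Ω * semimajor P.k L ^ 2 with hC
  have hC0 : C ≠ 0 := by
    rw [hC, semimajor]
    have := hk.ne'
    have := hΩ.ne'
    have := pi_ne_zero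
    positivity
  set Q : ℝ × ℝ × ℝ → ℝ × ℝ × ℝ := fun y => bifurcation P m (resonantCoords m L y, δ) with hQ
  set ρ : ℝ → ℝ := fun G => -G / (L ^ 2 * eccentricity L G) with hρ
  set γ : ℝ × ℝ × ℝ → ℝ × ℝ × ℝ := fun y => (C * (ρ y.1 * (Q y).1),
    C * (2 * m * (Q y).2.1 + m * (δ / 2) * (Q y).2.2),
    C * (2 * (Q y).2.1 + δ * (Q y).2.2)) with hγ
  set w : ℝ × ℝ × ℝ → ℝ := fun y => C * (coeffU (2 * m) (eccentricity L y.1) *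
    cos (2 * y.2.2 + 2 * m * y.2.1) + δ / 2 * ((P.α - P.β) * coeffU m (eccentricity L y.1) *
      cos (2 * y.2.2 + m * y.2.1) + (P.α + P.β) * coeffU (3 * m) (eccentricity L y.1) *
        cos (2 * y.2.2 + 3 * m * y.2.1))) with hw
  obtain ⟨he0, he1⟩ := eccentricity_mem hL hz₀.2.1 hz₀.2.2
  have hρ0 : ρ y₀.1 ≠ 0 := div_ne_zero (neg_ne_zero.2 hz₀.2.1) (by positivity)
  have hecc := hasDerivAt_eccentricity hL hz₀.2.2
  have hQ0 : Q y₀ = 0 := h0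
  -- the resonant coordinates along a line
  have hX : ∀ c : ℝ × ℝ × ℝ, HasDerivAt (fun s : ℝ => resonantCoords m L (y₀ + s • c))
      (ρ y₀.1 * c.1, 2 * c.2.2 + 2 * m * c.2.1, 2 * c.2.2 + m * c.2.1) 0 := by
    rintro ⟨c₁, c₂, c₃⟩
    have l : ∀ a b : ℝ, HasDerivAt (fun s : ℝ => a + s * b) b 0 := fun a b => by
      simpa using ((hasDerivAt_id (0 : ℝ)).mul_const b).const_add a
    have k1 := HasDerivAt.comp_of_eq (0 : ℝ) hecc (l y₀.1 c₁) (by simp)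
    exact k1.prodMk
      ((((l y₀.2.2 c₃).const_mul 2).add ((l y₀.2.1 c₂).const_mul (2 * (m : ℝ)))).prodMk (
      ((l y₀.2.2 c₃).const_mul 2).add ((l y₀.2.1 c₂).const_mul (m : ℝ))))
  have hXd : DifferentiableAt ℝ (resonantCoords m L) y₀ := by
    have : DifferentiableAt ℝ (fun y : ℝ × ℝ × ℝ => eccentricity L y.1) y₀ :=
      DifferentiableAt.comp (f := fun y : ℝ × ℝ × ℝ => y.1) y₀ hecc.differentiableAt (by fun_prop)
    unfold resonantCoords
    fun_prop
  have hΦ := (contDiffAt_bifurcation (P := P) hm (q := (resonantCoords m L y₀, δ)) he0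
    he1).differentiableAt one_ne_zero
  have hQd : DifferentiableAt ℝ Q y₀ :=
    DifferentiableAt.comp (f := fun y => (resonantCoords m L y, δ)) y₀ hΦ
      (hXd.prodMk (differentiableAt_const δ))
  have hQline : ∀ c : ℝ × ℝ × ℝ, fderiv ℝ Q y₀ c = fderiv ℝ (bifurcation P m)
      (resonantCoords m L y₀, δ)
      ((ρ y₀.1 * c.1, 2 * c.2.2 + 2 * m * c.2.1, 2 * c.2.2 + m * c.2.1), 0) := by
    intro c
    have hline : HasDerivAt (fun s : ℝ => y₀ + s • c) c 0 := by
      simpa using ((hasDerivAt_id (0 : ℝ)).smul_const c).const_add y₀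
    have k1 := HasFDerivAt.comp_hasDerivAt_of_eq (0 : ℝ) hQd.hasFDerivAt hline (by simp)
    have k2 := HasFDerivAt.comp_hasDerivAt_of_eq (0 : ℝ) hΦ.hasFDerivAt
      ((hX c).prodMk (hasDerivAt_const (0 : ℝ) δ)) (by simp)
    exact k1.unique k2
  have hρd : DifferentiableAt ℝ (fun y : ℝ × ℝ × ℝ => ρ y.1) y₀ := by
    have : DifferentiableAt ℝ ρ y₀.1 :=
      (differentiableAt_id.neg).div ((differentiableAt_const _).mul hecc.differentiableAt)
        (by positivity)
    exact DifferentiableAt.comp (f := fun y : ℝ × ℝ × ℝ => y.1) y₀ this (by fun_prop)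
  have hγd : DifferentiableAt ℝ γ y₀ := by
    have q1 := hQd.fst
    have q2 := hQd.snd.fst
    have q3 := hQd.snd.snd
    exact ((hρd.mul q1).const_mul C).prodMk
      ((((q2.const_mul (2 * (m : ℝ))).add (q3.const_mul (m * (δ / 2)))).const_mul C).prodMk
        (((q2.const_mul 2).add (q3.const_mul δ)).const_mul C))
  refine continuable_of_nondegenerate hk hΩ hm hz₀ hres (w := w) (γ := γ)
    (fun y hy => ?_) (fun y hy => ?_) ?_ hγd.hasFDerivAt fun c hc => ?_
  · exact averaged_eq hΩ hm hy
  · obtain ⟨G, l, g⟩ := y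
    obtain ⟨h0', h1'⟩ := eccentricity_mem hL hy.2.1 hy.2.2
    have hG := hasDerivAt_eccentricity hL hy.2.2
    have hU : ∀ ν : ℕ, ν ≠ 0 → HasDerivAt (fun x => coeffU ν (eccentricity L x))
        (deriv (coeffU ν) (eccentricity L G) * ρ G) G := fun ν hν =>
      ((contDiffAt_coeffU hν h0' h1').differentiableAt (by simp)).hasDerivAt.comp G hG
    have hangle : 2 * (2 * g + 2 * m * l) - (2 * g + m * l) = 2 * g + 3 * m * l := by ring
    have hl : ∀ a : ℝ, HasDerivAt (fun x : ℝ => 2 * g + a * x) a l := fun a => by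
      simpa using ((hasDerivAt_id l).const_mul a).const_add (2 * g)
    have hg : ∀ a : ℝ, HasDerivAt (fun x : ℝ => 2 * x + a) 2 g := fun a => by
      simpa using ((hasDerivAt_id g).const_mul 2).add_const a
    simp only [hγ, hQ, hw, bifurcation, resonantCoords, hangle]
    refine ⟨?_, ?_, ?_⟩
    · refine ((((hU (2 * m) (by omega)).mul_const _).add
        ((((hU m hm).const_mul _).mul_const _ |>.add
          (((hU (3 * m) (by omega)).const_mul _).mul_const _)).const_mul (δ / 2))).const_mul
            C).congr_deriv ?_
      ring
    · refine ((((hl (2 * m)).cos.const_mul _).add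
        ((((hl m).cos.const_mul _).add ((hl (3 * m)).cos.const_mul _)).const_mul
          (δ / 2))).const_mul C).congr_deriv ?_
      ring
    · refine ((((hg _).cos.const_mul _).add
        ((((hg _).cos.const_mul _).add ((hg _).cos.const_mul _)).const_mul
          (δ / 2))).const_mul C).congr_deriv ?_
      ring
  · simp [hγ, hQ0]
  · -- at a zero of `Q` only the derivative of `Q` contributes
    set r := fderiv ℝ Q y₀ c with hr
    have hline : HasDerivAt (fun s : ℝ => y₀ + s • c) c 0 := by
      simpa using ((hasDerivAt_id (0 : ℝ)).smul_const c).const_add y₀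
    have k1 := HasFDerivAt.comp_hasDerivAt_of_eq (0 : ℝ) hγd.hasFDerivAt hline (by simp)
    have kQ : HasDerivAt (fun s : ℝ => Q (y₀ + s • c)) r 0 :=
      HasFDerivAt.comp_hasDerivAt_of_eq (0 : ℝ) hQd.hasFDerivAt hline (by simp)
    have kρ : HasDerivAt (fun s : ℝ => ρ (y₀ + s • c).1) _ 0 :=
      HasFDerivAt.comp_hasDerivAt_of_eq (0 : ℝ) hρd.hasFDerivAt hline (by simp)
    have q1 := hasDerivAt_prod_fst kQ
    have q2 := hasDerivAt_prod_fst (hasDerivAt_prod_snd kQ)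
    have q3 := hasDerivAt_prod_snd (hasDerivAt_prod_snd kQ)
    have k2 := ((kρ.mul q1).const_mul C).prodMk
      ((((q2.const_mul (2 * (m : ℝ))).add (q3.const_mul (m * (δ / 2)))).const_mul C).prodMk
        (((q2.const_mul 2).add (q3.const_mul δ)).const_mul C))
    have k3 := k1.unique k2
    rw [hc] at k3
    simp only [zero_smul, add_zero, hQ0, Prod.fst_zero, mul_zero, zero_add, Prod.ext_iff,
      Prod.snd_zero] at k3
    obtain ⟨e1, e2, e3⟩ := k3
    have r1 : r.1 = 0 := by simpa [hC0, hρ0] using e1.symm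
    have e2' : 2 * m * r.2.1 + m * (δ / 2) * r.2.2 = 0 := (mul_eq_zero.1 e2.symm).resolve_left hC0
    have e3' : 2 * r.2.1 + δ * r.2.2 = 0 := (mul_eq_zero.1 e3.symm).resolve_left hC0
    have r3 : r.2.2 = 0 := by
      have : m * δ * r.2.2 = 0 := by linear_combination 2 * m * e3' - 2 * e2'
      simpa [hm, hδ] using this
    have r2 : r.2.1 = 0 := by rw [r3] at e3'; linarith
    have hr0 : r = 0 := Prod.ext r1 (Prod.ext r2 r3)
    rw [hr, hQline] at hr0
    have hv := hinj _ hr0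
    simp only [Prod.ext_iff, Prod.fst_zero, Prod.snd_zero] at hv ⊢
    obtain ⟨v1, v2, v3⟩ := hv
    have c2 : c.2.1 = 0 := by
      have : m * c.2.1 = 0 := by linear_combination v2 - v3
      simpa [hm] using this
    exact ⟨by simpa [hρ0] using v1, c2, by rw [c2] at v3; linarith⟩

lemma sin_eq_zero_of_angle {x : ℝ} (h : (x : Real.Angle) = ((0 : ℝ) : Real.Angle) ∨
    (x : Real.Angle) = (π : Real.Angle)) : sin x = 0 := by
  rw [← Real.Angle.sin_coe]
  rcases h with h | h <;> rw [h, Real.Angle.sin_coe] <;> simp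

lemma cos_eq_zero_of_angle {x : ℝ} (h : (x : Real.Angle) = ((π / 2 : ℝ) : Real.Angle) ∨
    (x : Real.Angle) = ((3 * π / 2 : ℝ) : Real.Angle)) : cos x = 0 := by
  rw [← Real.Angle.cos_coe]
  rcases h with h | h <;> rw [h, Real.Angle.cos_coe]
  · exact cos_pi_div_two
  · rw [show 3 * π / 2 = π / 2 + π by ring, cos_add_pi, cos_pi_div_two, neg_zero]

end

end KeplerWave

open KeplerWave
theorem theorem2 (P : Params) (hk : 0 < P.k) (hΩ : 0 < P.Ω) (m : ℕ) (hm : 1 ≤ m)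
    (L G l g : ℝ) (hell : (L, G, l, g) ∈ ellipses)
    (hres : L ^ 3 = m * P.k ^ 2 / P.Ω)
    (hZ :
      ((eccentricity L G, l, g) ∈ Z1plus m ∪ Z1minus m ∧
        (P.α - P.β) * coeffU m (eccentricity L G) +
          (P.α + P.β) * coeffU (3 * m) (eccentricity L G) ≠ 0) ∨
      ((eccentricity L G, l, g) ∈ Z2plus m ∪ Z2minus m ∧
        (P.α - P.β) * coeffU m (eccentricity L G) -
          (P.α + P.β) * coeffU (3 * m) (eccentricity L G) ≠ 0))
    (hzero : Real.sin (2 * g + m * l) = 0) :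
    ∃ δ₀ > 0, ∃ Υ : ℝ → Delaunay,
      ContinuousOn Υ (Set.Ioo (-δ₀) δ₀) ∧ Υ 0 = (L, G, l, g) ∧
      ∀ δ ∈ Set.Ioo (-δ₀) δ₀, δ ≠ 0 →
        (Υ δ).1 = L ∧ Continuable P δ m (Υ δ) := by
  have hm0 : m ≠ 0 := by omega
  have hm' : (m : ℝ) ≠ 0 := Nat.cast_ne_zero.2 hm0
  obtain ⟨hL, hG, hGL⟩ := hell
  simp only at hL hG hGL
  obtain ⟨h0, h1⟩ := eccentricity_mem hL hG hGL
  obtain ⟨hb0, hbinj⟩ := bifurcation_nondegenerate (P := P) (m := m)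
    (ξ := 2 * g + 2 * m * l) (η := 2 * g + m * l) hm0 h0 h1 hzero (by
      rcases hZ with ⟨h, hne⟩ | ⟨h, hne⟩
      · refine Or.inl ⟨sin_eq_zero_of_angle (h.imp And.left And.left), ?_, hne⟩
        exact h.elim And.right And.right
      · refine Or.inr ⟨cos_eq_zero_of_angle (h.imp And.left And.left), ?_, hne⟩
        exact h.elim And.right And.right)
  obtain ⟨δ₀, hδ₀, ψ, hψc, hψ0, hψ⟩ := exists_nondegenerate_curve
    (contDiffAt_bifurcation (P := P) hm0 h0 h1) hb0 hbinj
    (isOpen_Ioo.preimage continuous_fst) (show (_ : ℝ × ℝ × ℝ) ∈ Prod.fst ⁻¹' Set.Ioo 0 1 from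
      ⟨h0, h1⟩)
  have hσ : (G / |G|) ^ 2 = 1 := by
    rw [div_pow, sq_abs, div_self (pow_ne_zero 2 hG)]
  refine ⟨δ₀, hδ₀, fun δ => (L, resonantCoordsInv m L (G / |G|) (ψ δ)), ?_, ?_,
    fun δ hδ hδ0 => ⟨rfl, ?_⟩⟩
  · have hc : Continuous fun x : ℝ × ℝ × ℝ =>
        ((L, resonantCoordsInv m L (G / |G|) x) : Delaunay) := by
      unfold resonantCoordsInv
      fun_prop
    exact hc.comp_continuousOn hψc
  · have hs : Real.sqrt (1 - eccentricity L G ^ 2) = |G| / L := by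
      rw [eccentricity, Real.sq_sqrt (one_sub_sq_div_pos hL hGL).le, sub_sub_cancel,
        Real.sqrt_div (sq_nonneg G), Real.sqrt_sq_eq_abs, Real.sqrt_sq hL.le]
    have habs : |G| ≠ 0 := abs_ne_zero.2 hG
    simp only [hψ0, resonantCoordsInv, hs, Prod.mk.injEq, true_and]
    refine ⟨?_, ?_, ?_⟩
    · field_simp
    · field_simp; ring
    · ring
  · obtain ⟨⟨hx0, hx1⟩, hz, hinj⟩ := hψ δ hδ
    have hcoord := resonantCoords_inv hm0 hL hσ hx0 hx1
    exact continuable_of_bifurcation hk hΩ hm0 hδ0 (resonantCoordsInv_mem hL hσ hx0 hx1) hres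
      (by rw [hcoord]; exact hz) (by rw [hcoord]; exact hinj)
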